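/- Let $1\le n\le d$ be integers and let $\mu$ be a Radon measure on $\mathbb R^d$ with $\mu(B(x,r))\le C_0 r^n$ for all $x\in\mathbb R^d$, $r>0$. A \emph{cube} is a closed cube of side length $l(Q)>0$ with sides parallel to the axes and center in $\operatorname{supp}\mu$; if $\mu(\mathbb R^d)<\infty$, then $\mathbb R^d$ is also allowed as a cube (with $2^k\mathbb R^d=\mathbb R^d$). For cubes $Q\subset R$ put $$K_{Q,R}=1+\sum_{k=1}^{N_{Q,R}}\frac{\mu(2^kQ)}{l(2^kQ)^n},$$ where $N_{Q,R}$ is the first integer $k\geq 0$ with $l(2^kQ)\ge l(R)$ ($N_{Q,R}=\infty$ if $R=\mathbb R^d\ne Q$; $K_{\mathbb R^d,\mathbb R^d}=1$). Let $\beta_d$ be twice the infimum of the numbers $\beta$ such that, for every Radon measure $\nu$ on $\mathbb R^d$, $\nu$-almost every $x$ is the center of a sequence of cubes $Q_k$ with $l(Q_k)\to0$ and $\nu(2Q_k)\le\beta\,\nu(Q_k)$. A cube $Q$ is \emph{doubling} if $\mu(2Q)\le\beta_d\,\mu(Q)$, and $\widetilde Q=2^NQ$ with the smallest integer $N\ge0$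 for which $2^NQ$ is doubling. Write $m_Qf=\mu(Q)^{-1}\int_Qf\,d\mu$. Functions are real valued and are identified when they agree $\mu$-a.e. \emph{RBMO.} $f\in L^1_{loc}(\mu)$ belongs to $RBMO(\mu)$ if for some $C\ge 0$ $$\int_Q|f-m_{\widetilde Q}f|\,d\mu\le C\,\mu(2Q)\ \text{ for all cubes }Q,\qquad |m_Qf-m_Rf|\le C\,K_{Q,R}\ \text{ for all doubling cubes }Q\subset R;$$ the least such $C$ is $\|f\|_*$, a norm modulo additive constants. \emph{Atomic block spaces.} Let $1<p\le\infty$. A $p$-atomic block is a $b\in L^1(\mu)$ supported in a cube $R$, with $\int b\,d\mu=0$, together with a representation $b=\sum_{j\ge1}\lambda_ja_j$, where $\lambda_j\in\mathbb R$, $a_j$ is supported in a cube $Q_j\subset R$ and $\|a_j\|_{L^p(\mu)}\le\mu(2Q_j)^{1/p-1}K_{Q_j,R}^{-1}$ (with $1/\infty=0$); put $|b|=\sum_j|\lambda_j|$. The space $H^{1,p}_{atb}(\mu)$ consists of the functions $f=\sum_{i\ge1}b_i$ with $p$-atomic blocks $b_i$ such that $\sum_i|b_i|<\infty$ (all series converging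 $\mu$-a.e.), and $\|f\|_{H^{1,p}_{atb}(\mu)}$ is the infimum of $\sum_i|b_i|$ over all such decompositions. \textbf{Theorem.} (1) For $1<p<\infty$, $H^{1,p}_{atb}(\mu)=H^{1,\infty}_{atb}(\mu)$, with equivalent norms; the constants depend only on $d,n,C_0,p$. (2) The dual of $H^{1,\infty}_{atb}(\mu)$ is $RBMO(\mu)$: for every $g\in RBMO(\mu)$ there is exactly one continuous linear functional $L_g$ on $H^{1,\infty}_{atb}(\mu)$ with $L_g(f)=\int fg\,d\mu$ for all bounded $f\in H^{1,\infty}_{atb}(\mu)$ with compact support. The map $g\mapsto L_g$ is linear, its kernel consists of the ($\mu$-a.e.) constant functions, it is onto the dual $H^{1,\infty}_{atb}(\mu)^*$, and $C^{-1}\|g\|_*\le\|L_g\|\le C\|g\|_*$ with $C \geq 1$ depending only on $d,n,C_0$. -/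

import Mathlib

open MeasureTheory Filter Topology Set
open scoped ENNReal NNReal

noncomputable section

namespace NonDoubling

/-- The growth condition `μ(B(x,r)) ≤ C₀ rⁿ` for all `x` and all `r > 0`, with Euclidean balls.
(`Fin d → ℝ` carries the sup distance in Mathlib, so the Euclidean ball is written out.) -/
def Growth {d : ℕ} (n : ℕ) (C₀ : ℝ) (μ : Measure (Fin d → ℝ)) : Prop :=
  ∀ (x : Fin d → ℝ) (r : ℝ), 0 < r →
    μ {y | √(∑ i, (y i - x i) ^ 2) < r} ≤ ENNReal.ofReal (C₀ * r ^ n)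

/-- `β` is such that for every Radon measure `ν` on `ℝᵈ`, `ν`-almost every `x` is the center of a
sequence of `(2,β)`-doubling cubes whose side lengths tend to `0`. -/
def SmallDoublingConst (d : ℕ) (β : ℝ) : Prop :=
  ∀ ν : Measure (Fin d → ℝ), IsLocallyFiniteMeasure ν →
    ∀ᵐ x ∂ν, ∃ l : ℕ → ℝ, (∀ k, 0 < l k) ∧ Tendsto l atTop (𝓝 0) ∧
      ∀ k, ν (Metric.closedBall x (2 * l k / 2)) ≤
        ENNReal.ofReal β * ν (Metric.closedBall x (l k / 2))

/-- The constant `β_d`: twice the infimum of the constants above. -/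
def betaD (d : ℕ) : ℝ := 2 * sInf {β : ℝ | SmallDoublingConst d β}

/-- The cubes: closed cubes with sides parallel to the axes, with center `x ∈ supp μ` and side
length `l > 0`; and, if `μ` is finite, also the whole space. -/
inductive Cube {d : ℕ} (μ : Measure (Fin d → ℝ)) : Type
  | cube (x : Fin d → ℝ) (l : ℝ) (hx : x ∈ μ.support) (hl : 0 < l) : Cube μ
  | whole (h : μ univ < ∞) : Cube μ

variable {d : ℕ} {μ : Measure (Fin d → ℝ)}

/-- The point set of a cube (balls of the sup distance on `Fin d → ℝ` are cubes). -/
def Cube.toSet : Cube μ → Set (Fin d → ℝ)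
  | .cube x l _ _ => Metric.closedBall x (l / 2)
  | .whole _ => univ

/-- The concentric cube `2ᵏ Q`. -/
def Cube.dilate : Cube μ → ℕ → Cube μ
  | .cube x l hx hl, k => .cube x (2 ^ k * l) hx (by positivity)
  | .whole h, _ => .whole h

/-- `Q` is `(2, β_d)`-doubling. -/
def Cube.IsDoubling (Q : Cube μ) : Prop :=
  μ (Q.dilate 1).toSet ≤ ENNReal.ofReal (betaD d) * μ Q.toSet

/-- `Q̃ = 2ᴺ Q` for the smallest `N ≥ 0` such that `2ᴺ Q` is doubling. -/
def Cube.tilde (Q : Cube μ) : Cube μ :=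
  Q.dilate (sInf {N : ℕ | (Q.dilate N).IsDoubling})

/-- The coefficient `K_{Q,R} = 1 + ∑_{k=1}^{N} μ(2ᵏ Q) / l(2ᵏ Q)ⁿ` for `Q ⊆ R`, where `N` is the
first integer `k` with `l(2ᵏ Q) ≥ l(R)`, and `N = ∞` when `R = ℝᵈ ≠ Q`. -/
def coeffK (n : ℕ) : Cube μ → Cube μ → ℝ≥0∞
  | .cube x l _ _, .cube _ s _ _ =>
      1 + ∑ k ∈ Finset.Icc 1 (sInf {k : ℕ | s ≤ 2 ^ k * l}),
        μ (Metric.closedBall x (2 ^ k * l / 2)) / ENNReal.ofReal ((2 ^ k * l) ^ n)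
  | .cube x l _ _, .whole _ =>
      1 + ∑' k : ℕ,
        μ (Metric.closedBall x (2 ^ (k + 1) * l / 2)) / ENNReal.ofReal ((2 ^ (k + 1) * l) ^ n)
  | .whole _, _ => 1

/-! ### The space `RBMO(μ)` -/

/-- `f ∈ L¹_loc(μ)` satisfies the two conditions defining `RBMO(μ)` with the constant `C`.
Here `⨍ y in Q, f y ∂μ` is the mean `m_Q f`. -/
structure IsRBMOWith (n : ℕ) (μ : Measure (Fin d → ℝ)) (C : ℝ≥0) (f : (Fin d → ℝ) → ℝ) :
    Prop where
  locInt : LocallyIntegrable f μ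
  osc : ∀ Q : Cube μ, ∫⁻ x in Q.toSet, ‖f x - ⨍ y in Q.tilde.toSet, f y ∂μ‖ₑ ∂μ ≤
    C * μ (Q.dilate 1).toSet
  reg : ∀ Q R : Cube μ, Q.IsDoubling → R.IsDoubling → Q.toSet ⊆ R.toSet →
    ‖(⨍ y in Q.toSet, f y ∂μ) - ⨍ y in R.toSet, f y ∂μ‖ₑ ≤ C * coeffK n Q R

/-- The minimal constant, `‖f‖_*`. -/
def rbmoNorm (n : ℕ) (μ : Measure (Fin d → ℝ)) (f : (Fin d → ℝ) → ℝ) : ℝ :=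
  ((sInf {C : ℝ≥0 | IsRBMOWith n μ C f} : ℝ≥0) : ℝ)

lemma average_congr' {f g : (Fin d → ℝ) → ℝ} (h : f =ᵐ[μ] g) (s : Set (Fin d → ℝ)) :
    ⨍ y in s, f y ∂μ = ⨍ y in s, g y ∂μ :=
  average_congr (ae_restrict_of_ae h)

lemma IsRBMOWith.congr {n : ℕ} {C : ℝ≥0} {f g : (Fin d → ℝ) → ℝ}
    (hf : IsRBMOWith n μ C f) (h : f =ᵐ[μ] g) : IsRBMOWith n μ C g where
  locInt := hf.locInt.congr h
  osc Q := by
    rw [← average_congr' h]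
    refine le_trans (le_of_eq (lintegral_congr_ae (ae_restrict_of_ae ?_))) (hf.osc Q)
    filter_upwards [h] with x hx
    rw [hx]
  reg Q R hQ hR hQR := by
    rw [← average_congr' h, ← average_congr' h]
    exact hf.reg Q R hQ hR hQR

lemma IsRBMOWith.integrableOn {n : ℕ} {C : ℝ≥0} {f : (Fin d → ℝ) → ℝ}
    (hf : IsRBMOWith n μ C f) (Q : Cube μ) : IntegrableOn f Q.toSet μ := by
  cases Q with
  | cube x l hx hl =>
    exact hf.locInt.integrableOn_isCompact (isCompact_closedBall x (l / 2))
  | whole h =>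
    have : IsFiniteMeasure μ := ⟨h⟩
    have h1 := hf.osc (.whole h)
    set m := ⨍ y in (Cube.whole h : Cube μ).tilde.toSet, f y ∂μ
    have h2 : Integrable (fun x => f x - m) μ := by
      refine ⟨hf.locInt.aestronglyMeasurable.sub aestronglyMeasurable_const, ?_⟩
      have h3 : (∫⁻ x, ‖f x - m‖ₑ ∂μ) ≤ C * μ univ := by
        simpa [Cube.toSet, Cube.dilate] using h1
      exact lt_of_le_of_lt h3 (ENNReal.mul_lt_top ENNReal.coe_lt_top h)
    have h4 : Integrable f μ := by
      refine (h2.add (integrable_const m)).congr (Eventually.of_forall fun x => ?_)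
      simp
    exact h4.integrableOn

lemma IsRBMOWith.zero (n : ℕ) (μ : Measure (Fin d → ℝ)) :
    IsRBMOWith n μ 0 (fun _ => 0) where
  locInt := locallyIntegrable_zero
  osc Q := by simp
  reg Q R _ _ _ := by simp

lemma average_add' {f g : (Fin d → ℝ) → ℝ} {s : Set (Fin d → ℝ)}
    (hf : IntegrableOn f s μ) (hg : IntegrableOn g s μ) :
    ⨍ y in s, (f + g) y ∂μ = (⨍ y in s, f y ∂μ) + ⨍ y in s, g y ∂μ := by
  simp only [setAverage_eq, Pi.add_apply]
  rw [integral_add hf hg, smul_add]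

lemma IsRBMOWith.add {n : ℕ} {C D : ℝ≥0} {f g : (Fin d → ℝ) → ℝ}
    (hf : IsRBMOWith n μ C f) (hg : IsRBMOWith n μ D g) :
    IsRBMOWith n μ (C + D) (f + g) where
  locInt := hf.locInt.add hg.locInt
  osc Q := by
    rw [average_add' (hf.integrableOn _) (hg.integrableOn _), ENNReal.coe_add, add_mul]
    refine le_trans ?_ (add_le_add (hf.osc Q) (hg.osc Q))
    rw [← lintegral_add_left']
    · refine lintegral_mono fun x => ?_
      refine le_trans (le_of_eq ?_) (enorm_add_le _ _)
      congr 1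
      simp only [Pi.add_apply]
      ring
    · exact ((hf.integrableOn Q).aestronglyMeasurable.sub aestronglyMeasurable_const).enorm
  reg Q R hQ hR hQR := by
    rw [average_add' (hf.integrableOn _) (hg.integrableOn _),
      average_add' (hf.integrableOn _) (hg.integrableOn _), ENNReal.coe_add, add_mul]
    refine le_trans ?_ (add_le_add (hf.reg Q R hQ hR hQR) (hg.reg Q R hQ hR hQR))
    refine le_trans (le_of_eq ?_) (enorm_add_le _ _)
    congr 1
    ring

lemma average_smul' (c : ℝ) (f : (Fin d → ℝ) → ℝ) (s : Set (Fin d → ℝ)) :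
    ⨍ y in s, (c • f) y ∂μ = c * ⨍ y in s, f y ∂μ := by
  simp only [setAverage_eq, Pi.smul_apply, smul_eq_mul, integral_const_mul]
  ring

lemma IsRBMOWith.smul {n : ℕ} {C : ℝ≥0} {f : (Fin d → ℝ) → ℝ} (c : ℝ)
    (hf : IsRBMOWith n μ C f) : IsRBMOWith n μ (‖c‖₊ * C) (c • f) where
  locInt := hf.locInt.smul c
  osc Q := by
    rw [average_smul', ENNReal.coe_mul, mul_assoc]
    refine le_trans (le_of_eq ?_) (mul_le_mul_right (hf.osc Q) (‖c‖₊ : ℝ≥0∞))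
    rw [← lintegral_const_mul' _ _ ENNReal.coe_ne_top]
    refine lintegral_congr fun x => ?_
    rw [Pi.smul_apply, smul_eq_mul, ← mul_sub, enorm_mul]
    rfl
  reg Q R hQ hR hQR := by
    rw [average_smul', average_smul', ENNReal.coe_mul, mul_assoc, ← mul_sub, enorm_mul]
    exact mul_le_mul_right (hf.reg Q R hQ hR hQR) (‖c‖₊ : ℝ≥0∞)

/-- The space `RBMO(μ)`, as a space of `μ`-a.e. classes of functions. -/
def RBMO (n : ℕ) (μ : Measure (Fin d → ℝ)) : Submodule ℝ ((Fin d → ℝ) →ₘ[μ] ℝ) where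
  carrier := {f | ∃ C : ℝ≥0, IsRBMOWith n μ C f}
  zero_mem' := ⟨0, (IsRBMOWith.zero n μ).congr AEEqFun.coeFn_zero.symm⟩
  add_mem' := by
    rintro f g ⟨C, hC⟩ ⟨D, hD⟩
    exact ⟨C + D, (hC.add hD).congr (AEEqFun.coeFn_add f g).symm⟩
  smul_mem' := by
    rintro c f ⟨C, hC⟩
    exact ⟨‖c‖₊ * C, (hC.smul c).congr (AEEqFun.coeFn_smul c f).symm⟩

/-! ### The atomic block spaces `H^{1,p}_{atb}(μ)`, `1 < p ≤ ∞` -/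

/-- A `p`-atomic block, with all the data of its decomposition. For `p = ∞` the exponent
`1/p - 1` is `-1`. -/
structure AtomicBlock (n : ℕ) (p : ℝ≥0∞) (μ : Measure (Fin d → ℝ)) where
  /-- the function -/
  b : (Fin d → ℝ) → ℝ
  /-- the cube containing its support -/
  R : Cube μ
  /-- the cubes `Q_j ⊆ R` -/
  Q : ℕ → Cube μ
  /-- the functions `a_j` -/
  a : ℕ → (Fin d → ℝ) → ℝ
  /-- the coefficients `λ_j` -/
  coef : ℕ → ℝ
  integrable : Integrable b μ
  support_b : Function.support b ⊆ R.toSet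
  integral_eq : ∫ x, b x ∂μ = 0
  subset : ∀ j, (Q j).toSet ⊆ R.toSet
  measurable_a : ∀ j, AEStronglyMeasurable (a j) μ
  support_a : ∀ j, Function.support (a j) ⊆ (Q j).toSet
  norm_a : ∀ j, eLpNorm (a j) p μ ≤
    μ ((Q j).dilate 1).toSet ^ ((p⁻¹).toReal - 1) * (coeffK n (Q j) R)⁻¹
  hasSum : ∀ᵐ x ∂μ, HasSum (fun j => coef j * a j x) (b x)

/-- `|b| = ∑ⱼ |λⱼ|`. -/
def AtomicBlock.size {n : ℕ} {p : ℝ≥0∞} (B : AtomicBlock n p μ) : ℝ≥0∞ := ∑' j, ‖B.coef j‖ₑ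

/-- The norm of `H^{1,p}_{atb}(μ)`: the infimum of `∑ᵢ |bᵢ|` over the decompositions `f = ∑ᵢ bᵢ`
into `p`-atomic blocks, and `∞` if there is none with a finite sum. When `∑ᵢ |bᵢ| < ∞` the series
converges absolutely `μ`-a.e. and in `L¹(μ)`. -/
def atbENorm (n : ℕ) (p : ℝ≥0∞) (μ : Measure (Fin d → ℝ)) (f : (Fin d → ℝ) → ℝ) : ℝ≥0∞ :=
  ⨅ (B : ℕ → AtomicBlock n p μ) (_ : ∀ᵐ x ∂μ, HasSum (fun i => (B i).b x) (f x)),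
    ∑' i, (B i).size

section helpers

variable {n : ℕ} {p : ℝ≥0∞}

lemma atbENorm_congr {f g : (Fin d → ℝ) → ℝ} (h : f =ᵐ[μ] g) :
    atbENorm n p μ f = atbENorm n p μ g := by
  unfold atbENorm
  refine iInf_congr fun B => iInf_congr_Prop ⟨fun H => ?_, fun H => ?_⟩ fun _ => rfl
  · filter_upwards [H, h] with x h1 h2
    rwa [← h2]
  · filter_upwards [H, h] with x h1 h2
    rwa [h2]

lemma exists_cube (μ : Measure (Fin d → ℝ)) : Nonempty (Cube μ) := by
  by_cases h : μ.support.Nonempty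
  · obtain ⟨x, hx⟩ := h
    exact ⟨.cube x 1 hx one_pos⟩
  · rw [Set.not_nonempty_iff_eq_empty] at h
    have h1 : μ univ = 0 := by
      have h2 := Measure.support_mem_ae (μ := μ)
      rw [mem_ae_iff, h, compl_empty] at h2
      exact h2
    exact ⟨.whole (by rw [h1]; exact ENNReal.zero_lt_top)⟩

/-- The block with `b = 0` and all `a_j = 0`, `λ_j = 0`. -/
def AtomicBlock.zero (R : Cube μ) : AtomicBlock n p μ where
  b := 0
  R := R
  Q := fun _ => R
  a := 0
  coef := 0
  integrable := integrable_zero _ _ _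
  support_b := by simp
  integral_eq := by simp
  subset := fun _ => Subset.rfl
  measurable_a := fun _ => aestronglyMeasurable_zero
  support_a := by simp
  norm_a := by simp
  hasSum := by simp [hasSum_zero]

/-- The block `c b`, with coefficients `c λ_j`. -/
def AtomicBlock.smul (c : ℝ) (B : AtomicBlock n p μ) : AtomicBlock n p μ where
  b := fun x => c * B.b x
  R := B.R
  Q := B.Q
  a := B.a
  coef := fun j => c * B.coef j
  integrable := B.integrable.const_mul c
  support_b := fun x hx => B.support_b (right_ne_zero_of_mul hx)
  integral_eq := by rw [integral_const_mul, B.integral_eq, mul_zero]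
  subset := B.subset
  measurable_a := B.measurable_a
  support_a := B.support_a
  norm_a := B.norm_a
  hasSum := by
    filter_upwards [B.hasSum] with x hx
    simpa [mul_assoc] using hx.mul_left c

lemma atbENorm_zero : atbENorm n p μ (fun _ => 0) = 0 := by
  obtain ⟨R⟩ := exists_cube μ
  refine le_antisymm ?_ zero_le
  refine iInf₂_le_of_le (fun _ => AtomicBlock.zero R) ?_ ?_
  · exact Eventually.of_forall fun x => by simp [AtomicBlock.zero, hasSum_zero]
  · simp [AtomicBlock.size, AtomicBlock.zero]

lemma atbENorm_add (f g : (Fin d → ℝ) → ℝ) :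
    atbENorm n p μ (f + g) ≤ atbENorm n p μ f + atbENorm n p μ g := by
  conv_rhs => unfold atbENorm
  simp only [ENNReal.iInf_add, ENNReal.add_iInf]
  refine le_iInf fun B => le_iInf fun hB => le_iInf fun B' => le_iInf fun hB' => ?_
  let e : ℕ ≃ ℕ ⊕ ℕ := Equiv.natSumNatEquivNat.symm
  refine iInf₂_le_of_le (fun i => Sum.elim B' B (e i)) ?_ (le_of_eq ?_)
  · filter_upwards [hB, hB'] with x h1 h2
    have h3 : HasSum (fun s : ℕ ⊕ ℕ => (Sum.elim B' B s).b x) (f x + g x) :=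
      HasSum.sum h2 h1
    rw [Pi.add_apply]
    exact (e.hasSum_iff (f := fun s : ℕ ⊕ ℕ => (Sum.elim B' B s).b x)).2 h3
  · rw [e.tsum_eq (fun s => (Sum.elim B' B s).size)]
    rw [Summable.tsum_sum ENNReal.summable ENNReal.summable]
    simp [add_comm]

lemma atbENorm_smul_le (c : ℝ) (f : (Fin d → ℝ) → ℝ) :
    atbENorm n p μ (c • f) ≤ ‖c‖ₑ * atbENorm n p μ f := by
  by_cases hc : c = 0
  · subst hc
    have h : ((0 : ℝ) • f) = fun _ => 0 := by ext x; simp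
    rw [h, atbENorm_zero]
    exact zero_le
  conv_rhs => unfold atbENorm
  rw [ENNReal.mul_iInf_of_ne (by simpa using hc) enorm_ne_top]
  refine le_iInf fun B => ?_
  rw [ENNReal.mul_iInf_of_ne (by simpa using hc) enorm_ne_top]
  refine le_iInf fun hB => ?_
  refine iInf₂_le_of_le (fun i => (B i).smul c) ?_ (le_of_eq ?_)
  · filter_upwards [hB] with x hx
    exact hx.mul_left c
  · rw [← ENNReal.tsum_mul_left]
    refine tsum_congr fun i => ?_
    simp only [AtomicBlock.size, AtomicBlock.smul, enorm_mul]
    rw [ENNReal.tsum_mul_left]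

lemma atbENorm_smul (c : ℝ) (f : (Fin d → ℝ) → ℝ) :
    atbENorm n p μ (c • f) = ‖c‖ₑ * atbENorm n p μ f := by
  refine le_antisymm (atbENorm_smul_le c f) ?_
  by_cases hc : c = 0
  · simp [hc]
  have h := atbENorm_smul_le (n := n) (p := p) (μ := μ) c⁻¹ (c • f)
  rw [smul_smul, inv_mul_cancel₀ hc, one_smul] at h
  calc ‖c‖ₑ * atbENorm n p μ f ≤ ‖c‖ₑ * (‖c⁻¹‖ₑ * atbENorm n p μ (c • f)) :=
        mul_le_mul_right h _
    _ = ‖c * c⁻¹‖ₑ * atbENorm n p μ (c • f) := by rw [enorm_mul, mul_assoc]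
    _ = atbENorm n p μ (c • f) := by rw [mul_inv_cancel₀ hc]; simp

end helpers

/-- The space `H^{1,p}_{atb}(μ)`, as a space of `μ`-a.e. classes of functions. -/
def Hatb (n : ℕ) (p : ℝ≥0∞) (μ : Measure (Fin d → ℝ)) :
    Submodule ℝ ((Fin d → ℝ) →ₘ[μ] ℝ) where
  carrier := {f | atbENorm n p μ f < ∞}
  zero_mem' := by
    rw [mem_ofPred_eq, atbENorm_congr AEEqFun.coeFn_zero]
    exact lt_of_le_of_lt (le_of_eq atbENorm_zero) ENNReal.zero_lt_top
  add_mem' := by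
    intro f g hf hg
    rw [mem_ofPred_eq, atbENorm_congr (AEEqFun.coeFn_add f g)]
    exact lt_of_le_of_lt (atbENorm_add _ _) (ENNReal.add_lt_top.2 ⟨hf, hg⟩)
  smul_mem' := by
    intro c f hf
    rw [mem_ofPred_eq, atbENorm_congr (AEEqFun.coeFn_smul c f), atbENorm_smul]
    exact ENNReal.mul_lt_top enorm_lt_top hf

instance (n : ℕ) (p : ℝ≥0∞) (μ : Measure (Fin d → ℝ)) : Norm (Hatb n p μ) :=
  ⟨fun f => (atbENorm n p μ f.1).toReal⟩

lemma hatbCore (n : ℕ) (p : ℝ≥0∞) (μ : Measure (Fin d → ℝ)) :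
    SeminormedSpace.Core ℝ (Hatb n p μ) where
  norm_nonneg _ := ENNReal.toReal_nonneg
  norm_smul c f := by
    change (atbENorm n p μ ((c • f.1 : (Fin d → ℝ) →ₘ[μ] ℝ))).toReal = _
    rw [atbENorm_congr (AEEqFun.coeFn_smul c f.1), atbENorm_smul, ENNReal.toReal_mul]
    simp only [toReal_enorm]
    rfl
  norm_triangle f g := by
    change (atbENorm n p μ ((f.1 + g.1 : (Fin d → ℝ) →ₘ[μ] ℝ))).toReal ≤ _
    rw [atbENorm_congr (AEEqFun.coeFn_add f.1 g.1)]
    refine le_trans (ENNReal.toReal_mono (ENNReal.add_lt_top.2 ⟨f.2, g.2⟩).ne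
      (atbENorm_add _ _)) (le_of_eq ?_)
    exact ENNReal.toReal_add (ne_of_lt f.2) (ne_of_lt g.2)

/-- `H^{1,p}_{atb}(μ)` with its norm (which is definite for `1 ≤ p`, as it dominates the
`L¹(μ)` norm). Its dual is `StrongDual ℝ (Hatb n p μ)`, with the operator norm. -/
instance (n : ℕ) (p : ℝ≥0∞) (μ : Measure (Fin d → ℝ)) : SeminormedAddCommGroup (Hatb n p μ) :=
  SeminormedAddCommGroup.ofCore (hatbCore n p μ)

instance (n : ℕ) (p : ℝ≥0∞) (μ : Measure (Fin d → ℝ)) : NormedSpace ℝ (Hatb n p μ) where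
  norm_smul_le c f := le_of_eq ((hatbCore n p μ).norm_smul c f)

/-- `f` is (a.e. equal to) a bounded function with compact support. -/
def IsBoundedCompSupp (μ : Measure (Fin d → ℝ)) (f : (Fin d → ℝ) → ℝ) : Prop :=
  MemLp f ∞ μ ∧ ∃ S : Set (Fin d → ℝ), IsCompact S ∧ ∀ᵐ x ∂μ, x ∉ S → f x = 0

end NonDoubling

end

/-!
Write `K_{Q,R}` for `coeffK n Q R` and `H^{1,p}` for `Hatb n p μ`.

*The constant `β_d`.* Almost every point is the center of small doubling cubes as soon as the
doubling constant exceeds `2ᵈ`: otherwise the Lebesgue measure would have infinite derivative with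
respect to `ν` on a set of positive `ν`-measure. The Lebesgue measure itself shows that `2ᵈ` is
optimal, so `β_d = 2^(d+1)` (`betaD_eq`). As `n ≤ d`, the densities `μ(2ᵏQ) / l(2ᵏQ)ⁿ` at least
double along non-doubling cubes; as they are bounded by the growth condition, every cube has large
doubling dilates, and a range of scales without doubling cubes contributes only `O(1)` to `K_{Q,R}`.

*Controlled oscillation.* From this, any two cubes `Q ⊆ R` have a common doubling ancestor `S` of
`Q̃` and `R̃` at distance `O(K_{Q,R})` from both (`exists_common_doubling`), so for `f ∈ RBMO(μ)` the
numbers `F Q = m_{Q̃} f` satisfy `|F Q - F R| ≲ ‖f‖_* K_{Q,R}` for *all* cubes `Q ⊆ R`. Such a family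
of numbers is called `OscData`. Truncations of `f` and `F` are again such data, which reduces the
John–Nirenberg inequality `∫_Q |f - F Q|^q dμ ≲ μ(2Q)`, `q < ∞`, to bounded functions
(`exists_johnNirenberg`). There one stops at the largest small doubling cubes on which `F` is at
distance more than `D` from `F R`. Besicovitch's covering theorem makes their total measure a small
fraction of `μ(2R)`, and off them `|f - F R|` is bounded. Hence the best constant `X`, finite because
`f` is bounded, satisfies `X ≤ C + X / 2`.

*Pairing.* If `a` is an atom on `Q` of a block with cube `R`, Hölder's inequality, the John–Nirenberg
inequality and the bound on `F Q - F R` give `∫ |a| |f - F R| dμ ≲ ‖f‖_*`; the vanishing integral of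
the block then bounds its pairing with `f` (`AtomicBlock.enorm_integral_mul_le`).

*Representation.* For `1 < p ≤ 2`, mean zero functions in `L²` of a cube belong to `H^{1,p}`, so the
Riesz representation theorem on an exhaustion by cubes represents functionals on `H^{1,p}` by a
function `g` (`exists_representation`). Testing against the sign of `g - m_{Q̃} g` on `Q`, corrected on
`Q̃`, and against `χ_Q / μ(Q) - χ_R / μ(R)` shows `g ∈ RBMO(μ)`, with norm controlled by the norm of
the functional with respect to `H^{1,∞}` (`isRBMOWith_of_test`).

*Equivalence of norms.* Together with the pairing this bounds, for functionals on `H^{1,p}`, the dual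
norm of `H^{1,p}` by the dual norm of `H^{1,∞}` (`exists_dual_bound`). By the Hahn–Banach theorem the
unit ball of `H^{1,p}` lies in the closure of a ball of `H^{1,∞}` (`exists_approx_top`), and summing
successive approximations yields `‖f‖_{H^{1,∞}} ≲ ‖f‖_{H^{1,p}}` (`exists_atbENorm_top_le`). The
converse inequality, and the case `p > 2`, follow from Hölder's inequality.

*Duality.* Bounded functions with compact support are dense in `H^{1,2} = H^{1,∞}`, and their pairing
with `g ∈ RBMO(μ)` is continuous, which defines `L_g` uniquely (`exists_functional`). Surjectivity and
the lower bound for `‖L_g‖` come from the representation on `H^{1,2}` (`exists_rbmo_of_dual`), and a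
function pairing to zero with all test functions has no oscillation on any cube
(`exists_ae_eq_const`).
-/

noncomputable section

namespace NonDoubling

/-! ### The growth condition and the constant `β_d` -/

section

variable {d : ℕ} {μ : Measure (Fin d → ℝ)}

/-- The growth condition for cubes: the cube of side length `l` centered at `x` (a ball of the sup
distance) has measure at most `c lⁿ`. -/
def CubeGrowth (n : ℕ) (c : ℝ≥0) (μ : Measure (Fin d → ℝ)) : Prop :=
  ∀ (x : Fin d → ℝ) (l : ℝ), 0 < l →
    μ (Metric.closedBall x (l / 2)) ≤ c * ENNReal.ofReal (l ^ n)

lemma Growth.cubeGrowth {n : ℕ} {C₀ : ℝ} (h : Growth n C₀ μ) :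
    CubeGrowth n (C₀.toNNReal * (d + 1) ^ n) μ := by
  intro x l hl
  have hr : 0 < (d + 1) * l := by positivity
  refine (measure_mono ?_).trans ((h x ((d + 1) * l) hr).trans (le_of_eq ?_))
  · intro y hy
    rw [Metric.mem_closedBall, dist_pi_le_iff (by positivity)] at hy
    have h1 : ∑ i, (y i - x i) ^ 2 ≤ ((d : ℝ) * l) ^ 2 := by
      calc ∑ i, (y i - x i) ^ 2 ≤ ∑ _i : Fin d, l ^ 2 := by
            refine Finset.sum_le_sum fun i _ => ?_
            have := hy i
            rw [Real.dist_eq] at this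
            rw [← sq_abs]
            gcongr
            linarith
        _ = d * l ^ 2 := by simp
        _ ≤ ((d : ℝ) * l) ^ 2 := by
            rw [mul_pow]
            gcongr
            rcases Nat.eq_zero_or_pos d with rfl | hd
            · simp
            · have : (1 : ℝ) ≤ d := by exact_mod_cast hd
              nlinarith
    calc √(∑ i, (y i - x i) ^ 2) ≤ d * l := by
          rw [← Real.sqrt_sq (by positivity : 0 ≤ (d : ℝ) * l)]
          exact Real.sqrt_le_sqrt h1
      _ < (d + 1) * l := by linarith
  · rw [mul_pow, ← mul_assoc, ENNReal.ofReal_mul' (by positivity),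
      ENNReal.ofReal_mul' (by positivity)]
    congr 1
    push_cast
    congr 1
    rw [ENNReal.ofReal_pow (by positivity)]
    congr 1
    rw [ENNReal.ofReal_add (by positivity) (by norm_num)]
    simp

lemma CubeGrowth.isLocallyFiniteMeasure {n : ℕ} {c : ℝ≥0} (h : CubeGrowth n c μ) :
    IsLocallyFiniteMeasure μ := by
  refine ⟨fun x => ⟨Metric.closedBall x (1 / 2), Metric.closedBall_mem_nhds x (by norm_num), ?_⟩⟩
  refine (h x 1 one_pos).trans_lt ?_
  exact ENNReal.mul_lt_top ENNReal.coe_lt_top ENNReal.ofReal_lt_top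

/-- The densities `μ(2ᵏ Q) / l(2ᵏ Q)ⁿ` for the cube `Q` with center `x` and side length `l`. -/
def density (n : ℕ) (μ : Measure (Fin d → ℝ)) (x : Fin d → ℝ) (l : ℝ) (k : ℕ) : ℝ≥0∞ :=
  μ (Metric.closedBall x (2 ^ k * l / 2)) / ENNReal.ofReal ((2 ^ k * l) ^ n)

lemma CubeGrowth.density_le {n : ℕ} {c : ℝ≥0} (h : CubeGrowth n c μ) (x : Fin d → ℝ) {l : ℝ}
    (hl : 0 < l) (k : ℕ) : density n μ x l k ≤ c :=
  ENNReal.div_le_of_le_mul (h x _ (by positivity))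

/-- For every `β > 2ᵈ` and `ν`-almost every `x`, each dyadic sequence of cubes shrinking to `x` has
infinitely many `(2,β)`-doubling members. Otherwise the measures of the cubes would decay faster
than their Lebesgue measures, and the derivative of the Lebesgue measure with respect to `ν`
would be infinite at `x`. -/
lemma ae_exists_doubling (ν : Measure (Fin d → ℝ)) [IsLocallyFiniteMeasure ν] {β : ℝ}
    (hβ : 2 ^ d < β) :
    ∀ᵐ x ∂ν, ∀ l : ℝ, 0 < l → ∀ K : ℕ, ∃ k ≥ K,
      ν (Metric.closedBall x (2 * (l / 2 ^ k) / 2)) ≤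
        ENNReal.ofReal β * ν (Metric.closedBall x (l / 2 ^ k / 2)) := by
  have hβ0 : 0 < β := lt_trans (by positivity) hβ
  filter_upwards [Besicovitch.ae_tendsto_rnDeriv volume ν,
    Measure.rnDeriv_lt_top volume ν] with x hx hfin l hl K
  by_contra! hcon
  obtain ⟨M, hM1, hM2⟩ := exists_between hfin
  have hev : ∀ᶠ r in 𝓝[>] (0 : ℝ), volume (Metric.closedBall x r) ≤ M * ν (Metric.closedBall x r) := by
    filter_upwards [hx.eventually_lt_const hM1, self_mem_nhdsWithin] with r hr hr0
    by_cases h0 : ν (Metric.closedBall x r) = 0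
    · rw [h0, ENNReal.div_zero] at hr
      · simp at hr
      · exact (Metric.measure_closedBall_pos volume x hr0).ne'
    · have hfin' : ν (Metric.closedBall x r) ≠ ∞ := (isCompact_closedBall x r).measure_lt_top.ne
      exact (ENNReal.div_le_iff h0 hfin').1 hr.le
  have hlim : Tendsto (fun k : ℕ => l / 2 ^ k / 2) atTop (𝓝[>] (0 : ℝ)) := by
    refine tendsto_nhdsWithin_iff.2 ⟨?_, Eventually.of_forall fun k => by
      simp only [mem_Ioi]; positivity⟩
    have h1 : Tendsto (fun k : ℕ => (l / 2) * (1 / 2 : ℝ) ^ k) atTop (𝓝 ((l / 2) * 0)) :=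
      (tendsto_pow_atTop_nhds_zero_of_lt_one (by norm_num) (by norm_num)).const_mul _
    rw [mul_zero] at h1
    refine h1.congr fun k => ?_
    rw [one_div, inv_pow]; field_simp
  -- geometric decay of the measures of the cubes
  have hdec : ∀ i : ℕ, ENNReal.ofReal β ^ i * ν (Metric.closedBall x (l / 2 ^ (K + i) / 2)) ≤
      ν (Metric.closedBall x (l / 2 ^ K / 2)) := by
    intro i
    induction i with
    | zero => simp
    | succ i ih =>
      refine le_trans ?_ ih
      rw [pow_succ, mul_assoc]
      gcongr
      refine (hcon (K + (i + 1)) (by omega)).le.trans (le_of_eq ?_)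
      congr 2
      rw [← add_assoc, pow_succ]
      field_simp
  have hvol : ∀ k : ℕ, volume (Metric.closedBall x (l / 2 ^ k / 2)) =
      ENNReal.ofReal ((l / 2 ^ k) ^ d) := by
    intro k
    rw [Real.volume_pi_closedBall _ (by positivity), Fintype.card_fin]
    congr 2
    ring
  have hfinK : ν (Metric.closedBall x (l / 2 ^ K / 2)) ≠ ∞ :=
    (isCompact_closedBall x _).measure_lt_top.ne
  set A := ν (Metric.closedBall x (l / 2 ^ K / 2)) with hA
  have hev2 : ∀ᶠ i : ℕ in atTop, ENNReal.ofReal ((β / 2 ^ d) ^ i) ≤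
      ENNReal.ofReal ((M * A).toReal / (l / 2 ^ K) ^ d) := by
    have h1 := (hlim.comp (tendsto_add_atTop_nat K)).eventually hev
    filter_upwards [h1] with i hi
    simp only [Function.comp_apply] at hi
    rw [hvol, add_comm i K] at hi
    have h2 : ENNReal.ofReal β ^ i * ENNReal.ofReal ((l / 2 ^ (K + i)) ^ d) ≤ M * A := by
      calc _ ≤ ENNReal.ofReal β ^ i * (M * ν (Metric.closedBall x (l / 2 ^ (K + i) / 2))) := by
            gcongr
        _ = M * (ENNReal.ofReal β ^ i * ν (Metric.closedBall x (l / 2 ^ (K + i) / 2))) := by ring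
        _ ≤ M * A := by gcongr; exact hdec i
    rw [← ENNReal.ofReal_pow hβ0.le, ← ENNReal.ofReal_mul (by positivity),
      ← ENNReal.ofReal_toReal (ENNReal.mul_ne_top hM2.ne hfinK)] at h2
    have h3 := (ENNReal.ofReal_le_ofReal_iff ENNReal.toReal_nonneg).1 h2
    refine ENNReal.ofReal_le_ofReal ?_
    rw [le_div_iff₀ (by positivity)]
    refine le_trans (le_of_eq ?_) h3
    rw [pow_add, div_pow, div_pow, div_pow, mul_pow, ← pow_mul, ← pow_mul, ← pow_mul, mul_comm d i]
    field_simp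
  have htop : Tendsto (fun i : ℕ => (β / 2 ^ d) ^ i) atTop atTop :=
    tendsto_pow_atTop_atTop_of_one_lt ((one_lt_div (by positivity)).2 hβ)
  obtain ⟨i, hi1, hi2⟩ := (hev2.and (htop.eventually_gt_atTop
    ((M * A).toReal / (l / 2 ^ K) ^ d))).exists
  exact absurd ((ENNReal.ofReal_le_ofReal_iff (by positivity)).1 hi1) (not_le.2 hi2)

lemma smallDoublingConst_of_lt {β : ℝ} (hβ : 2 ^ d < β) : SmallDoublingConst d β := by
  intro ν hν
  filter_upwards [ae_exists_doubling ν hβ] with x hx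
  choose k hk1 hk2 using hx 1 one_pos
  refine ⟨fun j => 1 / 2 ^ k j, fun j => by positivity, ?_, hk2⟩
  refine squeeze_zero (fun j => by positivity) (fun j => ?_)
    (tendsto_pow_atTop_nhds_zero_of_lt_one (by norm_num : (0 : ℝ) ≤ 1 / 2) (by norm_num))
  rw [← one_div_pow]
  exact pow_le_pow_of_le_one (by norm_num) (by norm_num) (hk1 j)

lemma SmallDoublingConst.two_pow_le {β : ℝ} (h : SmallDoublingConst d β) : 2 ^ d ≤ β := by
  have h1 := h volume inferInstance
  obtain ⟨x, l, hl, -, h2⟩ := h1.exists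
  have h3 := h2 0
  have hl0 := hl 0
  rw [Real.volume_pi_closedBall _ (by positivity), Real.volume_pi_closedBall _ (by positivity),
    Fintype.card_fin, ← ENNReal.ofReal_mul' (by positivity)] at h3
  by_contra! hcon
  have h4 := (ENNReal.ofReal_le_ofReal_iff' ).1 h3
  rcases h4 with h4 | h4
  · rw [show (2 * (2 * l 0 / 2)) = 2 * (2 * (l 0 / 2)) by ring, mul_pow 2 (2 * (l 0 / 2))] at h4
    have := le_of_mul_le_mul_right h4 (by positivity)
    linarith
  · have : 0 < (2 * (2 * l 0 / 2)) ^ d := by positivity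
    linarith

/-- The constant `β_d` equals `2^(d+1)`: the infimum of the admissible `β` is `2ᵈ`, the lower bound
coming from the Lebesgue measure. -/
lemma betaD_eq (d : ℕ) : betaD d = 2 ^ (d + 1) := by
  have : sInf {β : ℝ | SmallDoublingConst d β} = 2 ^ d := by
    refine le_antisymm (le_of_forall_gt_imp_ge_of_dense fun β hβ => ?_) ?_
    · exact csInf_le ⟨2 ^ d, fun b hb => hb.two_pow_le⟩ (smallDoublingConst_of_lt hβ)
    · exact le_csInf ⟨2 ^ d + 1, smallDoublingConst_of_lt (by linarith)⟩ fun b hb => hb.two_pow_le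
  rw [betaD, this, pow_succ, mul_comm]

lemma ofReal_betaD (d : ℕ) : ENNReal.ofReal (betaD d) = 2 ^ (d + 1) := by
  rw [betaD_eq, ENNReal.ofReal_pow (by norm_num)]
  simp

end

/-! ### Doubling cubes and the coefficients `K_{Q,R}` -/

variable {d n : ℕ} {μ : Measure (Fin d → ℝ)} {c : ℝ≥0}

lemma Cube.dilate_dilate (Q : Cube μ) (j k : ℕ) : (Q.dilate j).dilate k = Q.dilate (j + k) := by
  cases Q with
  | whole h => rfl
  | cube x l hx hl =>
    simp only [Cube.dilate]
    congr 1
    ring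

lemma Cube.measurableSet (Q : Cube μ) : MeasurableSet Q.toSet := by
  cases Q with
  | whole h => exact MeasurableSet.univ
  | cube x l hx hl => exact measurableSet_closedBall

lemma Cube.toSet_subset_dilate (Q : Cube μ) (k : ℕ) : Q.toSet ⊆ (Q.dilate k).toSet := by
  cases Q with
  | whole h => exact Subset.rfl
  | cube x l hx hl =>
    refine Metric.closedBall_subset_closedBall ?_
    have : (1 : ℝ) ≤ 2 ^ k := one_le_pow₀ (by norm_num)
    nlinarith

lemma Cube.measure_lt_top [IsLocallyFiniteMeasure μ] (Q : Cube μ) : μ Q.toSet < ∞ := by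
  cases Q with
  | whole h => exact h
  | cube x l hx hl => exact (isCompact_closedBall x _).measure_lt_top

lemma measure_closedBall_pos_of_mem_support {x : Fin d → ℝ} (hx : x ∈ μ.support) {r : ℝ}
    (hr : 0 < r) : 0 < μ (Metric.closedBall x r) := by
  rw [Measure.mem_support_iff_forall] at hx
  exact hx _ (Metric.closedBall_mem_nhds x hr)

lemma Cube.measure_pos (hμ : μ ≠ 0) (Q : Cube μ) : 0 < μ Q.toSet := by
  cases Q with
  | whole h => exact (Measure.measure_univ_pos).2 hμ
  | cube x l hx hl => exact measure_closedBall_pos_of_mem_support hx (by positivity)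

lemma Cube.isDoubling_iff (Q : Cube μ) :
    Q.IsDoubling ↔ μ (Q.dilate 1).toSet ≤ 2 ^ (d + 1) * μ Q.toSet := by
  rw [Cube.IsDoubling, ofReal_betaD]

lemma Cube.isDoubling_whole (h : μ univ < ∞) : (Cube.whole h : Cube μ).IsDoubling := by
  rw [Cube.isDoubling_iff]
  exact le_mul_of_one_le_left zero_le (one_le_pow₀ (by norm_num))

lemma density_shift (x : Fin d → ℝ) (l : ℝ) (a k : ℕ) :
    density n μ x (2 ^ a * l) k = density n μ x l (a + k) := by
  simp only [density]
  rw [show (2 : ℝ) ^ k * (2 ^ a * l) = 2 ^ (a + k) * l by ring]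

/-- The density at least doubles when passing from a non-doubling cube to its double, as
`β_d = 2^(d+1) ≥ 2 ⬝ 2ⁿ`. -/
lemma two_mul_density_le (hnd : n ≤ d) {x : Fin d → ℝ} {l : ℝ} (hx : x ∈ μ.support) (hl : 0 < l)
    {k : ℕ} (h : ¬ ((Cube.cube x l hx hl : Cube μ).dilate k).IsDoubling) :
    2 * density n μ x l k ≤ density n μ x l (k + 1) := by
  rw [Cube.isDoubling_iff, Cube.dilate_dilate, not_le] at h
  simp only [Cube.dilate, Cube.toSet] at h
  simp only [density]
  have h2 : ENNReal.ofReal ((2 ^ (k + 1) * l) ^ n) = 2 ^ n * ENNReal.ofReal ((2 ^ k * l) ^ n) := by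
    rw [pow_succ, mul_comm (2 ^ k : ℝ) 2, mul_assoc, mul_pow 2, ENNReal.ofReal_mul (by positivity),
      ENNReal.ofReal_pow (by norm_num)]
    simp
  rw [h2]
  have h3 : (2 : ℝ≥0∞) ^ (n + 1) ≤ 2 ^ (d + 1) := pow_le_pow_right₀ (by norm_num) (by omega)
  have h4 : (2 : ℝ≥0∞) ^ n ≠ 0 := by positivity
  have h5 : (2 : ℝ≥0∞) ^ n ≠ ∞ := ENNReal.pow_ne_top (by norm_num)
  rw [← mul_div_assoc]
  have hpos : ENNReal.ofReal ((2 ^ k * l) ^ n) ≠ 0 := by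
    rw [Ne, ENNReal.ofReal_eq_zero, not_le]; positivity
  calc 2 * μ (Metric.closedBall x (2 ^ k * l / 2)) / ENNReal.ofReal ((2 ^ k * l) ^ n)
      = 2 ^ n * (2 * μ (Metric.closedBall x (2 ^ k * l / 2))) /
        (2 ^ n * ENNReal.ofReal ((2 ^ k * l) ^ n)) :=
        (ENNReal.mul_div_mul_left _ _ h4 h5).symm
    _ ≤ _ := by
        gcongr
        refine le_trans ?_ h.le
        rw [← mul_assoc, ← pow_succ]
        gcongr

/-- The densities of consecutive non-doubling cubes form a geometric progression, so that their sum
is controlled by the last one. -/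
lemma sum_density_le (hnd : n ≤ d) {x : Fin d → ℝ} {l : ℝ} (hx : x ∈ μ.support) (hl : 0 < l)
    (a N : ℕ)
    (h : ∀ k, a ≤ k → k < a + N → ¬ ((Cube.cube x l hx hl : Cube μ).dilate k).IsDoubling) :
    ∑ i ∈ Finset.range N, density n μ x l (a + i) ≤ density n μ x l (a + N) := by
  induction N with
  | zero => simp
  | succ N ih =>
    rw [Finset.sum_range_succ]
    refine le_trans (add_le_add_left (ih fun k h1 h2 => h k h1 (by omega)) _) ?_
    rw [← two_mul]
    exact two_mul_density_le hnd hx hl (h _ (by omega) (by omega))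

/-- Every cube has arbitrarily large doubling dilates: otherwise the densities would grow
geometrically, against the growth condition. -/
lemma Cube.exists_isDoubling (hnd : n ≤ d) (hG : CubeGrowth n c μ) (Q : Cube μ) (m : ℕ) :
    ∃ N, (Q.dilate (m + N)).IsDoubling := by
  cases Q with
  | whole h => exact ⟨0, Cube.isDoubling_whole h⟩
  | cube x l hx hl =>
    by_contra! hcon
    have h1 : ∀ N : ℕ, (2 : ℝ≥0∞) ^ N * density n μ x l m ≤ density n μ x l (m + N) := by
      intro N
      induction N with
      | zero => simp
      | succ N ih =>
        refine le_trans ?_ (two_mul_density_le hnd hx hl (hcon N))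
        rw [pow_succ, mul_comm (2 ^ N : ℝ≥0∞) 2, mul_assoc]
        exact mul_le_mul_right ih 2
    have h2 : density n μ x l m ≠ 0 := by
      simp only [density]
      rw [Ne, ENNReal.div_eq_zero_iff, not_or]
      exact ⟨(measure_closedBall_pos_of_mem_support hx (by positivity)).ne', ENNReal.ofReal_ne_top⟩
    have h3 : density n μ x l m ≠ ∞ := ((hG.density_le x hl m).trans_lt ENNReal.coe_lt_top).ne
    have h4 : (c : ℝ≥0∞) / density n μ x l m ≠ ∞ := ENNReal.div_ne_top ENNReal.coe_ne_top h2
    obtain ⟨N, hN⟩ := ENNReal.exists_nat_gt h4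
    have h5 : (N : ℝ≥0∞) ≤ 2 ^ N := by
      exact_mod_cast (Nat.lt_two_pow_self).le
    have h6 := (ENNReal.le_div_iff_mul_le (Or.inl h2) (Or.inl h3)).2
      ((h1 N).trans (hG.density_le x hl _))
    exact absurd (h5.trans h6) (not_le.2 hN)

/-- The exponent `N` with `Q̃ = 2ᴺ Q`. -/
def Cube.tildeExp (Q : Cube μ) : ℕ := sInf {N : ℕ | (Q.dilate N).IsDoubling}

lemma Cube.tilde_eq (Q : Cube μ) : Q.tilde = Q.dilate Q.tildeExp := rfl

lemma Cube.tilde_isDoubling (hnd : n ≤ d) (hG : CubeGrowth n c μ) (Q : Cube μ) :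
    Q.tilde.IsDoubling := by
  obtain ⟨N, hN⟩ := Q.exists_isDoubling hnd hG 0
  exact Nat.sInf_mem (s := {N : ℕ | (Q.dilate N).IsDoubling}) ⟨0 + N, hN⟩

lemma Cube.not_isDoubling_of_lt {Q : Cube μ} {k : ℕ} (hk : k < Q.tildeExp) :
    ¬ (Q.dilate k).IsDoubling := fun h => Nat.notMem_of_lt_sInf hk h

lemma Cube.toSet_subset_tilde (Q : Cube μ) : Q.toSet ⊆ Q.tilde.toSet :=
  Q.toSet_subset_dilate _

lemma one_le_coeffK (Q R : Cube μ) : 1 ≤ coeffK n Q R := by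
  cases Q <;> cases R <;> simp [coeffK]

lemma coeffK_le_of_le {x y : Fin d → ℝ} {l s : ℝ} {hx : x ∈ μ.support} {hy : y ∈ μ.support}
    {hl : 0 < l} {hs : 0 < s} {m : ℕ} (h : s ≤ 2 ^ m * l) :
    coeffK n (.cube x l hx hl) (.cube y s hy hs) ≤
      1 + ∑ k ∈ Finset.Icc 1 m, density n μ x l k := by
  simp only [coeffK]
  gcongr
  refine Finset.sum_le_sum_of_subset (Finset.Icc_subset_Icc le_rfl ?_)
  exact Nat.sInf_le h

lemma le_coeffK_of_le {x y : Fin d → ℝ} {l s : ℝ} {hx : x ∈ μ.support} {hy : y ∈ μ.support}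
    {hl : 0 < l} {hs : 0 < s} {m : ℕ} (h : 2 ^ m * l ≤ s) :
    1 + ∑ k ∈ Finset.Icc 1 m, density n μ x l k ≤
      coeffK n (.cube x l hx hl) (.cube y s hy hs) := by
  simp only [coeffK]
  gcongr
  refine Finset.sum_le_sum_of_subset (Finset.Icc_subset_Icc le_rfl ?_)
  obtain ⟨k, hk⟩ := pow_unbounded_of_one_lt (s / l) (one_lt_two (α := ℝ))
  refine le_csInf ⟨k, ((div_lt_iff₀ hl).1 hk).le⟩ fun j hj => ?_
  have : (2 : ℝ) ^ m ≤ 2 ^ j := le_of_mul_le_mul_right (h.trans hj) hl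
  exact (pow_le_pow_iff_right₀ one_lt_two).1 this

lemma coeffK_self (Q : Cube μ) : coeffK n Q Q = 1 := by
  cases Q with
  | whole h => rfl
  | cube x l hx hl =>
    refine le_antisymm ?_ (one_le_coeffK _ _)
    refine (coeffK_le_of_le (m := 0) (by simp)).trans (by simp)

lemma sum_density_Icc_le (hG : CubeGrowth n c μ) (x : Fin d → ℝ) {l : ℝ} (hl : 0 < l) (m : ℕ) :
    ∑ k ∈ Finset.Icc 1 m, density n μ x l k ≤ m * c := by
  refine (Finset.sum_le_card_nsmul _ _ _ fun k _ => hG.density_le x hl k).trans (le_of_eq ?_)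
  simp

/-- Cubes of comparable size have a bounded coefficient. -/
lemma coeffK_le_of_comparable (hG : CubeGrowth n c μ) {x y : Fin d → ℝ} {l s : ℝ}
    {hx : x ∈ μ.support} {hy : y ∈ μ.support} {hl : 0 < l} {hs : 0 < s} {m : ℕ}
    (h : s ≤ 2 ^ m * l) :
    coeffK n (.cube x l hx hl) (.cube y s hy hs) ≤ 1 + m * c :=
  (coeffK_le_of_le h).trans (by gcongr; exact sum_density_Icc_le hG x hl m)

/-- `K_{Q, 2ᴺQ}` is bounded if there is no doubling cube strictly between `Q` and `2ᴺ Q`. -/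
lemma coeffK_dilate_le (hnd : n ≤ d) (hG : CubeGrowth n c μ) (Q : Cube μ) (N : ℕ)
    (h : ∀ k, 1 ≤ k → k < N → ¬ (Q.dilate k).IsDoubling) :
    coeffK n Q (Q.dilate N) ≤ 1 + 2 * c := by
  cases Q with
  | whole h' => simp [coeffK]
  | cube x l hx hl =>
    refine (coeffK_le_of_le (m := N) le_rfl).trans ?_
    gcongr
    rcases N with _ | N
    · simp
    · have h1 := sum_density_le (n := n) hnd hx hl 1 N fun k h1 h2 => h k h1 (by omega)
      have h2 : ∑ k ∈ Finset.Icc 1 (N + 1), density n μ x l k =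
          (∑ i ∈ Finset.range N, density n μ x l (1 + i)) + density n μ x l (N + 1) := by
        have h3 : Finset.Icc 1 N = Finset.Ico 1 (N + 1) := by ext; simp
        rw [Finset.sum_Icc_succ_top (by omega), h3, Finset.sum_Ico_eq_sum_range,
          Nat.add_sub_cancel]
      rw [h2, two_mul, add_comm N 1]
      exact add_le_add (h1.trans (hG.density_le x hl _)) (hG.density_le x hl _)

lemma coeffK_tilde_le (hnd : n ≤ d) (hG : CubeGrowth n c μ) (Q : Cube μ) :
    coeffK n Q Q.tilde ≤ 1 + 2 * c :=
  coeffK_dilate_le hnd hG Q _ fun _ _ hk => Cube.not_isDoubling_of_lt hk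

/-- Inclusion of cubes orders their side lengths. This uses `1 ≤ d`: for `d = 0` all cubes are equal
as sets. -/
lemma dist_le_of_closedBall_subset (hd : 1 ≤ d) {x y : Fin d → ℝ} {l s : ℝ} (hl : 0 < l)
    (h : Metric.closedBall x (l / 2) ⊆ Metric.closedBall y (s / 2)) :
    l ≤ s ∧ dist x y ≤ s / 2 := by
  refine ⟨?_, h (Metric.mem_closedBall_self (by positivity))⟩
  have key : ∀ ε : ℝ, |ε| = l / 2 → |x ⟨0, hd⟩ + ε - y ⟨0, hd⟩| ≤ s / 2 := by
    intro ε hε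
    have h1 : (fun i => x i + ε) ∈ Metric.closedBall x (l / 2) := by
      rw [Metric.mem_closedBall, dist_pi_le_iff (by positivity)]
      intro i
      simp [hε]
    have h2 := h h1
    rw [Metric.mem_closedBall] at h2
    have h3 := (dist_le_pi_dist (fun i => x i + ε) y ⟨0, hd⟩).trans h2
    rwa [Real.dist_eq] at h3
  have h1 := key (l / 2) (abs_of_pos (by positivity))
  have h2 := key (-(l / 2)) (by rw [abs_neg, abs_of_pos (by positivity)])
  have h3 := (abs_le.1 h1).2
  have h4 := (abs_le.1 h2).1
  linarith

lemma not_univ_subset_closedBall (hd : 1 ≤ d) (y : Fin d → ℝ) (s : ℝ) :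
    ¬ univ ⊆ Metric.closedBall y s := by
  intro h
  have h1 : (fun i => y i + (|s| + 1)) ∈ Metric.closedBall y s := h trivial
  rw [Metric.mem_closedBall] at h1
  have h2 := (dist_le_pi_dist _ y ⟨0, hd⟩).trans h1
  rw [Real.dist_eq] at h2
  have h3 := le_abs_self s
  have h4 : |y ⟨0, hd⟩ + (|s| + 1) - y ⟨0, hd⟩| = |s| + 1 := by
    rw [add_sub_cancel_left, abs_of_pos (by positivity)]
  linarith

/-- For nested cubes whose side lengths agree up to a factor `4`, the density of the smaller one is
controlled by that of the larger one. -/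
lemma density_le_of_subset {x y : Fin d → ℝ} {l s : ℝ} (hs : 0 < s) {k j : ℕ}
    (h1 : dist x y + 2 ^ k * l / 2 ≤ 2 ^ j * s / 2) (h2 : 2 ^ j * s ≤ 4 * (2 ^ k * l)) :
    density n μ x l k ≤ 4 ^ n * density n μ y s j := by
  have h3 : ENNReal.ofReal ((2 ^ j * s) ^ n) ≤ 4 ^ n * ENNReal.ofReal ((2 ^ k * l) ^ n) := by
    refine (ENNReal.ofReal_le_ofReal (pow_le_pow_left₀ (by positivity) h2 n)).trans (le_of_eq ?_)
    rw [mul_pow 4, ENNReal.ofReal_mul (by positivity), ENNReal.ofReal_pow (by norm_num)]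
    simp
  have h4 : (4 : ℝ≥0∞) ^ n ≠ 0 := by positivity
  have h5 : (4 : ℝ≥0∞) ^ n ≠ ∞ := ENNReal.pow_ne_top (by norm_num)
  simp only [density]
  rw [← ENNReal.mul_div_mul_left (μ (Metric.closedBall x (2 ^ k * l / 2))) _ h4 h5,
    ← mul_div_assoc]
  refine ENNReal.div_le_div ?_ h3
  gcongr
  exact Metric.closedBall_subset_closedBall' (by linarith)

/-- For cubes `Q ⊆ R` there is a doubling cube `S` containing `Q̃` and `R̃`, with coefficients
controlled by `K_{Q,R}`: take `S = (2ᵐR)~` with `2ᵐR` just large enough. The densities at scales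
below `l(Q̃)`, or below `l(R̃)` around `R`, or between `2ᵐR` and `S`, are summable because no doubling
cubes occur there. -/
lemma exists_common_doubling (hd : 1 ≤ d) (hnd : n ≤ d) (hG : CubeGrowth n c μ) (Q R : Cube μ)
    (hQR : Q.toSet ⊆ R.toSet) :
    ∃ S : Cube μ, S.IsDoubling ∧ Q.tilde.toSet ⊆ S.toSet ∧ R.tilde.toSet ⊆ S.toSet ∧
      coeffK n Q.tilde S ≤ (1 + 4 ^ n * (4 ^ n + 8) * c : ℝ≥0) * coeffK n Q R ∧
      coeffK n R.tilde S ≤ (1 + 4 ^ n * (4 ^ n + 8) * c : ℝ≥0) * coeffK n Q R := by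
  have hone : (1 : ℝ≥0∞) ≤ (1 + 4 ^ n * (4 ^ n + 8) * c : ℝ≥0) := by
    rw [ENNReal.coe_add]; simp
  have trivial_bound : ∀ Q' R' : Cube μ, (1 : ℝ≥0∞) ≤
      (1 + 4 ^ n * (4 ^ n + 8) * c : ℝ≥0) * coeffK n Q' R' :=
    fun Q' R' => one_le_mul hone (one_le_coeffK _ _)
  cases R with
  | whole h =>
    refine ⟨.whole h, Cube.isDoubling_whole h, subset_univ _, subset_univ _, ?_,
      trivial_bound _ _⟩
    cases Q with
    | whole h' => exact trivial_bound _ _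
    | cube x l hx hl =>
      refine le_trans ?_ (le_mul_of_one_le_left zero_le hone)
      rw [Cube.tilde_eq]
      set a := (Cube.cube x l hx hl : Cube μ).tildeExp
      change 1 + ∑' k : ℕ, density n μ x (2 ^ a * l) (k + 1) ≤ 1 + ∑' k : ℕ, density n μ x l (k + 1)
      refine add_le_add le_rfl ?_
      simp only [density_shift]
      refine ENNReal.tsum_comp_le_tsum_of_injective (f := fun k : ℕ => a + k)
        (fun i j hij => by simpa using hij) (fun k => density n μ x l (k + 1))
  | cube y s hy hs =>
    cases Q with
    | whole h' => exact absurd hQR (not_univ_subset_closedBall hd _ _)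
    | cube x l hx hl =>
      obtain ⟨hls, hdist⟩ := dist_le_of_closedBall_subset hd hl hQR
      -- `e` is the scale of `R` seen from `Q`: `2 ^ e * l ≤ s < 2 ^ (e + 1) * l`
      obtain ⟨e, he1, he2⟩ := exists_nat_pow_near ((one_le_div hl).2 hls) (one_lt_two (α := ℝ))
      rw [le_div_iff₀ hl] at he1
      rw [div_lt_iff₀ hl] at he2
      set a := (Cube.cube x l hx hl : Cube μ).tildeExp with ha
      set b := (Cube.cube y s hy hs : Cube μ).tildeExp with hb
      -- the first scale at which the dilates of `R` contain both `Q̃` and `R̃`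
      set m := max b (a - e) + 1 with hm
      set p := density n μ x l with hp
      set q := density n μ y s with hq
      have hpc : ∀ k, p k ≤ c := hG.density_le x hl
      have hqc : ∀ k, q k ≤ c := hG.density_le y hs
      -- the densities around the two centers are comparable at all scales above `s`
      have hpq : ∀ i, p (e + i) ≤ 4 ^ n * q (i + 1) := by
        intro i
        have h1 : (1 : ℝ) ≤ 2 ^ i := one_le_pow₀ (by norm_num)
        have h2 := mul_le_mul_of_nonneg_left he1 (by positivity : (0 : ℝ) ≤ 2 ^ i)
        have h3 := mul_lt_mul_of_pos_left he2 (by positivity : (0 : ℝ) < 2 ^ i)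
        have h4 : s ≤ 2 ^ i * s := le_mul_of_one_le_left hs.le h1
        refine density_le_of_subset hs ?_ ?_
        · rw [pow_add, pow_succ 2 i]; linarith
        · rw [pow_add 2 e i, pow_succ 2 i]; rw [pow_succ] at h3; linarith
      have hqp : ∀ i, q i ≤ 4 ^ n * p (e + i + 2) := by
        intro i
        have h1 : (1 : ℝ) ≤ 2 ^ i := one_le_pow₀ (by norm_num)
        have h2 := mul_le_mul_of_nonneg_left he1 (by positivity : (0 : ℝ) ≤ 2 ^ i)
        have h3 := mul_lt_mul_of_pos_left he2 (by positivity : (0 : ℝ) < 2 ^ i)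
        have h4 : s ≤ 2 ^ i * s := le_mul_of_one_le_left hs.le h1
        refine density_le_of_subset hl ?_ ?_
        · rw [pow_add, pow_add, dist_comm]; rw [pow_succ] at h3; linarith
        · rw [pow_add, pow_add]; linarith
      have hexp : ∃ N, ((Cube.cube y s hy hs : Cube μ).dilate (m + N)).IsDoubling :=
        Cube.exists_isDoubling hnd hG _ m
      classical
      set N := Nat.find hexp with hN
      have hNd := Nat.find_spec hexp
      have hNmin : ∀ k, m ≤ k → k < m + N →
          ¬ ((Cube.cube y s hy hs : Cube μ).dilate k).IsDoubling := by
        intro k h1 h2 h3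
        refine Nat.find_min hexp (m := k - m) (by omega) ?_
        rwa [Nat.add_sub_cancel' h1]
      have hal : (2 : ℝ) ^ a * l ≤ 2 ^ (a - e) * s := by
        rcases le_total e a with h | h
        · calc (2 : ℝ) ^ a * l = 2 ^ (a - e) * (2 ^ e * l) := by
                rw [← mul_assoc, ← pow_add, Nat.sub_add_cancel h]
            _ ≤ _ := by gcongr
        · rw [Nat.sub_eq_zero_of_le h, pow_zero, one_mul]
          refine le_trans ?_ he1
          gcongr
          norm_num
      -- the sums of the densities without doubling cubes
      have hsp : ∑ i ∈ Finset.range a, p i ≤ c := by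
        have := sum_density_le (n := n) hnd hx hl 0 a fun k _ h2 =>
          Cube.not_isDoubling_of_lt (by omega)
        simp only [zero_add] at this
        exact this.trans (hpc _)
      have hsq : ∑ i ∈ Finset.range b, q i ≤ c := by
        have := sum_density_le (n := n) hnd hy hs 0 b fun k _ h2 =>
          Cube.not_isDoubling_of_lt (by omega)
        simp only [zero_add] at this
        exact this.trans (hqc _)
      have hsN : ∑ i ∈ Finset.range N, q (m + i) ≤ c :=
        (sum_density_le (n := n) hnd hy hs m N hNmin).trans (hqc _)
      have h4n : (1 : ℝ≥0∞) ≤ 4 ^ n := one_le_pow₀ (by norm_num)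
      -- below the scale `m`: if `b < a - e`, the densities around `y` are compared with those of
      -- the non-doubling cubes below `Q̃`, with three scales to spare
      have hsm : ∑ i ∈ Finset.range m, q i ≤ (4 ^ n + 3) * c := by
        rcases le_total (a - e) b with h | h
        · rw [hm, max_eq_left h, Finset.sum_range_succ]
          calc _ ≤ (c : ℝ≥0∞) + c := add_le_add hsq (hqc _)
            _ = (1 + 1) * c := by ring
            _ ≤ (4 ^ n + 3) * c := by gcongr; norm_num
        · rw [hm, max_eq_right h]
          have h1 : ∑ i ∈ Finset.range (a - e - 2), q i ≤ 4 ^ n * c := by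
            calc _ ≤ ∑ i ∈ Finset.range (a - e - 2), 4 ^ n * p (e + i + 2) :=
                  Finset.sum_le_sum fun i _ => hqp i
              _ = 4 ^ n * ∑ i ∈ Finset.range (a - e - 2), p (e + i + 2) := by
                  rw [Finset.mul_sum]
              _ ≤ 4 ^ n * ∑ i ∈ Finset.range a, p i := by
                  gcongr
                  rw [← Finset.sum_image (f := p) (g := fun i => e + i + 2)
                    (fun i _ j _ hij => by simpa using hij)]
                  refine Finset.sum_le_sum_of_subset fun j hj => ?_
                  simp only [Finset.mem_image, Finset.mem_range] at hj ⊢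
                  obtain ⟨i, hi, rfl⟩ := hj
                  omega
              _ ≤ 4 ^ n * c := by gcongr
          calc ∑ i ∈ Finset.range (a - e + 1), q i
              ≤ ∑ i ∈ Finset.range (a - e - 2 + 3), q i :=
                Finset.sum_le_sum_of_subset (Finset.range_mono (by omega))
            _ ≤ 4 ^ n * c + c + c + c := by
                rw [Finset.sum_range_succ, Finset.sum_range_succ, Finset.sum_range_succ]
                exact add_le_add (add_le_add (add_le_add h1 (hqc _)) (hqc _)) (hqc _)
            _ = (4 ^ n + 3) * c := by ring
      have hA : ∀ j, ∑ i ∈ Finset.range (m + N + j), q i ≤ (4 ^ n + 4 + j) * c := by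
        intro j
        rw [Finset.sum_range_add, Finset.sum_range_add]
        calc _ ≤ (4 ^ n + 3) * (c : ℝ≥0∞) + c + j * c := by
              refine add_le_add (add_le_add hsm hsN) ?_
              refine (Finset.sum_le_card_nsmul _ _ _ fun k _ => hqc _).trans (le_of_eq ?_)
              simp
          _ = _ := by ring
      refine ⟨_, hNd, ?_, ?_, ?_, ?_⟩
      · refine Metric.closedBall_subset_closedBall' ?_
        have h1 : (2 : ℝ) ^ (a - e + 1) ≤ 2 ^ (m + N) :=
          pow_le_pow_right₀ (by norm_num) (by omega)
        have h2 := mul_le_mul_of_nonneg_right h1 hs.le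
        have h3 : (1 : ℝ) ≤ 2 ^ (a - e) := one_le_pow₀ (by norm_num)
        have h4 : s ≤ 2 ^ (a - e) * s := le_mul_of_one_le_left hs.le h3
        rw [pow_succ] at h2
        change 2 ^ a * l / 2 + dist x y ≤ 2 ^ (m + N) * s / 2
        linarith
      · refine Metric.closedBall_subset_closedBall ?_
        change 2 ^ b * s / 2 ≤ 2 ^ (m + N) * s / 2
        have h1 : (2 : ℝ) ^ b ≤ 2 ^ (m + N) := pow_le_pow_right₀ (by norm_num) (by omega)
        gcongr
      · have h1 : (2 : ℝ) ^ (m + N) * s ≤ 2 ^ (e + 1 + (m + N) - a) * (2 ^ a * l) := by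
          calc (2 : ℝ) ^ (m + N) * s ≤ 2 ^ (m + N) * (2 ^ (e + 1) * l) := by gcongr
            _ = 2 ^ (e + 1 + (m + N) - a + a) * l := by
                rw [Nat.sub_add_cancel (by omega)]; ring
            _ = _ := by ring
        refine (coeffK_le_of_le h1).trans ?_
        simp only [density_shift]
        -- the scales up to `e` are part of `K_{Q,R}`; those above `e` are compared with scales
        -- around `y`
        have h2 : ∑ k ∈ Finset.Icc 1 (e + 1 + (m + N) - a), density n μ x l (a + k) ≤
            ∑ k ∈ Finset.Icc 1 e, p k + ∑ i ∈ Finset.range (m + N + 2), p (e + i) := by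
          rw [← Finset.sum_image (f := density n μ x l) (g := fun k => a + k)
            (fun i _ j _ hij => by simpa using hij)]
          rw [← Finset.sum_image (s := Finset.range (m + N + 2)) (f := p) (g := fun k => e + k)
            (fun i _ j _ hij => by simpa using hij)]
          refine le_trans (Finset.sum_le_sum_of_subset
            (t := Finset.Icc 1 e ∪ (Finset.range (m + N + 2)).image fun k => e + k) ?_)
            ((Finset.sum_union_inter (f := p)).symm ▸ le_self_add)
          intro k hk
          simp only [Finset.mem_image, Finset.mem_Icc, Finset.mem_union, Finset.mem_range] at hk ⊢
          obtain ⟨i, hi, rfl⟩ := hk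
          rcases le_total (a + i) e with h | h
          · exact Or.inl ⟨by omega, h⟩
          · exact Or.inr ⟨a + i - e, by omega, by omega⟩
        have h3 : ∑ i ∈ Finset.range (m + N + 2), p (e + i) ≤ 4 ^ n * ((4 ^ n + 8) * c) := by
          calc _ ≤ ∑ i ∈ Finset.range (m + N + 2), 4 ^ n * q (i + 1) :=
                Finset.sum_le_sum fun i _ => hpq i
            _ = 4 ^ n * ∑ i ∈ Finset.range (m + N + 2), q (i + 1) := by rw [Finset.mul_sum]
            _ ≤ 4 ^ n * ∑ i ∈ Finset.range (m + N + 3), q i := by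
                gcongr
                rw [Finset.sum_range_succ' _ (m + N + 2)]
                exact le_self_add
            _ ≤ 4 ^ n * ((4 ^ n + 8) * c) := by
                gcongr
                refine (hA 3).trans (mul_le_mul_left ?_ _)
                rw [add_assoc]
                exact add_le_add le_rfl (by norm_num)
        calc 1 + ∑ k ∈ Finset.Icc 1 (e + 1 + (m + N) - a), density n μ x l (a + k)
            ≤ 1 + (∑ k ∈ Finset.Icc 1 e, p k + 4 ^ n * ((4 ^ n + 8) * c)) := by
              gcongr; exact h2.trans (by gcongr)
          _ = (1 + ∑ k ∈ Finset.Icc 1 e, p k) + 4 ^ n * ((4 ^ n + 8) * c) * 1 := by ring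
          _ ≤ coeffK n (.cube x l hx hl) (.cube y s hy hs) + 4 ^ n * ((4 ^ n + 8) * c) *
              coeffK n (.cube x l hx hl) (.cube y s hy hs) := by
              gcongr
              · exact le_coeffK_of_le he1
              · exact one_le_coeffK _ _
          _ = _ := by push_cast; ring
      · have h1 : (2 : ℝ) ^ (m + N) * s ≤ 2 ^ (m + N - b) * (2 ^ b * s) := by
          rw [← mul_assoc, ← pow_add, Nat.sub_add_cancel (by omega)]
        refine (coeffK_le_of_le h1).trans ?_
        simp only [density_shift]
        calc 1 + ∑ k ∈ Finset.Icc 1 (m + N - b), density n μ y s (b + k)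
            ≤ 1 + ∑ i ∈ Finset.range (m + N + 1), q i := by
              gcongr
              rw [← Finset.sum_image (f := density n μ y s) (g := fun k => b + k)
                (fun i _ j _ hij => by simpa using hij)]
              refine Finset.sum_le_sum_of_subset fun j hj => ?_
              simp only [Finset.mem_image, Finset.mem_range, Finset.mem_Icc] at hj ⊢
              obtain ⟨i, hi, rfl⟩ := hj
              omega
          _ ≤ 1 + 4 ^ n * ((4 ^ n + 8) * c) := by
              gcongr
              refine (hA 1).trans ?_
              refine le_trans ?_ (le_mul_of_one_le_left zero_le h4n)
              refine mul_le_mul_left ?_ _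
              rw [add_assoc]
              exact add_le_add le_rfl (by norm_num)
          _ = (1 + 4 ^ n * (4 ^ n + 8) * c : ℝ≥0) * 1 := by push_cast; ring
          _ ≤ _ := by gcongr; exact one_le_coeffK _ _

/-! ### Functions of controlled oscillation -/

/-- The oscillation of `f` is controlled by a family of numbers `F Q`, indexed by all cubes, which
vary slowly with respect to the coefficients `K_{Q,R}`. Unlike the definition of `RBMO(μ)` by means,
this condition is visibly stable under composition with contractions. -/
structure OscData (n : ℕ) (μ : Measure (Fin d → ℝ)) (A : ℝ≥0) (f : (Fin d → ℝ) → ℝ)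
    (F : Cube μ → ℝ) : Prop where
  locInt : LocallyIntegrable f μ
  osc : ∀ Q : Cube μ, ∫⁻ x in Q.toSet, ‖f x - F Q‖ₑ ∂μ ≤ A * μ (Q.dilate 1).toSet
  reg : ∀ Q R : Cube μ, Q.toSet ⊆ R.toSet → ‖F Q - F R‖ₑ ≤ A * coeffK n Q R

/-- The constant bounding `|m_{Q̃} f - m_{R̃} f|` by `‖f‖_* K_{Q,R}`. -/
def tildeConst (n : ℕ) (c : ℝ≥0) : ℝ≥0 := 2 * (1 + 4 ^ n * (4 ^ n + 8) * c)

lemma IsRBMOWith.oscData (hd : 1 ≤ d) (hnd : n ≤ d) (hG : CubeGrowth n c μ) {C : ℝ≥0}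
    {f : (Fin d → ℝ) → ℝ} (hf : IsRBMOWith n μ C f) :
    OscData n μ (C * tildeConst n c) f (fun Q => ⨍ y in Q.tilde.toSet, f y ∂μ) where
  locInt := hf.locInt
  osc Q := by
    refine (hf.osc Q).trans ?_
    gcongr
    refine le_mul_of_one_le_right zero_le ?_
    rw [tildeConst, mul_add, mul_one]
    exact le_add_right (by norm_num)
  reg Q R hQR := by
    obtain ⟨S, hS, hQS, hRS, h1, h2⟩ := exists_common_doubling hd hnd hG Q R hQR
    have hQ := hf.reg Q.tilde S (Q.tilde_isDoubling hnd hG) hS hQS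
    have hR := hf.reg R.tilde S (R.tilde_isDoubling hnd hG) hS hRS
    rw [← enorm_neg, neg_sub] at hR
    set u := ⨍ y in Q.tilde.toSet, f y ∂μ
    set v := ⨍ y in S.toSet, f y ∂μ
    set w := ⨍ y in R.tilde.toSet, f y ∂μ
    calc ‖u - w‖ₑ = ‖(u - v) + (v - w)‖ₑ := by ring_nf
      _ ≤ ‖u - v‖ₑ + ‖v - w‖ₑ := enorm_add_le _ _
      _ ≤ C * ((1 + 4 ^ n * (4 ^ n + 8) * c : ℝ≥0) * coeffK n Q R) +
          C * ((1 + 4 ^ n * (4 ^ n + 8) * c : ℝ≥0) * coeffK n Q R) :=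
          add_le_add (hQ.trans (by gcongr)) (hR.trans (by gcongr))
      _ = _ := by rw [tildeConst]; push_cast; ring

/-- Truncation at height `m`. -/
def clip (m : ℝ) (t : ℝ) : ℝ := max (-m) (min t m)

lemma abs_clip_sub_clip_le (m s t : ℝ) : |clip m s - clip m t| ≤ |s - t| := by
  unfold clip
  rw [max_comm, max_comm (-m)]
  refine (abs_max_sub_max_le_abs _ _ _).trans ?_
  have h := abs_max_sub_max_le_abs (-s) (-t) (-m)
  rw [max_neg_neg, max_neg_neg] at h
  rw [← abs_neg]
  refine (le_of_eq ?_).trans (h.trans (le_of_eq ?_))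
  · congr 1; ring
  · rw [← abs_neg]; congr 1; ring

lemma enorm_clip_sub_clip_le (m s t : ℝ) : ‖clip m s - clip m t‖ₑ ≤ ‖s - t‖ₑ := by
  rw [enorm_le_iff_norm_le]
  exact abs_clip_sub_clip_le m s t

lemma continuous_clip (m : ℝ) : Continuous (clip m) :=
  continuous_const.max (continuous_id.min continuous_const)

lemma abs_clip_le {m : ℝ} (hm : 0 ≤ m) (t : ℝ) : |clip m t| ≤ m :=
  abs_le.2 ⟨le_max_left _ _, max_le (by linarith) (min_le_right _ _)⟩

lemma abs_clip_le_abs {m : ℝ} (hm : 0 ≤ m) (t : ℝ) : |clip m t| ≤ |t| := by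
  have h := abs_clip_sub_clip_le m t 0
  have h0 : clip m 0 = 0 := by simp [clip, hm]
  rwa [h0, sub_zero, sub_zero] at h

lemma clip_eq_self {m t : ℝ} (h : |t| ≤ m) : clip m t = t := by
  rw [clip, min_eq_left (abs_le.1 h).2, max_eq_right (abs_le.1 h).1]

lemma tendsto_clip (t : ℝ) : Tendsto (fun m : ℕ => clip m t) atTop (𝓝 t) := by
  obtain ⟨N, hN⟩ := exists_nat_ge |t|
  refine tendsto_const_nhds.congr' ?_
  filter_upwards [eventually_ge_atTop N] with m hm
  exact (clip_eq_self (hN.trans (by exact_mod_cast hm))).symm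

lemma OscData.clip {A : ℝ≥0} {f : (Fin d → ℝ) → ℝ} {F : Cube μ → ℝ} (h : OscData n μ A f F)
    {m : ℝ} (hm : 0 ≤ m) :
    OscData n μ A (fun x => clip m (f x)) (fun Q => clip m (F Q)) where
  locInt := h.locInt.mono ((continuous_clip m).comp_aestronglyMeasurable
    h.locInt.aestronglyMeasurable) (Eventually.of_forall fun _ => abs_clip_le_abs hm _)
  osc Q := (lintegral_mono fun _ => enorm_clip_sub_clip_le m _ _).trans (h.osc Q)
  reg Q R hQR := (enorm_clip_sub_clip_le m _ _).trans (h.reg Q R hQR)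

lemma OscData.smul {A : ℝ≥0} {f : (Fin d → ℝ) → ℝ} {F : Cube μ → ℝ} (h : OscData n μ A f F)
    (t : ℝ≥0) : OscData n μ (t * A) (fun x => (t : ℝ) * f x) (fun Q => (t : ℝ) * F Q) where
  locInt := h.locInt.smul (t : ℝ)
  osc Q := by
    simp_rw [← mul_sub, enorm_mul]
    rw [lintegral_const_mul' _ _ enorm_ne_top, ENNReal.coe_mul, mul_assoc]
    refine (mul_le_mul_right (h.osc Q) _).trans (le_of_eq ?_)
    simp
  reg Q R hQR := by
    rw [← mul_sub, enorm_mul, ENNReal.coe_mul, mul_assoc]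
    refine (mul_le_mul_right (h.reg Q R hQR) _).trans (le_of_eq ?_)
    simp

lemma enorm_average_sub_mul_le {f : (Fin d → ℝ) → ℝ} {s : Set (Fin d → ℝ)}
    (hf : IntegrableOn f s μ) (hs : μ s ≠ ∞) (a : ℝ) :
    ‖(⨍ y in s, f y ∂μ) - a‖ₑ * μ s ≤ ∫⁻ x in s, ‖f x - a‖ₑ ∂μ := by
  by_cases h0 : μ s = 0
  · simp [h0]
  have hfin : IsFiniteMeasure (μ.restrict s) := ⟨by simpa using hs.lt_top⟩
  have h1 : ∫ x in s, (f x - a) ∂μ = ((⨍ y in s, f y ∂μ) - a) * μ.real s := by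
    rw [integral_sub hf (integrable_const a), setAverage_eq]
    have : μ.real s ≠ 0 := by
      rw [measureReal_def, ENNReal.toReal_ne_zero]; exact ⟨h0, hs⟩
    simp only [integral_const, smul_eq_mul, measureReal_restrict_apply_univ]
    field_simp
  have h2 : ‖μ.real s‖ₑ = μ s := by
    rw [Real.enorm_eq_ofReal measureReal_nonneg, measureReal_def, ENNReal.ofReal_toReal hs]
  rw [← h2, ← enorm_mul, ← h1]
  exact enorm_integral_le_lintegral_enorm _

lemma OscData.integrableOn {A : ℝ≥0} {f : (Fin d → ℝ) → ℝ} {F : Cube μ → ℝ}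
    (h : OscData n μ A f F) (Q : Cube μ) : IntegrableOn f Q.toSet μ := by
  cases Q with
  | cube x l hx hl => exact h.locInt.integrableOn_isCompact (isCompact_closedBall x (l / 2))
  | whole h' =>
    have : IsFiniteMeasure μ := ⟨h'⟩
    have h2 : Integrable (fun x => f x - F (.whole h')) μ := by
      refine ⟨h.locInt.aestronglyMeasurable.sub aestronglyMeasurable_const, ?_⟩
      refine lt_of_le_of_lt ?_ (ENNReal.mul_lt_top (ENNReal.coe_lt_top (r := A)) h')
      simpa [Cube.toSet, Cube.dilate] using h.osc (.whole h')
    have h4 : Integrable f μ := by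
      refine (h2.add (integrable_const (F (.whole h')))).congr (Eventually.of_forall fun x => ?_)
      simp
    exact h4.integrableOn

/-- On a doubling cube, `F Q` is close to the mean of `f`. -/
lemma OscData.enorm_average_sub_le [IsLocallyFiniteMeasure μ] (hμ : μ ≠ 0) {A : ℝ≥0}
    {f : (Fin d → ℝ) → ℝ} {F : Cube μ → ℝ} (h : OscData n μ A f F) {Q : Cube μ}
    (hQ : Q.IsDoubling) : ‖(⨍ y in Q.toSet, f y ∂μ) - F Q‖ₑ ≤ 2 ^ (d + 1) * A := by
  have h1 := (enorm_average_sub_mul_le (h.integrableOn Q) Q.measure_lt_top.ne (F Q)).trans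
    (h.osc Q)
  rw [Cube.isDoubling_iff] at hQ
  have h2 : ‖(⨍ y in Q.toSet, f y ∂μ) - F Q‖ₑ * μ Q.toSet ≤ (2 ^ (d + 1) * A) * μ Q.toSet :=
    h1.trans ((mul_le_mul_right hQ _).trans (le_of_eq (by ring)))
  exact (ENNReal.mul_le_mul_iff_left (Q.measure_pos hμ).ne' Q.measure_lt_top.ne).1 h2

/-- The numbers `F Q` and `F R` are close if `R` has side length `s` and `Q` is a cube near `R` with
side length between `s/4` and `s`. -/
lemma OscData.enorm_sub_le_of_near (hG : CubeGrowth n c μ) {A : ℝ≥0} {f : (Fin d → ℝ) → ℝ}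
    {F : Cube μ → ℝ} (h : OscData n μ A f F) {x y : Fin d → ℝ} {l s : ℝ}
    {hx : x ∈ μ.support} {hy : y ∈ μ.support} {hl : 0 < l} {hs : 0 < s}
    (hdist : dist x y ≤ s) (hls : l ≤ s) (hsl : s ≤ 4 * l) :
    ‖F (.cube x l hx hl) - F (.cube y s hy hs)‖ₑ ≤ A * (2 + 6 * c) := by
  have hs4 : 0 < 4 * s := by positivity
  have h1 := h.reg (.cube x l hx hl) (.cube y (4 * s) hy hs4)
    (Metric.closedBall_subset_closedBall' (by linarith))
  have h2 := h.reg (.cube y s hy hs) (.cube y (4 * s) hy hs4)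
    (Metric.closedBall_subset_closedBall (by linarith))
  have h3 : coeffK n (.cube x l hx hl) (.cube y (4 * s) hy hs4) ≤ 1 + (4 : ℕ) * c :=
    coeffK_le_of_comparable hG (by norm_num; linarith)
  have h4 : coeffK n (.cube y s hy hs) (.cube y (4 * s) hy hs4) ≤ 1 + (2 : ℕ) * c :=
    coeffK_le_of_comparable hG (by norm_num)
  rw [← enorm_neg, neg_sub] at h2
  have h5 := enorm_add_le (F (.cube x l hx hl) - F (.cube y (4 * s) hy hs4))
    (F (.cube y (4 * s) hy hs4) - F (.cube y s hy hs))
  rw [sub_add_sub_cancel] at h5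
  refine h5.trans ((add_le_add (h1.trans (mul_le_mul_right h3 _))
    (h2.trans (mul_le_mul_right h4 _))).trans (le_of_eq ?_))
  push_cast
  ring

/-- The oscillation on a slightly enlarged cube is still controlled by the measure of the double
cube, by covering the enlarged cube with boundedly many small cubes. -/
lemma exists_osc_enlarged_le (d n : ℕ) (c : ℝ≥0) :
    ∃ C : ℝ≥0, ∀ μ : Measure (Fin d → ℝ), CubeGrowth n c μ → ∀ (f : (Fin d → ℝ) → ℝ)
      (F : Cube μ → ℝ), OscData n μ 1 f F → ∀ (y : Fin d → ℝ) (s : ℝ) (hy : y ∈ μ.support)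
      (hs : 0 < s), ∫⁻ x in Metric.closedBall y (5 / 8 * s), ‖f x - F (.cube y s hy hs)‖ₑ ∂μ ≤
        C * μ (Metric.closedBall y s) := by
  obtain ⟨T, -, hTfin, hT⟩ := (isCompact_closedBall (0 : Fin d → ℝ) 1).finite_cover_balls
    (e := 1 / 16) (by norm_num)
  refine ⟨hTfin.toFinset.card * (3 + 6 * c), fun μ hG f F h y s hy hs => ?_⟩
  have := hTfin.fintype
  have hloc := hG.isLocallyFiniteMeasure
  set g : (Fin d → ℝ) → ℝ≥0∞ := fun x => ‖f x - F (.cube y s hy hs)‖ₑ with hg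
  have hcover : Metric.closedBall y (5 / 8 * s) ⊆
      ⋃ t : T, Metric.ball (y + s • (t : Fin d → ℝ)) (s / 16) ∩ Metric.closedBall y (5 / 8 * s) := by
    intro x hx
    have h1 : s⁻¹ • (x - y) ∈ Metric.closedBall (0 : Fin d → ℝ) 1 := by
      rw [mem_closedBall_zero_iff, norm_smul, norm_inv, Real.norm_of_nonneg hs.le]
      rw [mem_closedBall_iff_norm] at hx
      rw [inv_mul_le_iff₀ hs]
      linarith
    obtain ⟨t, ht, hxt⟩ := mem_iUnion₂.1 (hT h1)
    refine mem_iUnion.2 ⟨⟨t, ht⟩, ?_, hx⟩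
    rw [mem_ball_iff_norm] at hxt ⊢
    have h2 : x - (y + s • t) = s • (s⁻¹ • (x - y) - t) := by
      rw [smul_sub, smul_smul, mul_inv_cancel₀ hs.ne', one_smul]; abel
    rw [h2, norm_smul, Real.norm_of_nonneg hs.le]
    have := mul_lt_mul_of_pos_left hxt hs
    linarith
  have hpiece : ∀ t : T, ∫⁻ x in Metric.ball (y + s • (t : Fin d → ℝ)) (s / 16) ∩
      Metric.closedBall y (5 / 8 * s), g x ∂μ ≤ (3 + 6 * c) * μ (Metric.closedBall y s) := by
    intro t
    set U := Metric.ball (y + s • (t : Fin d → ℝ)) (s / 16) ∩ Metric.closedBall y (5 / 8 * s)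
    by_cases hU : (U ∩ μ.support).Nonempty
    · obtain ⟨z, ⟨hz1, hz2⟩, hz3⟩ := hU
      have hs4 : 0 < s / 4 := by positivity
      have h1 : U ⊆ (Cube.cube z (s / 4) hz3 hs4 : Cube μ).toSet := by
        intro x hx
        have h2 := dist_triangle_right x z (y + s • (t : Fin d → ℝ))
        have h3 := Metric.mem_ball.1 hx.1
        have h4 := Metric.mem_ball.1 hz1
        exact Metric.mem_closedBall.2 (by linarith)
      have h2 : ((Cube.cube z (s / 4) hz3 hs4 : Cube μ).dilate 1).toSet ⊆
          Metric.closedBall y s := by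
        refine Metric.closedBall_subset_closedBall' ?_
        have := Metric.mem_closedBall.1 hz2
        rw [pow_one]
        linarith
      have h3 := h.enorm_sub_le_of_near hG (hx := hz3) (hy := hy) (hl := hs4) (hs := hs)
        ((Metric.mem_closedBall.1 hz2).trans (by linarith)) (by linarith) (by linarith)
      rw [ENNReal.coe_one, one_mul] at h3
      set Z : Cube μ := Cube.cube z (s / 4) hz3 hs4
      calc ∫⁻ x in U, g x ∂μ ≤ ∫⁻ x in Z.toSet, g x ∂μ := lintegral_mono_set h1
        _ ≤ ∫⁻ x in Z.toSet, (‖f x - F Z‖ₑ + (2 + 6 * c)) ∂μ := by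
            refine lintegral_mono fun x => ?_
            have h4 := enorm_add_le (f x - F Z) (F Z - F (.cube y s hy hs))
            rw [sub_add_sub_cancel] at h4
            exact h4.trans (add_le_add le_rfl h3)
        _ = ∫⁻ x in Z.toSet, ‖f x - F Z‖ₑ ∂μ + (2 + 6 * c) * μ Z.toSet := by
            rw [lintegral_add_right _ measurable_const, setLIntegral_const]
        _ ≤ 1 * μ (Metric.closedBall y s) + (2 + 6 * c) * μ (Metric.closedBall y s) := by
            refine add_le_add ((h.osc Z).trans ?_) ?_
            · rw [ENNReal.coe_one]; gcongr
            · gcongr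
              exact (Z.toSet_subset_dilate 1).trans h2
        _ = _ := by ring
    · have h0 : μ U = 0 := by
        rw [not_nonempty_iff_eq_empty, ← disjoint_iff_inter_eq_empty] at hU
        exact measure_mono_null hU.subset_compl_right (Measure.support_mem_ae (μ := μ))
      rw [setLIntegral_measure_zero _ _ h0]
      exact zero_le
  calc _ ≤ ∫⁻ x in ⋃ t : T, Metric.ball (y + s • (t : Fin d → ℝ)) (s / 16) ∩
        Metric.closedBall y (5 / 8 * s), g x ∂μ := lintegral_mono_set hcover
    _ ≤ ∑' t : T, ∫⁻ x in Metric.ball (y + s • (t : Fin d → ℝ)) (s / 16) ∩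
        Metric.closedBall y (5 / 8 * s), g x ∂μ := lintegral_iUnion_le _ _
    _ ≤ ∑' _t : T, (3 + 6 * (c : ℝ≥0∞)) * μ (Metric.closedBall y s) := by
        exact ENNReal.tsum_le_tsum hpiece
    _ = _ := by
        rw [tsum_fintype, Finset.sum_const, nsmul_eq_mul, Finset.card_univ,
          ← Set.toFinset_card, Set.Finite.toFinset_eq_toFinset]
        push_cast
        ring

/-! ### Stopping cubes -/

/-- The cube of side length `2⁻ᵏ s / 4` centered at `x`. -/
def stopCube (x : Fin d → ℝ) (hx : x ∈ μ.support) (s : ℝ) (hs : 0 < s) (k : ℕ) : Cube μ :=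
  .cube x (s / 4 / 2 ^ k) hx (by positivity)

lemma stopCube_dilate (x : Fin d → ℝ) (hx : x ∈ μ.support) (s : ℝ) (hs : 0 < s) {j k : ℕ}
    (h : j ≤ k) : (stopCube x hx s hs k).dilate (k - j) = stopCube x hx s hs j := by
  simp only [stopCube, Cube.dilate]
  congr 1
  have h1 : (2 : ℝ) ^ k = 2 ^ (k - j) * 2 ^ j := by rw [← pow_add, Nat.sub_add_cancel h]
  rw [h1]
  field_simp

/-- The first doubling cube among the `2⁻ᵏ`-cubes around `x` on which `F` differs from `F R` by more
than `B` still has `F` within `B + O(1)` of `F R`: compare it with the next larger doubling cube, or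
with `R` itself if there is none. -/
lemma enorm_stopCube_sub_le (hnd : n ≤ d) (hG : CubeGrowth n c μ) {f : (Fin d → ℝ) → ℝ}
    {F : Cube μ → ℝ} (h : OscData n μ 1 f F) {x y : Fin d → ℝ} {s : ℝ}
    {hx : x ∈ μ.support} {hy : y ∈ μ.support} {hs : 0 < s} (hxy : dist x y ≤ s) {B : ℝ≥0∞} {k : ℕ}
    (hk : ∀ j < k, (stopCube x hx s hs j).IsDoubling →
      ‖F (stopCube x hx s hs j) - F (.cube y s hy hs)‖ₑ ≤ B) :
    ‖F (stopCube x hx s hs k) - F (.cube y s hy hs)‖ₑ ≤ B + (3 + 8 * c) := by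
  have key : ∀ j ≤ k, (∀ i, j < i → i < k → ¬ (stopCube x hx s hs i).IsDoubling) →
      ‖F (stopCube x hx s hs k) - F (stopCube x hx s hs j)‖ₑ ≤ 1 + 2 * c := by
    intro j hj hnot
    have h1 := h.reg (stopCube x hx s hs k) (stopCube x hx s hs j) (by
      rw [← stopCube_dilate x hx s hs hj]; exact Cube.toSet_subset_dilate _ _)
    rw [ENNReal.coe_one, one_mul] at h1
    refine h1.trans ?_
    rw [← stopCube_dilate x hx s hs hj]
    refine coeffK_dilate_le hnd hG _ _ fun i h1 h2 => ?_
    have h3 := stopCube_dilate x hx s hs (Nat.sub_le k i)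
    rw [show k - (k - i) = i by omega] at h3
    rw [h3]
    exact hnot _ (by omega) (by omega)
  have tri : ∀ j, ‖F (stopCube x hx s hs k) - F (.cube y s hy hs)‖ₑ ≤
      ‖F (stopCube x hx s hs k) - F (stopCube x hx s hs j)‖ₑ +
      ‖F (stopCube x hx s hs j) - F (.cube y s hy hs)‖ₑ := by
    intro j
    have := enorm_add_le (F (stopCube x hx s hs k) - F (stopCube x hx s hs j))
      (F (stopCube x hx s hs j) - F (.cube y s hy hs))
    rwa [sub_add_sub_cancel] at this
  by_cases hex : ∃ j, j < k ∧ (stopCube x hx s hs j).IsDoubling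
  · obtain ⟨j, ⟨hj1, hj2⟩, hjmax⟩ : ∃ j, (j < k ∧ (stopCube x hx s hs j).IsDoubling) ∧
        ∀ i, j < i → i < k → ¬ (stopCube x hx s hs i).IsDoubling := by
      classical
      obtain ⟨j0, hj0⟩ := hex
      have hj := Nat.findGreatest_spec (P := fun j => j < k ∧ (stopCube x hx s hs j).IsDoubling)
        hj0.1.le hj0
      refine ⟨_, hj, fun i hi1 hi2 hi3 => ?_⟩
      exact Nat.findGreatest_is_greatest hi1 hi2.le ⟨hi2, hi3⟩
    refine (tri j).trans ((add_le_add (key j hj1.le hjmax) (hk j hj1 hj2)).trans ?_)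
    rw [add_comm]
    gcongr <;> norm_num
  · push Not at hex
    refine (tri 0).trans ((add_le_add (key 0 (Nat.zero_le _) fun i _ hi => hex i hi) ?_).trans
      (b := 1 + 2 * (c : ℝ≥0∞) + (2 + 6 * c)) ?_)
    · have := h.enorm_sub_le_of_near hG (x := x) (y := y) (l := s / 4 / 2 ^ 0) (s := s) (hx := hx)
        (hy := hy) (hl := by positivity) (hs := hs) hxy
        (by rw [pow_zero]; linarith) (by rw [pow_zero]; linarith)
      rwa [ENNReal.coe_one, one_mul] at this
    · refine le_trans (le_of_eq ?_) le_add_self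
      ring

/-- Stopping-time covering: up to a null set, the set where `f` is far from `F R` on the cube `R` is
covered by countably many doubling cubes whose `F`-values differ from `F R` by at least `D` but at
most `D + O(1)`; their total measure is `O(μ(2R) / D)`. -/
lemma exists_stopping_cubes (d n : ℕ) (hnd : n ≤ d) (c : ℝ≥0) :
    ∃ C₁ C₂ : ℝ≥0, ∀ μ : Measure (Fin d → ℝ), CubeGrowth n c μ → ∀ (f : (Fin d → ℝ) → ℝ)
      (F : Cube μ → ℝ), OscData n μ 1 f F → ∀ (y : Fin d → ℝ) (s : ℝ) (hy : y ∈ μ.support)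
      (hs : 0 < s) (D : ℝ≥0), ∃ (ι : Type) (_ : Countable ι) (P : ι → Cube μ),
        (∀ i, ∃ x l hx hl, P i = .cube x l hx hl) ∧ (∀ i, (P i).IsDoubling) ∧
        (∀ i, ‖F (P i) - F (.cube y s hy hs)‖ₑ ≤ D + C₂) ∧
        D * ∑' i, μ (P i).toSet ≤ C₁ * μ (Metric.closedBall y s) ∧
        ∀ᵐ x ∂μ, x ∈ Metric.closedBall y (s / 2) → x ∉ ⋃ i, (P i).toSet →
          ‖f x - F (.cube y s hy hs)‖ₑ ≤ D + C₂ := by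
  obtain ⟨C, hC⟩ := exists_osc_enlarged_le d n c
  obtain ⟨N, τ, hτ, hN⟩ := HasBesicovitchCovering.no_satelliteConfig (α := Fin d → ℝ)
  refine ⟨N * C, 2 ^ (d + 1) + 2 ^ (d + 1) + (3 + 8 * c), fun μ hG f F h y s hy hs D => ?_⟩
  have hloc := hG.isLocallyFiniteMeasure
  have hμ : μ ≠ 0 := by
    rintro rfl
    simp at hy
  set R : Cube μ := .cube y s hy hs with hR
  -- the mean of `f` on a doubling cube is within `2 ^ (d + 1)` of the value of `F`
  set B : ℝ≥0∞ := D + 2 ^ (d + 1) with hB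
  let bad : (x : Fin d → ℝ) → (hx : x ∈ μ.support) → ℕ → Prop := fun x hx k =>
    (stopCube x hx s hs k).IsDoubling ∧ B < ‖F (stopCube x hx s hs k) - F R‖ₑ
  let E : Type := {x : Fin d → ℝ // x ∈ Metric.closedBall y (s / 2) ∧ ∃ hx, ∃ k, bad x hx k}
  have hsupp : ∀ x : E, x.1 ∈ μ.support := fun x => x.2.2.choose
  have hexk : ∀ x : E, ∃ k, bad x.1 (hsupp x) k := fun x => x.2.2.choose_spec
  classical
  let k : E → ℕ := fun x => Nat.find (hexk x)
  have hkspec : ∀ x : E, bad x.1 (hsupp x) (k x) := fun x => Nat.find_spec (hexk x)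
  let P : E → Cube μ := fun x => stopCube x.1 (hsupp x) s hs (k x)
  have hside : ∀ k : ℕ, s / 4 / 2 ^ k ≤ s / 4 := fun k =>
    div_le_self (by positivity) (one_le_pow₀ (by norm_num))
  let pkg : Besicovitch.BallPackage E (Fin d → ℝ) :=
    { c := fun x => x.1
      r := fun x => s / 4 / 2 ^ k x / 2
      rpos := fun x => by positivity
      r_bound := s
      r_le := fun x => by have := hside (k x); linarith }
  obtain ⟨S, hS1, hS2⟩ := Besicovitch.exist_disjoint_covering_families hτ hN pkg
  have hPset : ∀ x : E, (P x).toSet = Metric.closedBall (pkg.c x) (pkg.r x) := fun x => rfl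
  have hScount : ∀ i, (S i).Countable := fun i =>
    (hS1 i).countable_of_nonempty_interior fun x _ =>
      ⟨pkg.c x, Metric.ball_subset_interior_closedBall (Metric.mem_ball_self (pkg.rpos x))⟩
  have hcountU : (⋃ i, S i).Countable := countable_iUnion hScount
  have hfar : ∀ x : E, D * μ (P x).toSet ≤ ∫⁻ z in (P x).toSet, ‖f z - F R‖ₑ ∂μ := by
    intro x
    have h1 : (B : ℝ≥0∞) * μ (P x).toSet ≤
        ∫⁻ z in (P x).toSet, ‖f z - F R‖ₑ ∂μ + 2 ^ (d + 1) * μ (P x).toSet := by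
      calc (B : ℝ≥0∞) * μ (P x).toSet ≤ ‖F (P x) - F R‖ₑ * μ (P x).toSet := by
            gcongr; exact (hkspec x).2.le
        _ = ∫⁻ _z in (P x).toSet, ‖F (P x) - F R‖ₑ ∂μ := by rw [setLIntegral_const]
        _ ≤ ∫⁻ z in (P x).toSet, (‖f z - F R‖ₑ + ‖f z - F (P x)‖ₑ) ∂μ := by
            refine lintegral_mono fun z => ?_
            have := enorm_sub_le (a := f z - F R) (b := f z - F (P x))
            rwa [sub_sub_sub_cancel_left] at this
        _ = ∫⁻ z in (P x).toSet, ‖f z - F R‖ₑ ∂μ + ∫⁻ z in (P x).toSet, ‖f z - F (P x)‖ₑ ∂μ := by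
            refine lintegral_add_left' ?_ _
            exact (h.locInt.aestronglyMeasurable.sub
              aestronglyMeasurable_const).enorm.restrict
        _ ≤ _ := by
            gcongr
            refine (h.osc (P x)).trans ?_
            rw [ENNReal.coe_one, one_mul]
            exact (Cube.isDoubling_iff _).1 (hkspec x).1
    rw [hB, add_mul] at h1
    exact ENNReal.le_of_add_le_add_right
      (ENNReal.mul_ne_top (ENNReal.pow_ne_top (by norm_num)) (P x).measure_lt_top.ne) h1
  have hPsub : ∀ x : E, (P x).toSet ⊆ Metric.closedBall y (5 / 8 * s) := by
    intro x
    refine Metric.closedBall_subset_closedBall' ?_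
    have h1 := Metric.mem_closedBall.1 x.2.1
    have h2 := hside (k x)
    linarith
  -- each disjoint family has small total measure
  have hfam : ∀ i, D * ∑' x : S i, μ (P x).toSet ≤ C * μ (Metric.closedBall y s) := by
    intro i
    have := (hScount i).to_subtype
    calc D * ∑' x : S i, μ (P x).toSet = ∑' x : S i, D * μ (P x).toSet := by
          rw [ENNReal.tsum_mul_left]
      _ ≤ ∑' x : S i, ∫⁻ z in (P x).toSet, ‖f z - F R‖ₑ ∂μ := ENNReal.tsum_le_tsum fun x => hfar x
      _ = ∫⁻ z in ⋃ x : S i, (P x).toSet, ‖f z - F R‖ₑ ∂μ := by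
          rw [lintegral_iUnion (fun x : S i => (P x).measurableSet)]
          intro x x' hxx'
          exact hS1 i x.2 x'.2 fun heq => hxx' (Subtype.ext heq)
      _ ≤ ∫⁻ z in Metric.closedBall y (5 / 8 * s), ‖f z - F R‖ₑ ∂μ :=
          lintegral_mono_set (iUnion_subset fun x => hPsub x)
      _ ≤ _ := hC μ hG f F h y s hy hs
  have hcov : ∀ x : E, x.1 ∈ ⋃ z : ↥(⋃ i, S i), (P z).toSet := by
    intro x
    have h1 := hS2 (mem_range_self x)
    simp only [mem_iUnion] at h1
    obtain ⟨i, z, hz, hxz⟩ := h1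
    exact mem_iUnion.2 ⟨⟨z, mem_iUnion.2 ⟨i, hz⟩⟩, Metric.ball_subset_closedBall hxz⟩
  refine ⟨↥(⋃ i, S i), hcountU.to_subtype, fun x => P x, fun x => ⟨_, _, _, _, rfl⟩,
    fun x => (hkspec x).1, fun x => ?_, ?_, ?_⟩
  · have hxy : dist (x : E).1 y ≤ s := (Metric.mem_closedBall.1 (x : E).2.1).trans (by linarith)
    refine (enorm_stopCube_sub_le hnd hG h (hy := hy) hxy (B := B) fun j hj hjd => ?_).trans
      (le_of_eq_of_le (by rw [hB, add_assoc]) (b := D + (2 ^ (d + 1) + (3 + 8 * (c : ℝ≥0∞)))) ?_)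
    · have := Nat.find_min (hexk x) hj
      simp only [bad, not_and, not_lt] at this
      exact this hjd
    · push_cast
      gcongr
      exact le_add_self
  · calc D * ∑' x : ↥(⋃ i, S i), μ (P x).toSet
        ≤ D * ∑ i, ∑' x : S i, μ (P x).toSet := by
          gcongr
          exact ENNReal.tsum_iUnion_le (fun x => μ (P x).toSet) S
      _ = ∑ i, D * ∑' x : S i, μ (P x).toSet := by rw [Finset.mul_sum]
      _ ≤ ∑ _i : Fin N, C * μ (Metric.closedBall y s) := Finset.sum_le_sum fun i _ => hfam i
      _ = _ := by simp [mul_assoc]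
  -- outside the stopping cubes, `f x` is the limit of the means over the doubling cubes shrinking
  -- to `x`, none of which is bad
  · filter_upwards [ae_exists_doubling μ (β := 2 ^ (d + 1)) (by
        rw [pow_succ]; linarith [pow_pos (two_pos (α := ℝ)) d]),
      (Besicovitch.vitaliFamily μ).ae_tendsto_average h.locInt,
      Measure.support_mem_ae (μ := μ)] with x hx1 hx2 hx3 hxR hxP
    have hlim : Tendsto (fun k : ℕ => s / 4 / 2 ^ k / 2) atTop (𝓝[>] (0 : ℝ)) := by
      refine tendsto_nhdsWithin_iff.2 ⟨?_, Eventually.of_forall fun k => by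
        simp only [mem_Ioi]; positivity⟩
      have h1 : Tendsto (fun k : ℕ => (s / 8) * (1 / 2 : ℝ) ^ k) atTop (𝓝 ((s / 8) * 0)) :=
        (tendsto_pow_atTop_nhds_zero_of_lt_one (by norm_num) (by norm_num)).const_mul _
      rw [mul_zero] at h1
      refine h1.congr fun k => ?_
      rw [one_div, inv_pow]; field_simp; norm_num
    have h1 : Tendsto (fun k : ℕ => ⨍ z in (stopCube x hx3 s hs k).toSet, f z ∂μ) atTop
        (𝓝 (f x)) := hx2.comp ((Besicovitch.tendsto_filterAt μ x).comp hlim)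
    have h2 : Tendsto (fun k : ℕ => ‖(⨍ z in (stopCube x hx3 s hs k).toSet, f z ∂μ) - F R‖ₑ) atTop
        (𝓝 ‖f x - F R‖ₑ) := (h1.sub_const _).enorm
    refine le_of_tendsto_of_frequently h2 ?_
    rw [frequently_atTop]
    intro K
    obtain ⟨k, hk, hkd⟩ := hx1 (s / 4) (by positivity) K
    refine ⟨k, hk, ?_⟩
    have hdoub : (stopCube x hx3 s hs k).IsDoubling := by
      rw [Cube.IsDoubling, betaD_eq]
      simpa only [stopCube, Cube.dilate, Cube.toSet, pow_one] using hkd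
    have h3 : ‖F (stopCube x hx3 s hs k) - F R‖ₑ ≤ B := by
      by_contra! hcon
      exact hxP (hcov ⟨x, hxR, hx3, k, hdoub, hcon⟩)
    have h4 := h.enorm_average_sub_le hμ hdoub
    have h5 := enorm_add_le ((⨍ z in (stopCube x hx3 s hs k).toSet, f z ∂μ) -
      F (stopCube x hx3 s hs k)) (F (stopCube x hx3 s hs k) - F R)
    rw [sub_add_sub_cancel] at h5
    refine h5.trans ((add_le_add h4 h3).trans ?_)
    rw [hB]
    push_cast
    rw [mul_one, add_left_comm]
    exact add_le_add le_rfl le_self_add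

/-! ### The John–Nirenberg inequality -/

lemma lintegral_enorm_sub_rpow_le {f : (Fin d → ℝ) → ℝ} (s : Set (Fin d → ℝ)) {q : ℝ}
    (hq : 1 ≤ q) (a b : ℝ) :
    ∫⁻ x in s, ‖f x - b‖ₑ ^ q ∂μ ≤
      2 ^ (q - 1) * (∫⁻ x in s, ‖f x - a‖ₑ ^ q ∂μ + ‖a - b‖ₑ ^ q * μ s) := by
  have h2 : (2 : ℝ≥0∞) ^ (q - 1) ≠ ∞ := ENNReal.rpow_ne_top_of_nonneg (by linarith) (by norm_num)
  calc ∫⁻ x in s, ‖f x - b‖ₑ ^ q ∂μ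
      ≤ ∫⁻ x in s, 2 ^ (q - 1) * (‖f x - a‖ₑ ^ q + ‖a - b‖ₑ ^ q) ∂μ := by
        refine lintegral_mono fun x => ?_
        refine le_trans ?_ (ENNReal.rpow_add_le_mul_rpow_add_rpow _ _ hq)
        refine ENNReal.rpow_le_rpow ?_ (by linarith)
        have := enorm_add_le (f x - a) (a - b)
        rwa [sub_add_sub_cancel] at this
    _ = _ := by
        rw [lintegral_const_mul' _ _ h2, lintegral_add_right _ measurable_const, setLIntegral_const]

/-- The John–Nirenberg inequality in `L^q` form, for bounded functions. The best constant `X` is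
finite a priori, and the stopping cubes give `X ≤ C + X / 2`. -/
lemma exists_johnNirenberg_of_bounded (d n : ℕ) (hnd : n ≤ d) (c : ℝ≥0) {q : ℝ} (hq : 1 ≤ q) :
    ∃ C : ℝ≥0, ∀ μ : Measure (Fin d → ℝ), CubeGrowth n c μ → ∀ (f : (Fin d → ℝ) → ℝ)
      (F : Cube μ → ℝ), OscData n μ 1 f F → ∀ M : ℝ≥0, (∀ x, ‖f x‖ₑ ≤ M) → (∀ Q, ‖F Q‖ₑ ≤ M) →
      ∀ (y : Fin d → ℝ) (s : ℝ) (hy : y ∈ μ.support) (hs : 0 < s),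
        ∫⁻ x in Metric.closedBall y (s / 2), ‖f x - F (.cube y s hy hs)‖ₑ ^ q ∂μ ≤
          C * μ (Metric.closedBall y s) := by
  obtain ⟨C₁, C₂, hC⟩ := exists_stopping_cubes d n hnd c
  have hq0 : 0 ≤ q := by linarith
  set W : ℝ≥0 := 2 ^ (q - 1) with hW
  -- `D` is so large that the stopping cubes have total measure at most `m / (2 * W * 2 ^ (d + 1))`,
  -- where `m` is the measure of the double cube
  set D : ℝ≥0 := 2 * (W * 2 ^ (d + 1)) * C₁ + 1 with hD
  set E : ℝ≥0 := (D + C₂) ^ q with hE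
  have hWcoe : (2 : ℝ≥0∞) ^ (q - 1) = W := by
    rw [hW, ENNReal.coe_rpow_of_nonneg _ (by linarith)]; rfl
  have hEcoe : ((D : ℝ≥0∞) + C₂) ^ q = E := by
    rw [hE, ENNReal.coe_rpow_of_nonneg _ hq0]; push_cast; rfl
  refine ⟨2 * (2 * E), fun μ hG f F h M hfM hFM => ?_⟩
  have hloc := hG.isLocallyFiniteMeasure
  set I : (y : Fin d → ℝ) → (s : ℝ) → (hy : y ∈ μ.support) → (hs : 0 < s) → ℝ≥0∞ :=
    fun y s hy hs => ∫⁻ x in Metric.closedBall y (s / 2), ‖f x - F (.cube y s hy hs)‖ₑ ^ q ∂μ with hI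
  set X : ℝ≥0∞ := ⨆ (y) (s) (hy) (hs), I y s hy hs / μ (Metric.closedBall y s) with hX
  have hpos : ∀ {y : Fin d → ℝ} {s : ℝ}, y ∈ μ.support → 0 < s →
      μ (Metric.closedBall y s) ≠ 0 := fun hy hs =>
    (measure_closedBall_pos_of_mem_support hy hs).ne'
  have hfin : ∀ (y : Fin d → ℝ) (s : ℝ), μ (Metric.closedBall y s) ≠ ∞ := fun y s =>
    (isCompact_closedBall y s).measure_lt_top.ne
  have hIX : ∀ y s hy hs, I y s hy hs ≤ X * μ (Metric.closedBall y s) := by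
    intro y s hy hs
    rw [← ENNReal.div_le_iff (hpos hy hs) (hfin y s)]
    exact le_iSup₂_of_le y s (le_iSup₂_of_le hy hs le_rfl)
  -- the boundedness of `f` and `F` enters only here
  have hXtop : X ≠ ∞ := by
    refine ne_top_of_le_ne_top (b := ((M : ℝ≥0∞) + M) ^ q)
      (ENNReal.rpow_ne_top_of_nonneg hq0 (by simp)) ?_
    refine iSup₂_le fun y s => iSup₂_le fun hy hs => ?_
    refine ENNReal.div_le_of_le_mul ?_
    calc I y s hy hs ≤ ∫⁻ _x in Metric.closedBall y (s / 2), ((M : ℝ≥0∞) + M) ^ q ∂μ := by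
          refine lintegral_mono fun x => ENNReal.rpow_le_rpow ?_ hq0
          exact enorm_sub_le.trans (add_le_add (hfM x) (hFM _))
      _ = ((M : ℝ≥0∞) + M) ^ q * μ (Metric.closedBall y (s / 2)) := setLIntegral_const _ _
      _ ≤ _ := by
          gcongr
          linarith
  have hmain : ∀ y s hy hs, I y s hy hs ≤ (2 * E + X / 2) * μ (Metric.closedBall y s) := by
    intro y s hy hs
    obtain ⟨ι, hι, P, hPc, hPd, hPF, hPs, hPae⟩ := hC μ hG f F h y s hy hs D
    set R : Cube μ := .cube y s hy hs
    set m := μ (Metric.closedBall y s) with hm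
    set T := ∑' i, μ (P i).toSet with hT
    have hsum : 2 * (W * 2 ^ (d + 1)) * T ≤ m := by
      have hD0 : (D : ℝ≥0∞) ≠ 0 := by
        rw [Ne, ENNReal.coe_eq_zero, hD]; positivity
      refine (ENNReal.mul_le_mul_iff_right hD0 ENNReal.coe_ne_top).1 ?_
      calc (D : ℝ≥0∞) * (2 * (W * 2 ^ (d + 1)) * T) = 2 * (W * 2 ^ (d + 1)) * (D * T) := by ring
        _ ≤ 2 * (W * 2 ^ (d + 1)) * (C₁ * m) := by gcongr
        _ = (2 * (W * 2 ^ (d + 1)) * C₁) * m := by ring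
        _ ≤ D * m := by
            gcongr
            rw [hD]
            push_cast
            exact le_self_add
    have hpiece : ∀ i, ∫⁻ x in (P i).toSet, ‖f x - F R‖ₑ ^ q ∂μ ≤
        W * (X * 2 ^ (d + 1) + E) * μ (P i).toSet := by
      intro i
      refine (lintegral_enorm_sub_rpow_le _ hq (F (P i)) (F R)).trans ?_
      rw [hWcoe, mul_assoc, add_mul]
      gcongr
      · obtain ⟨x, l, hx, hl, hP⟩ := hPc i
        have h1 := hIX x l hx hl
        have h2 : ∫⁻ z in (P i).toSet, ‖f z - F (P i)‖ₑ ^ q ∂μ = I x l hx hl := by rw [hP]; rfl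
        have h3 : μ (Metric.closedBall x l) = μ ((P i).dilate 1).toSet := by
          rw [hP]; simp [Cube.dilate, Cube.toSet]
        rw [h2, mul_assoc]
        refine h1.trans ?_
        rw [h3]
        gcongr
        exact (Cube.isDoubling_iff _).1 (hPd i)
      · rw [← hEcoe]
        exact ENNReal.rpow_le_rpow (hPF i) hq0
    calc I y s hy hs
        ≤ ∫⁻ x in (Metric.closedBall y (s / 2) \ ⋃ i, (P i).toSet) ∪ ⋃ i, (P i).toSet,
            ‖f x - F R‖ₑ ^ q ∂μ := lintegral_mono_set (by rw [sdiff_union_self]; simp)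
      _ ≤ ∫⁻ x in Metric.closedBall y (s / 2) \ ⋃ i, (P i).toSet, ‖f x - F R‖ₑ ^ q ∂μ +
          ∫⁻ x in ⋃ i, (P i).toSet, ‖f x - F R‖ₑ ^ q ∂μ := lintegral_union_le _ _ _
      _ ≤ E * m + W * (X * 2 ^ (d + 1) + E) * T := by
          gcongr
          · calc _ ≤ ∫⁻ _x in Metric.closedBall y (s / 2) \ ⋃ i, (P i).toSet, (E : ℝ≥0∞) ∂μ := by
                  refine setLIntegral_mono_ae measurable_const.aemeasurable ?_
                  filter_upwards [hPae] with x hx hxm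
                  rw [← hEcoe]
                  exact ENNReal.rpow_le_rpow (hx hxm.1 hxm.2) hq0
              _ = E * μ (Metric.closedBall y (s / 2) \ ⋃ i, (P i).toSet) := setLIntegral_const _ _
              _ ≤ E * m := by
                  exact mul_le_mul_right (measure_mono (sdiff_subset.trans
                    (Metric.closedBall_subset_closedBall (by linarith)))) _
          · refine (lintegral_iUnion_le _ _).trans ((ENNReal.tsum_le_tsum hpiece).trans ?_)
            rw [ENNReal.tsum_mul_left]
      _ = E * m + X * (W * 2 ^ (d + 1) * T) + E * (W * T) := by ring
      -- the total measure of the stopping cubes absorbs the constants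
      _ ≤ E * m + X * (m / 2) + E * m := by
          gcongr
          · rw [ENNReal.le_div_iff_mul_le (Or.inl (by norm_num)) (Or.inl (by norm_num))]
            refine le_trans (le_of_eq ?_) hsum
            ring
          · refine le_trans ?_ hsum
            gcongr
            calc (W : ℝ≥0∞) = 1 * (W * 1) := by ring
              _ ≤ _ := by
                gcongr
                · norm_num
                · exact one_le_pow₀ (by norm_num)
      _ = _ := by rw [add_mul, ENNReal.div_eq_inv_mul, ENNReal.div_eq_inv_mul]; ring
  have hXle : X ≤ 2 * E + X / 2 := by
    refine iSup₂_le fun y s => iSup₂_le fun hy hs => ?_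
    exact ENNReal.div_le_of_le_mul (hmain y s hy hs)
  have hX2 : X / 2 ≤ 2 * E := by
    have h2 : X / 2 ≠ ∞ := ENNReal.div_ne_top hXtop (by norm_num)
    refine ENNReal.le_of_add_le_add_right h2 ?_
    rwa [ENNReal.add_halves]
  intro y s hy hs
  refine (hIX y s hy hs).trans ?_
  gcongr
  rw [← ENNReal.add_halves X]
  push_cast
  rw [two_mul (2 * (E : ℝ≥0∞))]
  exact add_le_add hX2 hX2

/-- Removal of the boundedness assumption by truncation and Fatou's lemma. -/
lemma exists_johnNirenberg_cube (d n : ℕ) (hnd : n ≤ d) (c : ℝ≥0) {q : ℝ} (hq : 1 ≤ q) :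
    ∃ C : ℝ≥0, ∀ μ : Measure (Fin d → ℝ), CubeGrowth n c μ → ∀ (f : (Fin d → ℝ) → ℝ)
      (F : Cube μ → ℝ), OscData n μ 1 f F →
      ∀ (y : Fin d → ℝ) (s : ℝ) (hy : y ∈ μ.support) (hs : 0 < s),
        ∫⁻ x in Metric.closedBall y (s / 2), ‖f x - F (.cube y s hy hs)‖ₑ ^ q ∂μ ≤
          C * μ (Metric.closedBall y s) := by
  obtain ⟨C, hC⟩ := exists_johnNirenberg_of_bounded d n hnd c hq
  refine ⟨C, fun μ hG f F h y s hy hs => ?_⟩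
  set R : Cube μ := .cube y s hy hs
  have henorm : ∀ (m : ℕ) (t : ℝ), ‖clip m t‖ₑ ≤ (m : ℝ≥0) := by
    intro m t
    rw [← ofReal_norm, Real.norm_eq_abs]
    refine (ENNReal.ofReal_le_ofReal (abs_clip_le m.cast_nonneg t)).trans (le_of_eq ?_)
    simp
  have hm : ∀ m : ℕ, ∫⁻ x in Metric.closedBall y (s / 2), ‖clip m (f x) - clip m (F R)‖ₑ ^ q ∂μ ≤
      C * μ (Metric.closedBall y s) := fun m =>
    hC μ hG _ _ (h.clip m.cast_nonneg) m (fun x => henorm m _) (fun Q => henorm m _) y s hy hs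
  have hlim : ∀ x, Tendsto (fun m : ℕ => ‖clip m (f x) - clip m (F R)‖ₑ ^ q) atTop
      (𝓝 (‖f x - F R‖ₑ ^ q)) := fun x =>
    (ENNReal.continuous_rpow_const.tendsto _).comp
      (((tendsto_clip (f x)).sub (tendsto_clip (F R))).enorm)
  calc _ = ∫⁻ x in Metric.closedBall y (s / 2),
        liminf (fun m : ℕ => ‖clip m (f x) - clip m (F R)‖ₑ ^ q) atTop ∂μ :=
        lintegral_congr fun x => (hlim x).liminf_eq.symm
    _ ≤ liminf (fun m : ℕ => ∫⁻ x in Metric.closedBall y (s / 2),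
        ‖clip m (f x) - clip m (F R)‖ₑ ^ q ∂μ) atTop := by
        refine lintegral_liminf_le' fun m => ?_
        have := ((continuous_clip m).comp_aestronglyMeasurable
          h.locInt.aestronglyMeasurable).sub (aestronglyMeasurable_const (b := clip m (F R)))
        exact (this.enorm.pow_const q).restrict
    _ ≤ _ := by
        refine liminf_le_of_frequently_le' (Frequently.of_forall hm)

/-- For a finite measure, `K_{Q,ℝᵈ} ≤ 2` for all large cubes `Q`. -/
lemma coeffK_whole_le (hn : 1 ≤ n) (h : μ univ < ∞) {x : Fin d → ℝ} {l : ℝ} (hx : x ∈ μ.support)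
    (hl : 1 ≤ l) (hl' : μ univ ≤ ENNReal.ofReal l) :
    coeffK n (.cube x l hx (one_pos.trans_le hl)) (.whole h) ≤ 2 := by
  have hl0 : 0 < l := one_pos.trans_le hl
  change 1 + ∑' k : ℕ, density n μ x l (k + 1) ≤ 2
  rw [← one_add_one_eq_two]
  gcongr
  have hsum : ∑' k : ℕ, (2⁻¹ : ℝ≥0∞) ^ (k + 1) = 1 := by
    rw [ENNReal.tsum_geometric_add_one, ENNReal.one_sub_inv_two, inv_inv,
      ENNReal.inv_mul_cancel (by norm_num) (by norm_num)]
  rw [← hsum]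
  refine ENNReal.tsum_le_tsum fun k => ?_
  have h1 : ENNReal.ofReal (2 ^ (k + 1) * l) ≤ ENNReal.ofReal ((2 ^ (k + 1) * l) ^ n) := by
    refine ENNReal.ofReal_le_ofReal (le_self_pow₀ ?_ (by omega))
    exact one_le_mul_of_one_le_of_one_le (one_le_pow₀ (by norm_num)) hl
  calc density n μ x l (k + 1) ≤ ENNReal.ofReal l / ENNReal.ofReal (2 ^ (k + 1) * l) := by
        refine ENNReal.div_le_div ((measure_mono (subset_univ _)).trans hl') h1
    _ = ENNReal.ofReal (l / (2 ^ (k + 1) * l)) := (ENNReal.ofReal_div_of_pos (by positivity)).symm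
    _ = ENNReal.ofReal ((2 ^ (k + 1))⁻¹) := by congr 1; field_simp
    _ = _ := by
        rw [ENNReal.ofReal_inv_of_pos (by positivity), ENNReal.ofReal_pow (by norm_num)]
        simp [ENNReal.inv_pow]

/-- The John–Nirenberg inequality in `L^q` form, for all cubes; the whole space is exhausted by
large cubes. -/
lemma exists_johnNirenberg_aux (d n : ℕ) (hn : 1 ≤ n) (hnd : n ≤ d) (c : ℝ≥0) {q : ℝ}
    (hq : 1 ≤ q) :
    ∃ C : ℝ≥0, ∀ μ : Measure (Fin d → ℝ), CubeGrowth n c μ → ∀ (f : (Fin d → ℝ) → ℝ)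
      (F : Cube μ → ℝ), OscData n μ 1 f F → ∀ Q : Cube μ,
        ∫⁻ x in Q.toSet, ‖f x - F Q‖ₑ ^ q ∂μ ≤ C * μ (Q.dilate 1).toSet := by
  obtain ⟨C, hC⟩ := exists_johnNirenberg_cube d n hnd c hq
  have hq0 : 0 ≤ q := by linarith
  set W : ℝ≥0 := 2 ^ (q - 1) with hW
  have hWcoe : (2 : ℝ≥0∞) ^ (q - 1) = W := by
    rw [hW, ENNReal.coe_rpow_of_nonneg _ (by linarith)]; rfl
  have h2q : (2 : ℝ≥0∞) ^ q = (2 ^ q : ℝ≥0) := by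
    rw [ENNReal.coe_rpow_of_nonneg _ hq0]; rfl
  refine ⟨C + W * (C + 2 ^ q), fun μ hG f F h Q => ?_⟩
  cases Q with
  | cube y s hy hs =>
    refine (hC μ hG f F h y s hy hs).trans ?_
    have : ((Cube.cube y s hy hs : Cube μ).dilate 1).toSet = Metric.closedBall y s := by
      simp [Cube.dilate, Cube.toSet]
    rw [this]
    gcongr
    exact le_self_add
  | whole hμ =>
    change ∫⁻ x in univ, ‖f x - F (.whole hμ)‖ₑ ^ q ∂μ ≤ _ * μ univ
    rcases μ.support.eq_empty_or_nonempty with h0 | ⟨x, hx⟩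
    · have h1 : μ = 0 := by
        have h2 := Measure.support_mem_ae (μ := μ)
        rw [mem_ae_iff, h0, compl_empty] at h2
        exact Measure.measure_univ_eq_zero.1 h2
      simp [h1]
    · obtain ⟨N, hN⟩ := exists_nat_ge (max 1 (μ univ).toReal)
      have hN1 : (1 : ℝ) ≤ N := (le_max_left _ _).trans hN
      have hpos : ∀ m : ℕ, (1 : ℝ) ≤ N + m := fun m => by
        have : (0 : ℝ) ≤ m := m.cast_nonneg
        linarith
      have hcov : (univ : Set (Fin d → ℝ)) =
          ⋃ m : ℕ, Metric.closedBall x ((N + m : ℝ) / 2) := by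
        refine (eq_univ_of_forall fun z => ?_).symm
        obtain ⟨m, hm⟩ := exists_nat_ge (2 * dist z x)
        refine mem_iUnion.2 ⟨m, Metric.mem_closedBall.2 ?_⟩
        linarith
      rw [hcov, setLIntegral_iUnion_of_directed, ← hcov]
      · refine iSup_le fun m => ?_
        set Q : Cube μ := .cube x (N + m) hx (one_pos.trans_le (hpos m))
        have hμN : μ univ ≤ ENNReal.ofReal (N + m) := by
          rw [← ENNReal.ofReal_toReal hμ.ne]
          refine ENNReal.ofReal_le_ofReal (((le_max_right _ _).trans hN).trans ?_)
          simp
        have hK : coeffK n Q (.whole hμ) ≤ 2 := coeffK_whole_le hn hμ hx (hpos m) hμN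
        have hF : ‖F Q - F (.whole hμ)‖ₑ ≤ 2 := by
          refine (h.reg Q (.whole hμ) (subset_univ _)).trans ?_
          rw [ENNReal.coe_one, one_mul]
          exact hK
        refine (lintegral_enorm_sub_rpow_le _ hq (F Q) _).trans ?_
        rw [hWcoe]
        calc (W : ℝ≥0∞) * (∫⁻ z in Metric.closedBall x ((N + m : ℝ) / 2), ‖f z - F Q‖ₑ ^ q ∂μ +
              ‖F Q - F (.whole hμ)‖ₑ ^ q * μ (Metric.closedBall x ((N + m : ℝ) / 2)))
            ≤ W * (C * μ univ + 2 ^ q * μ univ) := by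
              gcongr
              · refine (hC μ hG f F h x (N + m) hx (one_pos.trans_le (hpos m))).trans ?_
                gcongr
                exact subset_univ _
              · exact subset_univ _
          _ = (W * (C + 2 ^ q)) * μ univ := by ring
          _ ≤ _ := by
              rw [h2q]
              push_cast
              gcongr
              exact le_add_self
      · refine Monotone.directed_le fun i j hij => Metric.closedBall_subset_closedBall ?_
        have : (i : ℝ) ≤ j := by exact_mod_cast hij
        linarith

/-- The John–Nirenberg inequality in `L^q` form, `1 ≤ q < ∞`. -/
lemma exists_johnNirenberg (d n : ℕ) (hn : 1 ≤ n) (hnd : n ≤ d) (c : ℝ≥0) {q : ℝ≥0∞}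
    (hq : 1 ≤ q) (hq' : q ≠ ∞) :
    ∃ C : ℝ≥0, ∀ μ : Measure (Fin d → ℝ), CubeGrowth n c μ → ∀ (A : ℝ≥0) (f : (Fin d → ℝ) → ℝ)
      (F : Cube μ → ℝ), OscData n μ A f F → ∀ Q : Cube μ,
        eLpNorm (fun x => f x - F Q) q (μ.restrict Q.toSet) ≤
          C * A * μ (Q.dilate 1).toSet ^ (q⁻¹).toReal := by
  have hqr : 1 ≤ q.toReal := by
    rw [← ENNReal.toReal_one]; exact ENNReal.toReal_mono hq' hq
  obtain ⟨C, hC⟩ := exists_johnNirenberg_aux d n hn hnd c hqr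
  have hinv : 0 ≤ 1 / q.toReal := by positivity
  refine ⟨C ^ (1 / q.toReal), fun μ hG A f F h Q => ?_⟩
  rcases eq_or_ne A 0 with rfl | hA
  · have h1 := h.osc Q
    have hmeas : AEMeasurable (fun x => ‖f x - F Q‖ₑ) (μ.restrict Q.toSet) :=
      (h.locInt.aestronglyMeasurable.sub aestronglyMeasurable_const).enorm.restrict
    rw [ENNReal.coe_zero, zero_mul, nonpos_iff_eq_zero, lintegral_eq_zero_iff' hmeas] at h1
    rw [eLpNorm_congr_ae (g := 0), eLpNorm_zero]
    · exact zero_le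
    · filter_upwards [h1] with x hx
      simpa using hx
  · have h1 := h.smul A⁻¹
    rw [inv_mul_cancel₀ hA] at h1
    have h2 := hC μ hG _ _ h1 Q
    have h3 : eLpNorm (fun x => (A⁻¹ : ℝ≥0) * f x - (A⁻¹ : ℝ≥0) * F Q) q (μ.restrict Q.toSet) ≤
        (C ^ (1 / q.toReal) : ℝ≥0) * μ (Q.dilate 1).toSet ^ (q⁻¹).toReal := by
      rw [eLpNorm_eq_lintegral_rpow_enorm_toReal (by positivity) hq',
        ENNReal.toReal_inv, ← one_div q.toReal, ENNReal.coe_rpow_of_nonneg _ hinv,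
        ← ENNReal.mul_rpow_of_nonneg _ _ hinv]
      exact ENNReal.rpow_le_rpow h2 hinv
    have h4 : (fun x => f x - F Q) =
        (A : ℝ) • fun x => ((A⁻¹ : ℝ≥0) : ℝ) * f x - (A⁻¹ : ℝ≥0) * F Q := by
      funext x
      rw [Pi.smul_apply, smul_eq_mul, ← mul_sub, NNReal.coe_inv, ← mul_assoc,
        mul_inv_cancel₀ (by exact_mod_cast hA), one_mul]
    rw [h4, eLpNorm_const_smul]
    refine (mul_le_mul_right h3 _).trans (le_of_eq ?_)
    simp only [Real.enorm_eq_ofReal A.coe_nonneg, ENNReal.ofReal_coe_nnreal]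
    ring

/-! ### Atomic blocks and their pairing with `RBMO` -/

variable {p q r : ℝ≥0∞}

/-- The normalization `μ(2Q)^(1/p - 1) K_{Q,R}⁻¹` of the `p`-atoms of a block with supporting cube
`R`. -/
def atomBound (n : ℕ) (p : ℝ≥0∞) (Q R : Cube μ) : ℝ≥0∞ :=
  μ (Q.dilate 1).toSet ^ ((p⁻¹).toReal - 1) * (coeffK n Q R)⁻¹

lemma lintegral_enorm_mul_le [ENNReal.HolderConjugate p q] {a u : (Fin d → ℝ) → ℝ}
    {s : Set (Fin d → ℝ)} (ha : AEStronglyMeasurable a μ)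
    (hu : AEStronglyMeasurable u (μ.restrict s)) (hs : Function.support a ⊆ s) :
    ∫⁻ x, ‖a x‖ₑ * ‖u x‖ₑ ∂μ ≤ eLpNorm a p μ * eLpNorm u q (μ.restrict s) := by
  have h1 : ∫⁻ x, ‖a x‖ₑ * ‖u x‖ₑ ∂μ = eLpNorm (a • u) 1 μ := by
    rw [eLpNorm_one_eq_lintegral_enorm]
    simp [enorm_mul]
  have h2 : Function.support (a • u) ⊆ s := fun x hx => hs fun h0 => hx (by simp [h0])
  rw [h1, ← eLpNorm_restrict_eq_of_support_subset h2,
    ← eLpNorm_restrict_eq_of_support_subset hs]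
  exact eLpNorm_smul_le_mul_eLpNorm hu ha.restrict

lemma toReal_inv_sub_one [ENNReal.HolderConjugate p q] :
    (p⁻¹).toReal - 1 = -(q⁻¹).toReal := by
  have h := ENNReal.HolderConjugate.inv_add_inv_eq_one p q
  have hp : p⁻¹ ≠ ∞ := ne_top_of_le_ne_top ENNReal.one_ne_top (h ▸ le_self_add)
  have hq : q⁻¹ ≠ ∞ := ne_top_of_le_ne_top ENNReal.one_ne_top (h ▸ le_add_self)
  have h2 := congrArg ENNReal.toReal h
  rw [ENNReal.toReal_add hp hq, ENNReal.toReal_one] at h2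
  linarith

lemma atomBound_mul_le [ENNReal.HolderConjugate p q] (Q R : Cube μ) :
    atomBound n p Q R * μ (Q.dilate 1).toSet ^ (q⁻¹).toReal ≤ (coeffK n Q R)⁻¹ := by
  rw [atomBound, toReal_inv_sub_one (q := q), ENNReal.rpow_neg, mul_right_comm]
  exact mul_le_of_le_one_left zero_le (ENNReal.inv_mul_le_one _)

lemma one_lt_conj [ENNReal.HolderConjugate p q] (hp : 1 < p) : 1 ≤ q ∧ q ≠ ∞ := by
  have h := ENNReal.HolderConjugate.inv_add_inv_eq_one p q
  refine ⟨ENNReal.HolderConjugate.one_le q p, ?_⟩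
  rintro rfl
  simp only [ENNReal.inv_top, add_zero] at h
  rw [ENNReal.inv_eq_one] at h
  exact hp.ne' h

lemma lintegral_enorm_le_of_atom (hp : 1 < p) {a : (Fin d → ℝ) → ℝ} {Q R : Cube μ} {t : ℝ≥0∞}
    (ha : AEStronglyMeasurable a μ) (hs : Function.support a ⊆ Q.toSet)
    (hb : eLpNorm a p μ ≤ t * atomBound n p Q R) :
    ∫⁻ x, ‖a x‖ₑ ∂μ ≤ t * (coeffK n Q R)⁻¹ := by
  have := ENNReal.HolderConjugate.conjExponent hp.le
  set q := p.conjExponent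
  obtain ⟨hq1, hq2⟩ := one_lt_conj (p := p) (q := q) hp
  have h1 := lintegral_enorm_mul_le (p := p) (q := q) (u := fun _ => 1) ha
    aestronglyMeasurable_const hs
  simp only [enorm_one, mul_one] at h1
  rw [eLpNorm_const' _ (one_pos.trans_le hq1).ne' hq2, enorm_one, one_mul,
    Measure.restrict_apply_univ] at h1
  calc ∫⁻ x, ‖a x‖ₑ ∂μ ≤ t * atomBound n p Q R * μ Q.toSet ^ (1 / q.toReal) :=
        h1.trans (mul_le_mul_left hb _)
    _ ≤ t * (atomBound n p Q R * μ (Q.dilate 1).toSet ^ (q⁻¹).toReal) := by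
        rw [mul_assoc, one_div, ENNReal.toReal_inv]
        gcongr
        exact Q.toSet_subset_dilate 1
    _ ≤ _ := by gcongr; exact atomBound_mul_le Q R

lemma inv_coeffK_le_one (Q R : Cube μ) : (coeffK n Q R)⁻¹ ≤ 1 :=
  ENNReal.inv_le_one.2 (one_le_coeffK Q R)

/-- The pairing of an atom with a function whose oscillation is controlled in `L^q`. -/
lemma lintegral_atom_mul_le [ENNReal.HolderConjugate p q] (hp : 1 < p) {a g : (Fin d → ℝ) → ℝ}
    {G : Cube μ → ℝ} {A C : ℝ≥0} {Q R : Cube μ} (h : OscData n μ A g G)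
    (hJN : eLpNorm (fun x => g x - G Q) q (μ.restrict Q.toSet) ≤
      C * A * μ (Q.dilate 1).toSet ^ (q⁻¹).toReal)
    (ha : AEStronglyMeasurable a μ) (hs : Function.support a ⊆ Q.toSet)
    (hb : eLpNorm a p μ ≤ atomBound n p Q R) (hQR : Q.toSet ⊆ R.toSet) :
    ∫⁻ x, ‖a x‖ₑ * ‖g x - G R‖ₑ ∂μ ≤ (C + 1) * A := by
  have hg : AEStronglyMeasurable g μ := h.locInt.aestronglyMeasurable
  have h1 : ∫⁻ x, ‖a x‖ₑ * ‖g x - G Q‖ₑ ∂μ ≤ C * A := by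
    calc _ ≤ eLpNorm a p μ * eLpNorm (fun x => g x - G Q) q (μ.restrict Q.toSet) :=
          lintegral_enorm_mul_le ha (hg.sub aestronglyMeasurable_const).restrict hs
      _ ≤ atomBound n p Q R * (C * A * μ (Q.dilate 1).toSet ^ (q⁻¹).toReal) :=
          mul_le_mul' hb hJN
      _ = C * A * (atomBound n p Q R * μ (Q.dilate 1).toSet ^ (q⁻¹).toReal) := by ring
      _ ≤ C * A * 1 := by
          gcongr
          exact (atomBound_mul_le Q R).trans (inv_coeffK_le_one Q R)
      _ = _ := mul_one _
  have h2 : ∫⁻ x, ‖a x‖ₑ * ‖G Q - G R‖ₑ ∂μ ≤ A := by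
    rw [lintegral_mul_const' _ _ enorm_ne_top]
    have h3 := lintegral_enorm_le_of_atom (n := n) (t := 1) hp ha hs (by rwa [one_mul])
    rw [one_mul] at h3
    calc _ ≤ (coeffK n Q R)⁻¹ * (A * coeffK n Q R) := mul_le_mul' h3 (h.reg Q R hQR)
      _ = A * ((coeffK n Q R)⁻¹ * coeffK n Q R) := by ring
      _ ≤ A * 1 := by gcongr; exact ENNReal.inv_mul_le_one _
      _ = A := mul_one _
  calc ∫⁻ x, ‖a x‖ₑ * ‖g x - G R‖ₑ ∂μ
      ≤ ∫⁻ x, (‖a x‖ₑ * ‖g x - G Q‖ₑ + ‖a x‖ₑ * ‖G Q - G R‖ₑ) ∂μ := by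
        refine lintegral_mono fun x => ?_
        rw [← mul_add]
        gcongr
        have := enorm_add_le (g x - G Q) (G Q - G R)
        rwa [sub_add_sub_cancel] at this
    _ = ∫⁻ x, ‖a x‖ₑ * ‖g x - G Q‖ₑ ∂μ + ∫⁻ x, ‖a x‖ₑ * ‖G Q - G R‖ₑ ∂μ :=
        lintegral_add_left' (ha.enorm.mul (hg.sub aestronglyMeasurable_const).enorm) _
    _ ≤ C * A + A := add_le_add h1 h2
    _ = _ := by ring

/-- A weighted `L¹` norm of a pointwise sum is at most the sum of the weighted norms. -/
lemma lintegral_enorm_mul_le_tsum {ι : Type*} [Countable ι] {h : ι → (Fin d → ℝ) → ℝ}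
    {f : (Fin d → ℝ) → ℝ} {w : (Fin d → ℝ) → ℝ≥0∞} (hm : ∀ i, AEStronglyMeasurable (h i) μ)
    (hw : AEMeasurable w μ) (hf : ∀ᵐ x ∂μ, HasSum (fun i => h i x) (f x)) :
    ∫⁻ x, ‖f x‖ₑ * w x ∂μ ≤ ∑' i, ∫⁻ x, ‖h i x‖ₑ * w x ∂μ := by
  have hmw : ∀ i, AEMeasurable (fun x => ‖h i x‖ₑ * w x) μ := fun i => (hm i).enorm.mul hw
  rw [← lintegral_tsum hmw]
  refine lintegral_mono_ae ?_
  filter_upwards [hf] with x hx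
  rw [ENNReal.tsum_mul_right, ← hx.tsum_eq]
  gcongr
  exact enorm_tsum_le_tsum_enorm

lemma lintegral_enorm_le_tsum {ι : Type*} [Countable ι] {h : ι → (Fin d → ℝ) → ℝ}
    {f : (Fin d → ℝ) → ℝ} (hm : ∀ i, AEStronglyMeasurable (h i) μ)
    (hf : ∀ᵐ x ∂μ, HasSum (fun i => h i x) (f x)) :
    ∫⁻ x, ‖f x‖ₑ ∂μ ≤ ∑' i, ∫⁻ x, ‖h i x‖ₑ ∂μ := by
  simpa using lintegral_enorm_mul_le_tsum (w := fun _ => 1) hm aemeasurable_const hf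

lemma AtomicBlock.lintegral_enorm_mul_le (B : AtomicBlock n p μ) {w : (Fin d → ℝ) → ℝ≥0∞}
    (hw : AEMeasurable w μ) {M : ℝ≥0∞} (hM : ∀ j, ∫⁻ x, ‖B.a j x‖ₑ * w x ∂μ ≤ M) :
    ∫⁻ x, ‖B.b x‖ₑ * w x ∂μ ≤ B.size * M := by
  refine (lintegral_enorm_mul_le_tsum (h := fun j x => B.coef j * B.a j x)
    (fun j => (B.measurable_a j).const_mul _) hw B.hasSum).trans ?_
  rw [AtomicBlock.size, ← ENNReal.tsum_mul_right]
  refine ENNReal.tsum_le_tsum fun j => ?_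
  simp_rw [enorm_mul, mul_assoc]
  rw [lintegral_const_mul' _ _ enorm_ne_top]
  gcongr
  exact hM j

lemma AtomicBlock.lintegral_enorm_le (hp : 1 < p) (B : AtomicBlock n p μ) :
    ∫⁻ x, ‖B.b x‖ₑ ∂μ ≤ B.size := by
  have := B.lintegral_enorm_mul_le (w := fun _ => 1) (M := 1) aemeasurable_const fun j => by
    have h := lintegral_enorm_le_of_atom (n := n) (t := 1) (R := B.R) hp (B.measurable_a j)
      (B.support_a j) (by rw [one_mul]; exact B.norm_a j)
    simp only [mul_one]
    exact h.trans ((one_mul _).trans_le (inv_coeffK_le_one _ _))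
  simpa using this

/-- The pairing of an atomic block of finite size with a function of controlled oscillation. -/
lemma AtomicBlock.enorm_integral_mul_le [ENNReal.HolderConjugate p q] (hp : 1 < p)
    {g : (Fin d → ℝ) → ℝ} {G : Cube μ → ℝ} {A C : ℝ≥0} (h : OscData n μ A g G)
    (hJN : ∀ Q : Cube μ, eLpNorm (fun x => g x - G Q) q (μ.restrict Q.toSet) ≤
      C * A * μ (Q.dilate 1).toSet ^ (q⁻¹).toReal) (B : AtomicBlock n p μ) (hB : B.size ≠ ∞) :
    Integrable (fun x => B.b x * g x) μ ∧
      ‖∫ x, B.b x * g x ∂μ‖ₑ ≤ (C + 1) * A * B.size := by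
  have hg : AEStronglyMeasurable g μ := h.locInt.aestronglyMeasurable
  have h1 : ∫⁻ x, ‖B.b x * (g x - G B.R)‖ₑ ∂μ ≤ (C + 1) * A * B.size := by
    simp_rw [enorm_mul]
    refine (B.lintegral_enorm_mul_le (hg.sub aestronglyMeasurable_const).enorm
      fun j => lintegral_atom_mul_le hp h (hJN _) (B.measurable_a j) (B.support_a j)
        (B.norm_a j) (B.subset j)).trans (le_of_eq ?_)
    ring
  have hint1 : Integrable (fun x => B.b x * (g x - G B.R)) μ := by
    refine ⟨B.integrable.aestronglyMeasurable.mul (hg.sub aestronglyMeasurable_const), ?_⟩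
    refine h1.trans_lt (ENNReal.mul_lt_top ?_ hB.lt_top)
    exact ENNReal.mul_lt_top (by simp) ENNReal.coe_lt_top
  have hint2 : Integrable (fun x => B.b x * G B.R) μ := B.integrable.mul_const _
  have heq : (fun x => B.b x * g x) = fun x => B.b x * (g x - G B.R) + B.b x * G B.R := by
    funext x; ring
  refine ⟨heq ▸ hint1.add hint2, ?_⟩
  rw [heq, integral_add hint1 hint2, integral_mul_const, B.integral_eq, zero_mul, add_zero]
  exact (enorm_integral_le_lintegral_enorm _).trans h1

/-- A `p`-atomic block is an `r`-atomic block for `r ≤ p`, by Hölder's inequality. -/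
def AtomicBlock.lower [IsLocallyFiniteMeasure μ] (hr : r ≤ p) (hr1 : 1 ≤ r)
    (B : AtomicBlock n p μ) : AtomicBlock n r μ where
  b := B.b
  R := B.R
  Q := B.Q
  a := B.a
  coef := B.coef
  integrable := B.integrable
  support_b := B.support_b
  integral_eq := B.integral_eq
  subset := B.subset
  measurable_a := B.measurable_a
  support_a := B.support_a
  norm_a j := by
    rcases eq_or_ne μ 0 with hμ | hμ
    · simp [hμ]
    set m := μ ((B.Q j).dilate 1).toSet
    have hm0 : m ≠ 0 := (Cube.measure_pos hμ _).ne'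
    have hm1 : m ≠ ∞ := (Cube.measure_lt_top _).ne
    have h1 := eLpNorm_le_eLpNorm_mul_rpow_measure_univ hr
      (B.measurable_a j).restrict (μ := μ.restrict (B.Q j).toSet)
    rw [eLpNorm_restrict_eq_of_support_subset (B.support_a j),
      eLpNorm_restrict_eq_of_support_subset (B.support_a j), Measure.restrict_apply_univ] at h1
    have hexp : 0 ≤ 1 / r.toReal - 1 / p.toReal := by
      rw [one_div, one_div, ← ENNReal.toReal_inv, ← ENNReal.toReal_inv, sub_nonneg]
      refine ENNReal.toReal_mono ?_ (ENNReal.inv_le_inv.2 hr)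
      exact ENNReal.inv_ne_top.2 (one_pos.trans_le hr1).ne'
    calc eLpNorm (B.a j) r μ
        ≤ (m ^ ((p⁻¹).toReal - 1) * (coeffK n (B.Q j) B.R)⁻¹) * m ^ (1 / r.toReal - 1 / p.toReal) := by
          refine h1.trans (mul_le_mul' (B.norm_a j) ?_)
          exact ENNReal.rpow_le_rpow (measure_mono ((B.Q j).toSet_subset_dilate 1)) hexp
      _ = m ^ ((p⁻¹).toReal - 1 + (1 / r.toReal - 1 / p.toReal)) *
          (coeffK n (B.Q j) B.R)⁻¹ := by
          rw [ENNReal.rpow_add _ _ hm0 hm1]; ring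
      _ = _ := by
          congr 2
          rw [ENNReal.toReal_inv, ENNReal.toReal_inv, one_div, one_div]
          ring
  hasSum := B.hasSum

lemma atbENorm_mono [IsLocallyFiniteMeasure μ] (hr : r ≤ p) (hr1 : 1 ≤ r)
    (f : (Fin d → ℝ) → ℝ) : atbENorm n r μ f ≤ atbENorm n p μ f := by
  refine le_iInf₂ fun B hB => ?_
  exact iInf₂_le_of_le (fun i => (B i).lower hr hr1) hB le_rfl

lemma exists_decomposition {f : (Fin d → ℝ) → ℝ} {t : ℝ≥0∞} (h : atbENorm n p μ f < t) :
    ∃ B : ℕ → AtomicBlock n p μ, (∀ᵐ x ∂μ, HasSum (fun i => (B i).b x) (f x)) ∧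
      ∑' i, (B i).size < t := by
  simpa only [atbENorm, iInf_lt_iff, exists_prop] using h

lemma atbENorm_le_tsum_size {ι : Type*} [Denumerable ι] {f : (Fin d → ℝ) → ℝ}
    (B : ι → AtomicBlock n p μ) (h : ∀ᵐ x ∂μ, HasSum (fun i => (B i).b x) (f x)) :
    atbENorm n p μ f ≤ ∑' i, (B i).size := by
  have e : ℕ ≃ ι := (Denumerable.eqv ι).symm
  refine iInf₂_le_of_le (fun i => B (e i)) ?_ (le_of_eq (e.tsum_eq fun i => (B i).size))
  filter_upwards [h] with x hx
  exact (e.hasSum_iff (f := fun i => (B i).b x)).2 hx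

lemma AtomicBlock.atbENorm_le (B : AtomicBlock n p μ) : atbENorm n p μ B.b ≤ B.size := by
  classical
  refine (atbENorm_le_tsum_size (fun i : ℕ => if i = 0 then B else AtomicBlock.zero B.R)
    (Eventually.of_forall fun x => ?_)).trans (le_of_eq ?_)
  · have := hasSum_ite_eq (0 : ℕ) (B.b x)
    refine this.congr_fun fun i => ?_
    split_ifs <;> simp [AtomicBlock.zero]
  · rw [tsum_eq_single 0]
    · simp
    · intro i hi
      simp [hi, AtomicBlock.size, AtomicBlock.zero]

lemma lintegral_enorm_le_atbENorm (hp : 1 < p) (f : (Fin d → ℝ) → ℝ) :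
    ∫⁻ x, ‖f x‖ₑ ∂μ ≤ atbENorm n p μ f := by
  refine le_iInf₂ fun B hB => ?_
  refine (lintegral_enorm_le_tsum (fun i => (B i).integrable.aestronglyMeasurable) hB).trans ?_
  exact ENNReal.tsum_le_tsum fun i => (B i).lintegral_enorm_le hp

/-- Countable subadditivity of the norm. -/
lemma atbENorm_le_tsum (hp : 1 < p) {f : (Fin d → ℝ) → ℝ} {h : ℕ → (Fin d → ℝ) → ℝ}
    (hf : ∀ᵐ x ∂μ, HasSum (fun k => h k x) (f x)) :
    atbENorm n p μ f ≤ ∑' k, atbENorm n p μ (h k) := by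
  by_cases htop : ∑' k, atbENorm n p μ (h k) = ∞
  · rw [htop]; exact le_top
  refine ENNReal.le_of_forall_pos_le_add fun ε hε _ => ?_
  obtain ⟨δ, hδ, hδε⟩ := ENNReal.exists_pos_sum_of_countable' (ENNReal.coe_ne_zero.2 hε.ne') ℕ
  have hfin : ∀ k, atbENorm n p μ (h k) ≠ ∞ := fun k => ENNReal.ne_top_of_tsum_ne_top htop k
  have hex : ∀ k, ∃ B : ℕ → AtomicBlock n p μ,
      (∀ᵐ x ∂μ, HasSum (fun i => (B i).b x) (h k x)) ∧
      ∑' i, (B i).size < atbENorm n p μ (h k) + δ k := fun k =>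
    exists_decomposition (ENNReal.lt_add_right (hfin k) (hδ k).ne')
  choose B hB1 hB2 using hex
  have hsum : ∑' z : ℕ × ℕ, (B z.1 z.2).size ≤ ∑' k, atbENorm n p μ (h k) + ε := by
    rw [ENNReal.tsum_prod (f := fun k i => (B k i).size)]
    calc _ ≤ ∑' k, (atbENorm n p μ (h k) + δ k) := ENNReal.tsum_le_tsum fun k => (hB2 k).le
      _ = ∑' k, atbENorm n p μ (h k) + ∑' k, δ k := ENNReal.tsum_add
      _ ≤ _ := by gcongr
  refine (atbENorm_le_tsum_size (fun z : ℕ × ℕ => B z.1 z.2) ?_).trans hsum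
  have hae : ∀ᵐ x ∂μ, ∑' z : ℕ × ℕ, ‖(B z.1 z.2).b x‖ₑ < ∞ := by
    have hmeas : ∀ z : ℕ × ℕ, AEMeasurable (fun x => ‖(B z.1 z.2).b x‖ₑ) μ := fun z =>
      (B z.1 z.2).integrable.aestronglyMeasurable.enorm
    refine ae_lt_top' (AEMeasurable.tsum hmeas) ?_
    rw [lintegral_tsum hmeas]
    refine ne_top_of_le_ne_top ?_
      ((ENNReal.tsum_le_tsum fun z : ℕ × ℕ => (B z.1 z.2).lintegral_enorm_le hp).trans hsum)
    exact ENNReal.add_ne_top.2 ⟨htop, ENNReal.coe_ne_top⟩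
  filter_upwards [hae, hf, ae_all_iff.2 hB1] with x hx1 hx2 hx3
  have hs := (Summable.of_enorm hx1.ne).hasSum
  have := hs.prod_fiberwise hx3
  rwa [this.unique hx2] at hs

/-- If a bounded function is tested against `f ∈ H^{1,p}`, the pairing may be computed block by
block; in particular bounds on blocks give bounds on `f`. -/
lemma enorm_integral_mul_le_of_blocks (hp : 1 < p) {f u : (Fin d → ℝ) → ℝ} {M : ℝ} {K : ℝ≥0}
    (hu : AEStronglyMeasurable u μ) (hM : ∀ x, ‖u x‖ ≤ M)
    (hK : ∀ B : AtomicBlock n p μ, B.size ≠ ∞ → ‖∫ x, B.b x * u x ∂μ‖ₑ ≤ K * B.size)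
    (hf : atbENorm n p μ f < ∞) : ‖∫ x, f x * u x ∂μ‖ₑ ≤ K * atbENorm n p μ f := by
  have key : ∀ t, atbENorm n p μ f < t → ‖∫ x, f x * u x ∂μ‖ₑ ≤ K * t := by
    intro t ht
    obtain ⟨B, hB1, hB2⟩ := exists_decomposition ht
    have hBtop : ∑' i, (B i).size ≠ ∞ := (hB2.trans_le le_top).ne
    have heq : ∫ x, f x * u x ∂μ = ∑' i, ∫ x, (B i).b x * u x ∂μ := by
      rw [← integral_tsum]
      · refine integral_congr_ae ?_
        filter_upwards [hB1] with x hx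
        exact (hx.mul_right (u x)).tsum_eq.symm
      · exact fun i => (B i).integrable.aestronglyMeasurable.mul hu
      · refine ne_top_of_le_ne_top (b := ∑' i, (B i).size * ENNReal.ofReal M) ?_
          (ENNReal.tsum_le_tsum fun i => ?_)
        · rw [ENNReal.tsum_mul_right]
          exact ENNReal.mul_ne_top hBtop ENNReal.ofReal_ne_top
        · simp_rw [enorm_mul]
          calc ∫⁻ x, ‖(B i).b x‖ₑ * ‖u x‖ₑ ∂μ ≤ ∫⁻ x, ‖(B i).b x‖ₑ * ENNReal.ofReal M ∂μ := by
                refine lintegral_mono fun x => ?_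
                gcongr
                rw [← ofReal_norm]
                exact ENNReal.ofReal_le_ofReal (hM x)
            _ = (∫⁻ x, ‖(B i).b x‖ₑ ∂μ) * ENNReal.ofReal M :=
                lintegral_mul_const' _ _ ENNReal.ofReal_ne_top
            _ ≤ _ := by gcongr; exact (B i).lintegral_enorm_le hp
    rw [heq]
    refine enorm_tsum_le_tsum_enorm.trans ?_
    calc ∑' i, ‖∫ x, (B i).b x * u x ∂μ‖ₑ ≤ ∑' i, K * (B i).size :=
          ENNReal.tsum_le_tsum fun i => hK _ (ENNReal.ne_top_of_tsum_ne_top hBtop i)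
      _ = K * ∑' i, (B i).size := ENNReal.tsum_mul_left
      _ ≤ K * t := by gcongr
  rcases eq_or_ne K 0 with rfl | hK0
  · simpa using key ∞ hf
  · have hK0' : (K : ℝ≥0∞) ≠ 0 := ENNReal.coe_ne_zero.2 hK0
    rw [mul_comm, ← ENNReal.div_le_iff hK0' ENNReal.coe_ne_top]
    refine le_of_forall_gt_imp_ge_of_dense fun t ht => ?_
    rw [ENNReal.div_le_iff hK0' ENNReal.coe_ne_top, mul_comm]
    exact key t ht

lemma integral_eq_zero_of_atbENorm_lt_top (hp : 1 < p) {f : (Fin d → ℝ) → ℝ}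
    (hf : atbENorm n p μ f < ∞) : ∫ x, f x ∂μ = 0 := by
  have h := enorm_integral_mul_le_of_blocks (u := fun _ => 1) (M := 1) (K := 0) hp
    aestronglyMeasurable_const (by simp) (fun B _ => by simp [B.integral_eq]) hf
  simpa using h

/-! ### Building blocks and approximating them by bounded functions -/

lemma coeffK_ne_top (hn : 1 ≤ n) (hG : CubeGrowth n c μ) (Q R : Cube μ) :
    coeffK n Q R ≠ ∞ := by
  cases Q with
  | whole h => simp [coeffK]
  | cube x l hx hl =>
    cases R with
    | cube y s hy hs =>
      obtain ⟨m, hm⟩ := pow_unbounded_of_one_lt (s / l) (one_lt_two (α := ℝ))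
      refine ne_top_of_le_ne_top ?_ (coeffK_le_of_comparable (m := m) hG
        ((div_lt_iff₀ hl).1 hm).le)
      exact ENNReal.add_ne_top.2 ⟨by simp, ENNReal.mul_ne_top (by simp) (by simp)⟩
    | whole h =>
      obtain ⟨m, hm⟩ := pow_unbounded_of_one_lt (max 1 (μ univ).toReal / l) (one_lt_two (α := ℝ))
      rw [div_lt_iff₀ hl] at hm
      have h1 : (1 : ℝ) ≤ 2 ^ m * l := (le_max_left _ _).trans hm.le
      have h2 : μ univ ≤ ENNReal.ofReal (2 ^ m * l) := by
        rw [← ENNReal.ofReal_toReal h.ne]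
        exact ENNReal.ofReal_le_ofReal ((le_max_right _ _).trans hm.le)
      have h3 : 1 + ∑' k : ℕ, density n μ x (2 ^ m * l) (k + 1) ≤ 2 :=
        coeffK_whole_le hn h hx h1 h2
      simp only [density_shift] at h3
      change 1 + ∑' k : ℕ, density n μ x l (k + 1) ≠ ∞
      rw [← ENNReal.summable.sum_add_tsum_nat_add' (k := m)]
      refine ENNReal.add_ne_top.2 ⟨ENNReal.one_ne_top, ENNReal.add_ne_top.2 ⟨?_, ?_⟩⟩
      · refine (ENNReal.sum_lt_top.2 fun k _ => ?_).ne
        exact (hG.density_le x hl _).trans_lt ENNReal.coe_lt_top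
      · refine ne_top_of_le_ne_top (by norm_num) (le_trans (le_trans (le_of_eq ?_) le_add_self) h3)
        refine tsum_congr fun k => ?_
        congr 1
        ring

lemma atomBound_ne_zero (hn : 1 ≤ n) (hG : CubeGrowth n c μ) (hμ : μ ≠ 0) (Q R : Cube μ) :
    atomBound n p Q R ≠ 0 := by
  have := hG.isLocallyFiniteMeasure
  refine mul_ne_zero ?_ (ENNReal.inv_ne_zero.2 (coeffK_ne_top hn hG Q R))
  exact (ENNReal.rpow_pos (Cube.measure_pos hμ _) (Cube.measure_lt_top _).ne).ne'

lemma atomBound_ne_top [IsLocallyFiniteMeasure μ] (hμ : μ ≠ 0) (Q R : Cube μ) :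
    atomBound n p Q R ≠ ∞ := by
  refine ENNReal.mul_ne_top ?_ (ne_top_of_le_ne_top ENNReal.one_ne_top (inv_coeffK_le_one Q R))
  rw [Ne, ENNReal.rpow_eq_top_iff, not_or, not_and_or, not_and_or]
  exact ⟨Or.inl (Cube.measure_pos hμ _).ne', Or.inl (Cube.measure_lt_top _).ne⟩

lemma hasSum_of_eq {f g : ℕ → ℝ} {a : ℝ} (h : HasSum f a) (e : ∀ i, g i = f i) : HasSum g a := by
  rwa [funext e]

lemma ennreal_div_mul_le (a b : ℝ≥0∞) : a / b * b ≤ a := by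
  rw [ENNReal.div_eq_inv_mul, mul_right_comm]
  exact mul_le_of_le_one_left zero_le (ENNReal.inv_mul_le_one b)

/-- A block assembled from functions `u j` whose `L^p` norms are at most `t j` times the bound for
atoms: the atoms are `u j / t j`. -/
lemma exists_block (hp : 1 < p) {b : (Fin d → ℝ) → ℝ} {R : Cube μ} {Q : ℕ → Cube μ}
    {u : ℕ → (Fin d → ℝ) → ℝ} {t : ℕ → ℝ≥0} (hb : Integrable b μ)
    (hbs : Function.support b ⊆ R.toSet) (hb0 : ∫ x, b x ∂μ = 0)
    (hQ : ∀ j, (Q j).toSet ⊆ R.toSet) (hu : ∀ j, AEStronglyMeasurable (u j) μ)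
    (hus : ∀ j, Function.support (u j) ⊆ (Q j).toSet)
    (hun : ∀ j, eLpNorm (u j) p μ ≤ t j * atomBound n p (Q j) R)
    (hsum : ∀ᵐ x ∂μ, HasSum (fun j => u j x) (b x)) :
    ∃ B : AtomicBlock n p μ, B.b = b ∧ B.R = R ∧ B.size ≤ ∑' j, (t j : ℝ≥0∞) := by
  have hzero : ∀ j, t j = 0 → u j =ᵐ[μ] 0 := by
    intro j hj
    have h := hun j
    rw [hj, ENNReal.coe_zero, zero_mul, nonpos_iff_eq_zero,
      eLpNorm_eq_zero_iff (hu j) (one_pos.trans hp).ne'] at h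
    exact h
  have hsum' : ∀ᵐ x ∂μ, HasSum (fun j => (t j : ℝ) * ((t j : ℝ)⁻¹ * u j x)) (b x) := by
    have hz : ∀ᵐ x ∂μ, ∀ j, t j = 0 → u j x = 0 := by
      rw [ae_all_iff]
      intro j
      by_cases hj : t j = 0
      · filter_upwards [hzero j hj] with x hx _
        exact hx
      · exact Eventually.of_forall fun x h => absurd h hj
    filter_upwards [hsum, hz] with x hx hzx
    convert hx using 2 with j
    by_cases hj : t j = 0
    · rw [hzx j hj]; simp
    · rw [← mul_assoc, mul_inv_cancel₀ (by exact_mod_cast hj), one_mul]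
  refine ⟨{ b := b, R := R, Q := Q, a := fun j x => (t j : ℝ)⁻¹ * u j x, coef := fun j => t j
            integrable := hb, support_b := hbs, integral_eq := hb0, subset := hQ
            measurable_a := fun j => (hu j).const_mul _
            support_a := fun j x hx => hus j (right_ne_zero_of_mul hx)
            norm_a := fun j => ?_
            hasSum := hsum' }, rfl, rfl, ?_⟩
  · change eLpNorm ((t j : ℝ)⁻¹ • u j) p μ ≤ atomBound n p (Q j) R
    rw [eLpNorm_const_smul]
    by_cases hj : t j = 0
    · simp [hj]
    · rw [enorm_inv (by exact_mod_cast hj), Real.enorm_eq_ofReal (t j).coe_nonneg,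
        ENNReal.ofReal_coe_nnreal]
      calc _ ≤ (t j : ℝ≥0∞)⁻¹ * (t j * atomBound n p (Q j) R) := by gcongr; exact hun j
        _ = ((t j : ℝ≥0∞)⁻¹ * t j) * atomBound n p (Q j) R := by ring
        _ ≤ 1 * atomBound n p (Q j) R := by gcongr; exact ENNReal.inv_mul_le_one _
        _ = _ := one_mul _
  · refine le_of_eq (tsum_congr fun j => ?_)
    rw [Real.enorm_eq_ofReal (t j).coe_nonneg, ENNReal.ofReal_coe_nnreal]

lemma atbENorm_le_of_two_atoms (hp : 1 < p) {u v : (Fin d → ℝ) → ℝ} {Q Q' R : Cube μ} {s t : ℝ≥0}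
    (hQ : Q.toSet ⊆ R.toSet) (hQ' : Q'.toSet ⊆ R.toSet)
    (hu : AEStronglyMeasurable u μ) (hv : AEStronglyMeasurable v μ)
    (hus : Function.support u ⊆ Q.toSet) (hvs : Function.support v ⊆ Q'.toSet)
    (hun : eLpNorm u p μ ≤ s * atomBound n p Q R) (hvn : eLpNorm v p μ ≤ t * atomBound n p Q' R)
    (h0 : ∫ x, (u + v) x ∂μ = 0) : atbENorm n p μ (u + v) ≤ s + t := by
  have hfin : ∀ {w : (Fin d → ℝ) → ℝ} {P : Cube μ} {k : ℝ≥0}, AEStronglyMeasurable w μ →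
      Function.support w ⊆ P.toSet → eLpNorm w p μ ≤ k * atomBound n p P R → Integrable w μ := by
    intro w P k h1 h2 h3
    refine ⟨h1, (lintegral_enorm_le_of_atom hp h1 h2 h3).trans_lt ?_⟩
    exact ENNReal.mul_lt_top ENNReal.coe_lt_top
      ((inv_coeffK_le_one _ _).trans_lt ENNReal.one_lt_top)
  have hex : ∃ B : AtomicBlock n p μ, B.b = u + v ∧ B.R = R ∧
      B.size ≤ ∑' j : ℕ, ((if j = 0 then s else if j = 1 then t else 0 : ℝ≥0) : ℝ≥0∞) := by
    refine exists_block (b := u + v) (Q := fun j => if j = 0 then Q else Q')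
      (u := fun j => if j = 0 then u else if j = 1 then v else 0)
      (t := fun j => if j = 0 then s else if j = 1 then t else 0) hp
      ((hfin hu hus hun).add (hfin hv hvs hvn)) ?_ h0 ?_ ?_ ?_ ?_ ?_
    · refine (Function.support_add u v).trans ?_
      exact union_subset (hus.trans hQ) (hvs.trans hQ')
    · intro j; split_ifs <;> assumption
    · intro j
      split_ifs
      · exact hu
      · exact hv
      · exact aestronglyMeasurable_zero
    · intro j
      split_ifs <;> simp_all
    · intro j
      split_ifs <;> simp_all
    · refine Eventually.of_forall fun x => ?_
      have := hasSum_sum_of_ne_finset_zero (L := SummationFilter.unconditional ℕ) (s := Finset.range 2) (f := fun j : ℕ =>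
        (if j = 0 then u else if j = 1 then v else 0 : (Fin d → ℝ) → ℝ) x) fun j hj => by
          rw [Finset.mem_range, not_lt] at hj
          rw [if_neg (by omega), if_neg (by omega), Pi.zero_apply]
      simpa [Finset.sum_range_succ] using this
  obtain ⟨B, hB1, -, hB2⟩ := hex
  have h1 := B.atbENorm_le
  rw [hB1] at h1
  refine h1.trans (hB2.trans (le_of_eq ?_))
  rw [tsum_eq_sum (s := Finset.range 2)]
  · simp [Finset.sum_range_succ]
  · intro j hj
    rw [Finset.mem_range, not_lt] at hj
    rw [if_neg (by omega), if_neg (by omega), ENNReal.coe_zero]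

/-- A mean zero function supported in a cube is a block with a single atom. -/
lemma atbENorm_le_of_single_atom (hp : 1 < p) {u : (Fin d → ℝ) → ℝ} {R : Cube μ} {t : ℝ≥0}
    (hu : AEStronglyMeasurable u μ) (hus : Function.support u ⊆ R.toSet)
    (hun : eLpNorm u p μ ≤ t * atomBound n p R R) (h0 : ∫ x, u x ∂μ = 0) :
    atbENorm n p μ u ≤ t := by
  have := atbENorm_le_of_two_atoms (n := n) (v := 0) (Q' := R) (t := 0) hp Subset.rfl Subset.rfl hu
    aestronglyMeasurable_zero hus (by simp) hun (by simp) (by simpa using h0)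
  simpa using this

lemma IsBoundedCompSupp.add {f g : (Fin d → ℝ) → ℝ} (hf : IsBoundedCompSupp μ f)
    (hg : IsBoundedCompSupp μ g) : IsBoundedCompSupp μ (f + g) := by
  obtain ⟨hf1, S, hS, hfS⟩ := hf
  obtain ⟨hg1, T, hT, hgT⟩ := hg
  refine ⟨hf1.add hg1, S ∪ T, hS.union hT, ?_⟩
  filter_upwards [hfS, hgT] with x h1 h2 hx
  rw [mem_union, not_or] at hx
  simp [h1 hx.1, h2 hx.2]

lemma IsBoundedCompSupp.const_smul {f : (Fin d → ℝ) → ℝ} (hf : IsBoundedCompSupp μ f) (t : ℝ) :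
    IsBoundedCompSupp μ (t • f) := by
  obtain ⟨hf1, S, hS, hfS⟩ := hf
  refine ⟨hf1.const_smul t, S, hS, ?_⟩
  filter_upwards [hfS] with x h1 hx
  simp [h1 hx]

lemma IsBoundedCompSupp.zero : IsBoundedCompSupp μ (0 : (Fin d → ℝ) → ℝ) :=
  ⟨MemLp.zero, ∅, isCompact_empty, by simp⟩

lemma IsBoundedCompSupp.sum {ι : Type*} (s : Finset ι) {f : ι → (Fin d → ℝ) → ℝ}
    (hf : ∀ i ∈ s, IsBoundedCompSupp μ (f i)) : IsBoundedCompSupp μ (∑ i ∈ s, f i) :=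
  Finset.sum_induction f _ (fun _ _ => IsBoundedCompSupp.add) IsBoundedCompSupp.zero hf

lemma IsBoundedCompSupp.congr {f g : (Fin d → ℝ) → ℝ} (hf : IsBoundedCompSupp μ f)
    (h : f =ᵐ[μ] g) : IsBoundedCompSupp μ g := by
  obtain ⟨hf1, S, hS, hfS⟩ := hf
  refine ⟨hf1.ae_eq h, S, hS, ?_⟩
  filter_upwards [hfS, h] with x h1 h2 hx
  rw [← h2, h1 hx]

lemma Cube.exists_compact_subset (hμ : μ ≠ 0) (R : Cube μ) :
    ∃ Q : Cube μ, IsCompact Q.toSet ∧ Q.toSet ⊆ R.toSet := by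
  cases R with
  | cube x l hx hl => exact ⟨.cube x l hx hl, isCompact_closedBall _ _, Subset.rfl⟩
  | whole h =>
    have hne : μ.support.Nonempty := by
      rw [nonempty_iff_ne_empty]
      intro h0
      have h2 := Measure.support_mem_ae (μ := μ)
      rw [mem_ae_iff, h0, compl_empty] at h2
      exact hμ (Measure.measure_univ_eq_zero.1 h2)
    obtain ⟨x, hx⟩ := hne
    exact ⟨.cube x 1 hx one_pos, isCompact_closedBall _ _, subset_univ _⟩

/-- A `p`-atomic block with `p < ∞` differs by a `p`-atomic block of small size from a bounded function
with compact support: truncate the sum, replace finitely many atoms by bounded functions, and restore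
the vanishing integral by a multiple of the indicator of a fixed cube. -/
lemma AtomicBlock.exists_approx (hn : 1 ≤ n) (hG : CubeGrowth n c μ) (hμ : μ ≠ 0) (hp : 1 < p)
    (hp' : p ≠ ∞) (B : AtomicBlock n p μ) (hB : B.size ≠ ∞) {η : ℝ≥0∞} (hη : η ≠ 0) :
    ∃ B' : AtomicBlock n p μ, B'.R = B.R ∧ B'.size ≤ η ∧
      IsBoundedCompSupp μ (fun x => B.b x - B'.b x) := by
  have hloc := hG.isLocallyFiniteMeasure
  obtain ⟨Q₀, hQ₀c, hQ₀R⟩ := B.R.exists_compact_subset hμ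
  -- the normalized indicator of `Q₀`
  set ψ : (Fin d → ℝ) → ℝ := Q₀.toSet.indicator fun _ => (μ.real Q₀.toSet)⁻¹ with hψ
  have hreal : μ.real Q₀.toSet ≠ 0 := by
    rw [measureReal_def, ENNReal.toReal_ne_zero]
    exact ⟨(Q₀.measure_pos hμ).ne', Q₀.measure_lt_top.ne⟩
  have hψint : ∫ x, ψ x ∂μ = 1 := by
    rw [hψ, integral_indicator Q₀.measurableSet, setIntegral_const, smul_eq_mul,
      mul_inv_cancel₀ hreal]
  have hψm : ∀ s : ℝ≥0∞, MemLp ψ s μ := fun s =>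
    memLp_indicator_const s Q₀.measurableSet _ (Or.inr Q₀.measure_lt_top.ne)
  have hψs : Function.support ψ ⊆ Q₀.toSet := Set.support_indicator_subset
  set κ : ℝ≥0 := (eLpNorm ψ p μ / atomBound n p Q₀ B.R).toNNReal with hκ
  have hκle : eLpNorm ψ p μ ≤ κ * atomBound n p Q₀ B.R := by
    rw [hκ, ENNReal.coe_toNNReal (ENNReal.div_ne_top (hψm p).2.ne
      (atomBound_ne_zero hn hG hμ _ _)), ENNReal.div_mul_cancel
      (atomBound_ne_zero hn hG hμ _ _) (atomBound_ne_top hμ _ _)]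
  -- the parameters
  have hη' : η / (1 + κ) ≠ 0 := ENNReal.div_ne_zero.2 ⟨hη, by simp⟩
  obtain ⟨δ, hδ0, hδ⟩ : ∃ δ : ℝ≥0, δ ≠ 0 ∧ δ * B.size ≤ (η / (1 + κ)) / 2 := by
    have h2 : (η / (1 + κ)) / 2 ≠ 0 := ENNReal.div_ne_zero.2 ⟨hη', by norm_num⟩
    obtain ⟨δ, hδ1, hδ2⟩ := ENNReal.lt_iff_exists_nnreal_btwn.1
      (pos_iff_ne_zero.2 (ENNReal.div_ne_zero.2 ⟨h2, hB⟩))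
    exact ⟨δ, (ENNReal.coe_pos.1 hδ1).ne', (mul_le_mul_left hδ2.le _).trans (ennreal_div_mul_le _ _)⟩
  obtain ⟨J, hJ⟩ : ∃ J : ℕ, ∑' k, ‖B.coef (k + J)‖ₑ ≤ (η / (1 + κ)) / 2 := by
    have h2 : 0 < (η / (1 + κ)) / 2 :=
      pos_iff_ne_zero.2 (ENNReal.div_ne_zero.2 ⟨hη', by norm_num⟩)
    have := (ENNReal.tendsto_sum_nat_add _ hB).eventually_le_const h2
    exact this.exists
  -- approximation of the atoms
  have hmem : ∀ j, MemLp (B.a j) p μ := fun j =>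
    ⟨B.measurable_a j, (B.norm_a j).trans_lt (atomBound_ne_top hμ _ _).lt_top⟩
  have happ : ∀ j, ∃ v : (Fin d → ℝ) → ℝ, IsBoundedCompSupp μ v ∧ AEStronglyMeasurable v μ ∧
      Function.support v ⊆ (B.Q j).toSet ∧
      eLpNorm (B.a j - v) p μ ≤ δ * atomBound n p (B.Q j) B.R := by
    intro j
    obtain ⟨g, hg1, hg2, hg3, hg4⟩ := (hmem j).exists_hasCompactSupport_eLpNorm_sub_le hp'
      (ε := δ * atomBound n p (B.Q j) B.R)
      (mul_ne_zero (ENNReal.coe_ne_zero.2 hδ0) (atomBound_ne_zero hn hG hμ _ _))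
    have hgtop : MemLp g ∞ μ := hg3.memLp_of_hasCompactSupport hg1
    refine ⟨(B.Q j).toSet.indicator g, ⟨hgtop.indicator (B.Q j).measurableSet, tsupport g, hg1,
      Eventually.of_forall fun x hx => ?_⟩,
      hg4.aestronglyMeasurable.indicator (B.Q j).measurableSet,
      Set.support_indicator_subset, ?_⟩
    · classical
      rw [indicator_apply]
      split_ifs
      · exact image_eq_zero_of_notMem_tsupport hx
      · rfl
    · refine le_trans (eLpNorm_mono fun x => ?_) hg2
      by_cases hx : x ∈ (B.Q j).toSet
      · simp [hx]
      · have : B.a j x = 0 := by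
          by_contra h
          exact hx (B.support_a j h)
        simp [hx, this]
  choose v hv1 hv2 hv3 hv4 using happ
  set V : (Fin d → ℝ) → ℝ := ∑ j ∈ Finset.range J, B.coef j • v j with hV
  have hVc : IsBoundedCompSupp μ V := IsBoundedCompSupp.sum _ fun j _ => (hv1 j).const_smul _
  set u : ℕ → (Fin d → ℝ) → ℝ := fun j =>
    if j < J then B.coef j • (B.a j - v j) else B.coef j • B.a j with hu
  set t : ℕ → ℝ≥0 := fun j => if j < J then δ * ‖B.coef j‖₊ else ‖B.coef j‖₊ with ht
  have hum : ∀ j, AEStronglyMeasurable (u j) μ := by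
    intro j
    simp only [hu]
    split_ifs
    · exact ((B.measurable_a j).sub (hv2 j)).const_smul _
    · exact (B.measurable_a j).const_smul _
  have hus : ∀ j, Function.support (u j) ⊆ (B.Q j).toSet := by
    intro j
    simp only [hu]
    split_ifs
    · refine (Function.support_const_smul_subset _ _).trans ((Function.support_sub _ _).trans ?_)
      exact union_subset (B.support_a j) (hv3 j)
    · exact (Function.support_const_smul_subset _ _).trans (B.support_a j)
  have hun : ∀ j, eLpNorm (u j) p μ ≤ t j * atomBound n p (B.Q j) B.R := by
    intro j
    simp only [hu, ht]
    split_ifs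
    · rw [eLpNorm_const_smul]
      refine (mul_le_mul_right (hv4 j) _).trans (le_of_eq ?_)
      push_cast
      rw [enorm_eq_nnnorm]
      ring
    · rw [eLpNorm_const_smul]
      exact mul_le_mul_right (B.norm_a j) _
  have htsum : ∑' j, (t j : ℝ≥0∞) ≤ η / (1 + κ) := by
    rw [← ENNReal.summable.sum_add_tsum_nat_add' (k := J), ← ENNReal.add_halves (η / (1 + κ))]
    refine add_le_add (le_trans ?_ hδ) (le_trans (le_of_eq ?_) hJ)
    · rw [AtomicBlock.size, ← ENNReal.tsum_mul_left]
      refine le_trans (Finset.sum_le_sum fun j hj => ?_) (ENNReal.sum_le_tsum (Finset.range J))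
      rw [Finset.mem_range] at hj
      simp only [ht, if_pos hj]
      push_cast
      rfl
    · refine tsum_congr fun k => ?_
      simp only [ht, if_neg (show ¬ k + J < J by omega)]
      rfl
  have husum : ∀ᵐ x ∂μ, HasSum (fun j => u j x) (B.b x - V x) := by
    filter_upwards [B.hasSum] with x hx
    have h1 : HasSum (fun j => if j < J then B.coef j * v j x else 0) (V x) := by
      have := hasSum_sum_of_ne_finset_zero (L := SummationFilter.unconditional ℕ)
        (s := Finset.range J) (f := fun j => if j < J then B.coef j * v j x else 0) fun j hj => by
          rw [Finset.mem_range] at hj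
          rw [if_neg hj]
      convert this using 1
      rw [hV, Finset.sum_apply]
      refine Finset.sum_congr rfl fun j hj => ?_
      rw [Finset.mem_range] at hj
      rw [if_pos hj]
      rfl
    refine hasSum_of_eq (hx.sub h1) fun j => ?_
    by_cases hj : j < J
    · simp [hu, hj, mul_sub]
    · simp [hu, hj]
  have hVint : Integrable V μ := by
    refine integrable_finsetSum' _ fun j _ => Integrable.smul _ ?_
    obtain ⟨h1, S, hS, h2⟩ := hv1 j
    have h3 : IntegrableOn (v j) S μ := by
      have : IsFiniteMeasure (μ.restrict S) := ⟨by simpa using hS.measure_lt_top⟩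
      exact (h1.restrict S).integrable le_top
    exact h3.integrable_of_ae_notMem_eq_zero h2
  have hrint : Integrable (fun x => B.b x - V x) μ := B.integrable.sub hVint
  set e : ℝ := ∫ x, (B.b x - V x) ∂μ with he
  have hele : ‖e‖ₑ ≤ ∑' j, (t j : ℝ≥0∞) := by
    refine (enorm_integral_le_lintegral_enorm _).trans ((lintegral_enorm_le_tsum hum husum).trans ?_)
    refine ENNReal.tsum_le_tsum fun j => ?_
    refine (lintegral_enorm_le_of_atom hp (hum j) (hus j) (hun j)).trans ?_
    exact mul_le_of_le_one_right zero_le (inv_coeffK_le_one _ _)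
  have hVs : Function.support V ⊆ B.R.toSet := by
    intro x hx
    by_contra hxR
    refine hx ?_
    rw [hV, Finset.sum_apply]
    refine Finset.sum_eq_zero fun j _ => ?_
    have : v j x = 0 := by
      by_contra h
      exact hxR (B.subset j (hv3 j h))
    simp [this]
  have hex : ∃ B' : AtomicBlock n p μ, (B'.b = fun x => -e * ψ x + (B.b x - V x)) ∧ B'.R = B.R ∧
      B'.size ≤ ∑' j : ℕ, ((Nat.casesOn j (‖e‖₊ * κ) t : ℝ≥0) : ℝ≥0∞) := by
    refine exists_block (Q := fun j => Nat.casesOn j Q₀ B.Q)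
      (u := fun j => Nat.casesOn j ((-e) • ψ) u)
      (t := fun j => Nat.casesOn j (‖e‖₊ * κ) t) hp ?_ ?_ ?_ ?_ ?_ ?_ ?_ ?_
    · exact ((memLp_one_iff_integrable.1 (hψm 1)).const_mul _).add hrint
    · intro x hx
      by_contra hxR
      refine hx ?_
      have h1 : ψ x = 0 := by
        by_contra h
        exact hxR (hQ₀R (hψs h))
      have h2 : B.b x = 0 := by
        by_contra h
        exact hxR (B.support_b h)
      have h3 : V x = 0 := by
        by_contra h
        exact hxR (hVs h)
      simp [h1, h2, h3]
    · rw [integral_add ((memLp_one_iff_integrable.1 (hψm 1)).const_mul _) hrint,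
        integral_const_mul, hψint, ← he]
      ring
    · rintro (_ | j)
      · exact hQ₀R
      · exact B.subset j
    · rintro (_ | j)
      · exact (hψm 1).aestronglyMeasurable.const_smul _
      · exact hum j
    · rintro (_ | j)
      · exact (Function.support_const_smul_subset _ _).trans hψs
      · exact hus j
    · rintro (_ | j)
      · change eLpNorm ((-e) • ψ) p μ ≤ ((‖e‖₊ * κ : ℝ≥0) : ℝ≥0∞) * atomBound n p Q₀ B.R
        rw [eLpNorm_const_smul, enorm_neg]
        refine (mul_le_mul_right hκle _).trans (le_of_eq ?_)
        push_cast
        rw [enorm_eq_nnnorm, mul_assoc]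
      · exact hun j
    · filter_upwards [husum] with x hx
      exact HasSum.zero_add (f := fun j => (Nat.casesOn j ((-e) • ψ) u : (Fin d → ℝ) → ℝ) x) hx
  obtain ⟨B', hB'1, hB'2, hB'3⟩ := hex
  refine ⟨B', hB'2, hB'3.trans ?_, ?_⟩
  · rw [tsum_eq_zero_add' ENNReal.summable]
    dsimp only
    calc ((‖e‖₊ * κ : ℝ≥0) : ℝ≥0∞) + ∑' j, (t j : ℝ≥0∞)
        ≤ (∑' j, (t j : ℝ≥0∞)) * κ + ∑' j, (t j : ℝ≥0∞) := by
          push_cast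
          gcongr
          exact hele
      _ = (∑' j, (t j : ℝ≥0∞)) * (1 + κ) := by ring
      _ ≤ η / (1 + κ) * (1 + κ) := by gcongr
      _ ≤ η := ennreal_div_mul_le _ _
  · have hψc : IsBoundedCompSupp μ ψ := ⟨hψm ∞, Q₀.toSet, hQ₀c,
      Eventually.of_forall fun x hx => by simp [hψ, hx]⟩
    refine (hVc.add (hψc.const_smul e)).congr (Eventually.of_forall fun x => ?_)
    simp [hB'1]
    ring

/-- Bounded functions with compact support are dense in `H^{1,p}`, `1 < p < ∞`. -/
lemma exists_boundedCompSupp_approx (hn : 1 ≤ n) (hG : CubeGrowth n c μ) (hμ : μ ≠ 0) (hp : 1 < p)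
    (hp' : p ≠ ∞) {f : (Fin d → ℝ) → ℝ} (hf : atbENorm n p μ f < ∞) {η : ℝ≥0∞} (hη : η ≠ 0) :
    ∃ v, IsBoundedCompSupp μ v ∧ atbENorm n p μ (f - v) ≤ η := by
  obtain ⟨B, hB1, hB2⟩ := exists_decomposition hf
  obtain ⟨δ, hδ, hδη⟩ := ENNReal.exists_pos_sum_of_countable'
    (ENNReal.div_ne_zero.2 ⟨hη, ENNReal.ofNat_ne_top (n := 2)⟩) ℕ
  choose B' _ hB'2 hB'3 using fun i => (B i).exists_approx hn hG hμ hp hp'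
    (ENNReal.ne_top_of_tsum_ne_top hB2.ne i) (hδ i).ne'
  obtain ⟨I, hI⟩ : ∃ I : ℕ, ∑' k, (B (k + I)).size ≤ η / 2 := by
    have h2 : 0 < η / 2 := pos_iff_ne_zero.2 (ENNReal.div_ne_zero.2 ⟨hη, by norm_num⟩)
    exact ((ENNReal.tendsto_sum_nat_add _ hB2.ne).eventually_le_const h2).exists
  refine ⟨∑ i ∈ Finset.range I, fun x => (B i).b x - (B' i).b x,
    IsBoundedCompSupp.sum _ fun i _ => hB'3 i, ?_⟩
  refine (atbENorm_le_tsum_size (fun i : ℕ => if i < I then B' i else B i) ?_).trans ?_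
  · filter_upwards [hB1] with x hx
    have h1 := hasSum_sum_of_ne_finset_zero (L := SummationFilter.unconditional ℕ)
      (s := Finset.range I) (f := fun i => if i < I then (B i).b x - (B' i).b x else 0) fun i hi => by
        rw [Finset.mem_range] at hi
        rw [if_neg hi]
    have h3 : (f - ∑ i ∈ Finset.range I, fun x => (B i).b x - (B' i).b x) x = f x -
        ∑ i ∈ Finset.range I, if i < I then (B i).b x - (B' i).b x else 0 := by
      rw [Pi.sub_apply, Finset.sum_apply]
      congr 1
      refine Finset.sum_congr rfl fun i hi => ?_
      rw [Finset.mem_range] at hi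
      rw [if_pos hi]
    rw [h3]
    refine hasSum_of_eq (hx.sub h1) fun i => ?_
    split_ifs <;> simp
  · rw [← ENNReal.summable.sum_add_tsum_nat_add' (k := I), ← ENNReal.add_halves η]
    refine add_le_add ?_ (le_trans (le_of_eq ?_) hI)
    · refine le_trans (Finset.sum_le_sum fun i hi => ?_)
        ((ENNReal.sum_le_tsum (Finset.range I)).trans hδη.le)
      rw [Finset.mem_range] at hi
      rw [if_pos hi]
      exact hB'2 i
    · refine tsum_congr fun k => ?_
      rw [if_neg (by omega)]

/-! ### Test functions for the `RBMO` conditions -/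

lemma atomBound_top (Q R : Cube μ) :
    atomBound n ∞ Q R = (μ (Q.dilate 1).toSet)⁻¹ * (coeffK n Q R)⁻¹ := by
  rw [atomBound, ENNReal.inv_top, ENNReal.toReal_zero, zero_sub, ENNReal.rpow_neg_one]

lemma atbENorm_top_le_of_two_atoms (hn : 1 ≤ n) (hG : CubeGrowth n c μ) (hμ : μ ≠ 0)
    {u v : (Fin d → ℝ) → ℝ} {Q Q' R : Cube μ} {s t : ℝ≥0∞} (hs : s ≠ ∞) (ht : t ≠ ∞)
    (hQ : Q.toSet ⊆ R.toSet) (hQ' : Q'.toSet ⊆ R.toSet)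
    (hu : AEStronglyMeasurable u μ) (hv : AEStronglyMeasurable v μ)
    (hus : Function.support u ⊆ Q.toSet) (hvs : Function.support v ⊆ Q'.toSet)
    (hun : eLpNorm u ∞ μ ≤ s) (hvn : eLpNorm v ∞ μ ≤ t) (h0 : ∫ x, (u + v) x ∂μ = 0) :
    atbENorm n ∞ μ (u + v) ≤ s * μ (Q.dilate 1).toSet * coeffK n Q R +
      t * μ (Q'.dilate 1).toSet * coeffK n Q' R := by
  have hloc := hG.isLocallyFiniteMeasure
  have key : ∀ {w : (Fin d → ℝ) → ℝ} {P : Cube μ} {k : ℝ≥0∞}, k ≠ ∞ → eLpNorm w ∞ μ ≤ k →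
      k * μ (P.dilate 1).toSet * coeffK n P R ≠ ∞ ∧
      eLpNorm w ∞ μ ≤ (k * μ (P.dilate 1).toSet * coeffK n P R) * atomBound n ∞ P R := by
    intro w P k hk hw
    have h1 := (P.dilate 1).measure_lt_top.ne
    have h2 := coeffK_ne_top hn hG P R
    refine ⟨ENNReal.mul_ne_top (ENNReal.mul_ne_top hk h1) h2, hw.trans (le_of_eq ?_)⟩
    rw [atomBound_top]
    calc k = k * (μ (P.dilate 1).toSet * (μ (P.dilate 1).toSet)⁻¹) *
          (coeffK n P R * (coeffK n P R)⁻¹) := by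
          rw [ENNReal.mul_inv_cancel ((P.dilate 1).measure_pos hμ).ne' h1, ENNReal.mul_inv_cancel
            (one_pos.trans_le (one_le_coeffK _ _)).ne' h2, mul_one, mul_one]
      _ = _ := by ring
  have h1 := key (P := Q) hs hun
  have h2 := key (P := Q') ht hvn
  have := atbENorm_le_of_two_atoms (n := n) (p := ∞) ENNReal.one_lt_top hQ hQ' hu hv hus hvs
    (s := (s * μ (Q.dilate 1).toSet * coeffK n Q R).toNNReal)
    (t := (t * μ (Q'.dilate 1).toSet * coeffK n Q' R).toNNReal)
    (by rw [ENNReal.coe_toNNReal h1.1]; exact h1.2)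
    (by rw [ENNReal.coe_toNNReal h2.1]; exact h2.2) h0
  rwa [ENNReal.coe_toNNReal h1.1, ENNReal.coe_toNNReal h2.1] at this

/-- Testing against `sgn(g - m) χ_Q - λ χ_{Q̃}`, where `m` is the mean of `g` over `Q̃` and `λ` makes
the integral vanish, bounds the oscillation of `g` on `Q`. -/
lemma lintegral_sub_average_tilde_le (hn : 1 ≤ n) (hnd : n ≤ d) (hG : CubeGrowth n c μ)
    (hμ : μ ≠ 0) {g : (Fin d → ℝ) → ℝ} {M : ℝ≥0} (Q : Cube μ)
    (hg : IntegrableOn g Q.tilde.toSet μ)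
    (hT : ∀ f, MemLp f ∞ μ → Function.support f ⊆ Q.tilde.toSet → ∫ x, f x ∂μ = 0 →
      ‖∫ x, f x * g x ∂μ‖ₑ ≤ M * atbENorm n ∞ μ f) :
    ∫⁻ x in Q.toSet, ‖g x - ⨍ y in Q.tilde.toSet, g y ∂μ‖ₑ ∂μ ≤
      M * (1 + 2 * c + 2 ^ (d + 1)) * μ (Q.dilate 1).toSet := by
  have hloc := hG.isLocallyFiniteMeasure
  set P := Q.tilde with hP
  set m := ⨍ y in P.toSet, g y ∂μ with hm
  have hQP : Q.toSet ⊆ P.toSet := Q.toSet_subset_tilde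
  have hPpos := P.measure_pos hμ
  have hPtop := P.measure_lt_top
  have hQtop := Q.measure_lt_top
  have hPr : μ.real P.toSet ≠ 0 := by
    rw [measureReal_def, ENNReal.toReal_ne_zero]; exact ⟨hPpos.ne', hPtop.ne⟩
  have hgm : AEStronglyMeasurable (fun x => g x - m) (μ.restrict P.toSet) :=
    hg.aestronglyMeasurable.sub aestronglyMeasurable_const
  -- the sign of `g - m` on `Q`
  set u : (Fin d → ℝ) → ℝ :=
    Q.toSet.indicator fun x => SignType.sign (g x - m) with hu
  have hsignm : Measurable fun t : ℝ => ((SignType.sign t : SignType) : ℝ) := by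
    have : (fun t : ℝ => ((SignType.sign t : SignType) : ℝ)) =
        fun t => if 0 < t then 1 else if t < 0 then -1 else 0 := by
      funext t
      rw [sign_apply]
      split_ifs <;> simp
    rw [this]
    exact Measurable.ite measurableSet_Ioi measurable_const
      (Measurable.ite measurableSet_Iio measurable_const measurable_const)
  have hsign1 : ∀ t : ℝ, ‖((SignType.sign t : SignType) : ℝ)‖ ≤ 1 := by
    intro t
    rcases lt_trichotomy t 0 with h | h | h
    · simp [sign_neg h]
    · simp [h]
    · simp [sign_pos h]
  have hum : AEStronglyMeasurable u μ := by
    rw [hu, aestronglyMeasurable_indicator_iff Q.measurableSet]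
    exact (hsignm.comp_aemeasurable
      (hgm.mono_measure (Measure.restrict_mono hQP le_rfl)).aemeasurable).aestronglyMeasurable
  have hu1 : ∀ x, ‖u x‖ ≤ 1 := by
    intro x
    rw [hu]
    refine (norm_indicator_le_norm_self _ _).trans (hsign1 _)
  have hus : Function.support u ⊆ Q.toSet := Set.support_indicator_subset
  have huinf : eLpNorm u ∞ μ ≤ 1 := by
    rw [eLpNorm_exponent_top]
    refine eLpNormEssSup_le_of_ae_enorm_bound (Eventually.of_forall fun x => ?_)
    rw [← ofReal_norm, ← ENNReal.ofReal_one]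
    exact ENNReal.ofReal_le_ofReal (hu1 x)
  have huint : Integrable u μ := by
    have h1 : IntegrableOn u Q.toSet μ :=
      Measure.integrableOn_of_bounded hQtop.ne hum (M := 1) (Eventually.of_forall fun x => hu1 x)
    exact h1.integrable_of_forall_notMem_eq_zero fun x hx => by simp [hu, hx]
  set κ : ℝ := -((∫ x, u x ∂μ) / μ.real P.toSet) with hκ
  set v : (Fin d → ℝ) → ℝ := P.toSet.indicator fun _ => κ with hv
  have hκle : ‖κ‖ₑ ≤ μ Q.toSet / μ P.toSet := by
    rw [hκ, enorm_neg, div_eq_mul_inv, enorm_mul, enorm_inv hPr, div_eq_mul_inv,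
      Real.enorm_eq_ofReal measureReal_nonneg, measureReal_def, ENNReal.ofReal_toReal hPtop.ne]
    gcongr
    refine (enorm_integral_le_lintegral_enorm _).trans ?_
    calc ∫⁻ x, ‖u x‖ₑ ∂μ ≤ ∫⁻ x, Q.toSet.indicator (fun _ => (1 : ℝ≥0∞)) x ∂μ := by
          refine lintegral_mono fun x => ?_
          by_cases hx : x ∈ Q.toSet
          · rw [indicator_of_mem hx, ← ofReal_norm, ← ENNReal.ofReal_one]
            exact ENNReal.ofReal_le_ofReal (hu1 x)
          · simp [hu, hx]
      _ = μ Q.toSet := lintegral_indicator_one Q.measurableSet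
  have hvint : Integrable v μ :=
    (integrable_indicator_iff P.measurableSet).2 (integrableOn_const hPtop.ne)
  have hvinf : eLpNorm v ∞ μ ≤ μ Q.toSet / μ P.toSet := by
    rw [eLpNorm_exponent_top]
    refine (eLpNormEssSup_le_of_ae_enorm_bound (Eventually.of_forall fun x => ?_)).trans hκle
    exact enorm_indicator_le_enorm_self _ _
  have hvs : Function.support v ⊆ P.toSet := Set.support_indicator_subset
  have h0 : ∫ x, (u + v) x ∂μ = 0 := by
    simp only [Pi.add_apply]
    rw [integral_add huint hvint, hv, integral_indicator P.measurableSet, setIntegral_const,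
      smul_eq_mul, hκ]
    field_simp
    ring
  have hmem : MemLp (u + v) ∞ μ :=
    MemLp.add ⟨hum, huinf.trans_lt ENNReal.one_lt_top⟩
      ⟨hvint.aestronglyMeasurable, hvinf.trans_lt (ENNReal.div_lt_top hQtop.ne hPpos.ne')⟩
  have hsupp : Function.support (u + v) ⊆ P.toSet :=
    (Function.support_add u v).trans (union_subset (hus.trans hQP) hvs)
  have hnorm : atbENorm n ∞ μ (u + v) ≤ (1 + 2 * c + 2 ^ (d + 1)) * μ (Q.dilate 1).toSet := by
    refine (atbENorm_top_le_of_two_atoms hn hG hμ ENNReal.one_ne_top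
      (ENNReal.div_lt_top hQtop.ne hPpos.ne').ne hQP Subset.rfl hum hvint.aestronglyMeasurable hus
      hvs huinf hvinf h0).trans ?_
    rw [add_mul, coeffK_self, mul_one, one_mul]
    refine add_le_add ?_ ?_
    · rw [mul_comm]
      exact mul_le_mul_left (coeffK_tilde_le hnd hG Q) _
    · have h1 := (P.isDoubling_iff).1 (Q.tilde_isDoubling hnd hG)
      calc μ Q.toSet / μ P.toSet * μ (P.dilate 1).toSet
          ≤ μ Q.toSet / μ P.toSet * (2 ^ (d + 1) * μ P.toSet) := by gcongr
        _ = 2 ^ (d + 1) * (μ Q.toSet / μ P.toSet * μ P.toSet) := by ring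
        _ = 2 ^ (d + 1) * μ Q.toSet := by rw [ENNReal.div_mul_cancel hPpos.ne' hPtop.ne]
        _ ≤ _ := by gcongr; exact Q.toSet_subset_dilate 1
  -- the pairing of the test function with `g`
  have hgmint : IntegrableOn (fun x => g x - m) P.toSet μ := hg.sub (integrableOn_const hPtop.ne)
  have hgm0 : ∫ x in P.toSet, (g x - m) ∂μ = 0 := by
    rw [integral_sub hg (integrableOn_const hPtop.ne), setIntegral_const, hm, setAverage_eq,
      smul_eq_mul, smul_eq_mul]
    field_simp
    ring
  have hpair : ∫ x, (u + v) x * g x ∂μ = ∫ x in Q.toSet, ‖g x - m‖ ∂μ := by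
    have e1 : ∫ x, (u + v) x * g x ∂μ = ∫ x in P.toSet, (u + v) x * g x ∂μ := by
      refine (setIntegral_eq_integral_of_forall_compl_eq_zero fun x hx => ?_).symm
      have : (u + v) x = 0 := by
        by_contra h
        exact hx (hsupp h)
      rw [this, zero_mul]
    have e2 : ∫ x in P.toSet, (u + v) x ∂μ = 0 := by
      rw [setIntegral_eq_integral_of_forall_compl_eq_zero fun x hx => ?_, h0]
      by_contra h
      exact hx (hsupp h)
    have e3 : ∫ x in P.toSet, (u + v) x * g x ∂μ =
        ∫ x in P.toSet, (u x * (g x - m) + κ * (g x - m) + m * (u + v) x) ∂μ := by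
      refine setIntegral_congr_fun P.measurableSet fun x hx => ?_
      have : v x = κ := by simp [hv, hx]
      simp only [Pi.add_apply, this]
      ring
    have i1 : IntegrableOn (fun x => u x * (g x - m)) P.toSet μ :=
      Integrable.bdd_mul hgmint hum.restrict (c := 1) (Eventually.of_forall hu1)
    have i2 : IntegrableOn (fun x => κ * (g x - m)) P.toSet μ := Integrable.const_mul hgmint _
    have i3 : IntegrableOn (fun x => m * (u + v) x) P.toSet μ :=
      Integrable.const_mul (huint.add hvint).integrableOn _
    have i12 : IntegrableOn (fun x => u x * (g x - m) + κ * (g x - m)) P.toSet μ := i1.add i2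
    rw [e1, e3, integral_add i12 i3, integral_add i1 i2, integral_const_mul,
      integral_const_mul, e2, hgm0, mul_zero, mul_zero, add_zero, add_zero]
    have e4 : ∫ x in P.toSet, u x * (g x - m) ∂μ = ∫ x in Q.toSet, u x * (g x - m) ∂μ :=
      setIntegral_eq_of_subset_of_forall_sdiff_eq_zero P.measurableSet hQP
        fun x hx => by simp [hu, hx.2]
    rw [e4]
    refine setIntegral_congr_fun Q.measurableSet fun x hx => ?_
    have : u x = SignType.sign (g x - m) := by rw [hu, indicator_of_mem hx]
    simp only [this]
    rw [Real.norm_eq_abs, sign_mul_self]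
  calc ∫⁻ x in Q.toSet, ‖g x - m‖ₑ ∂μ = ‖∫ x, (u + v) x * g x ∂μ‖ₑ := by
        rw [hpair, Real.enorm_eq_ofReal (integral_nonneg fun _ => norm_nonneg _),
          ofReal_integral_norm_eq_lintegral_enorm (hgmint.mono_set hQP)]
    _ ≤ M * atbENorm n ∞ μ (u + v) := hT _ hmem hsupp h0
    _ ≤ _ := by rw [mul_assoc]; gcongr

/-- Testing against `χ_Q / μ(Q) - χ_R / μ(R)` bounds the difference of the means of `g` over two
doubling cubes. -/
lemma enorm_average_sub_average_le (hn : 1 ≤ n) (hG : CubeGrowth n c μ)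
    (hμ : μ ≠ 0) {g : (Fin d → ℝ) → ℝ} {M : ℝ≥0} {Q R : Cube μ} (hQ : Q.IsDoubling)
    (hR : R.IsDoubling) (hQR : Q.toSet ⊆ R.toSet)
    (hg : IntegrableOn g R.toSet μ)
    (hT : ∀ f, MemLp f ∞ μ → Function.support f ⊆ R.toSet → ∫ x, f x ∂μ = 0 →
      ‖∫ x, f x * g x ∂μ‖ₑ ≤ M * atbENorm n ∞ μ f) :
    ‖(⨍ y in Q.toSet, g y ∂μ) - ⨍ y in R.toSet, g y ∂μ‖ₑ ≤
      M * (2 ^ (d + 1) + 2 ^ (d + 1)) * coeffK n Q R := by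
  have hloc := hG.isLocallyFiniteMeasure
  have hreal : ∀ P : Cube μ, μ.real P.toSet ≠ 0 := by
    intro P
    rw [measureReal_def, ENNReal.toReal_ne_zero]
    exact ⟨(P.measure_pos hμ).ne', P.measure_lt_top.ne⟩
  set w : Cube μ → ℝ → (Fin d → ℝ) → ℝ := fun P ε =>
    P.toSet.indicator fun _ => ε * (μ.real P.toSet)⁻¹ with hw
  have hwint : ∀ P ε, Integrable (w P ε) μ := fun P ε =>
    (integrable_indicator_iff P.measurableSet).2 (integrableOn_const P.measure_lt_top.ne)
  have hwi : ∀ P ε, ∫ x, w P ε x ∂μ = ε := by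
    intro P ε
    rw [hw, integral_indicator P.measurableSet, setIntegral_const, smul_eq_mul,
      mul_comm ε, mul_inv_cancel_left₀ (hreal P)]
  have hwg : ∀ P ε, P.toSet ⊆ R.toSet → Integrable (fun x => w P ε x * g x) μ ∧
      ∫ x, w P ε x * g x ∂μ = ε * ⨍ y in P.toSet, g y ∂μ := by
    intro P ε hP
    have e : (fun x => w P ε x * g x) =
        P.toSet.indicator fun x => (ε * (μ.real P.toSet)⁻¹) * g x := by
      funext x
      by_cases hx : x ∈ P.toSet <;> simp [hw, hx]
    rw [e]
    refine ⟨(integrable_indicator_iff P.measurableSet).2 ((hg.mono_set hP).const_mul _), ?_⟩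
    rw [integral_indicator P.measurableSet, integral_const_mul, setAverage_eq, smul_eq_mul,
      mul_assoc]
  have hwn : ∀ P ε, eLpNorm (w P ε) ∞ μ ≤ ‖ε‖ₑ * (μ P.toSet)⁻¹ := by
    intro P ε
    rw [eLpNorm_exponent_top]
    refine eLpNormEssSup_le_of_ae_enorm_bound (Eventually.of_forall fun x => ?_)
    refine (enorm_indicator_le_enorm_self _ _).trans (le_of_eq ?_)
    rw [enorm_mul, enorm_inv (hreal P), Real.enorm_eq_ofReal measureReal_nonneg, measureReal_def,
      ENNReal.ofReal_toReal P.measure_lt_top.ne]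
  have hwtop : ∀ (P : Cube μ) (ε : ℝ), ‖ε‖ₑ * (μ P.toSet)⁻¹ ≠ ∞ := fun P ε =>
    ENNReal.mul_ne_top enorm_ne_top (ENNReal.inv_ne_top.2 (P.measure_pos hμ).ne')
  have hws : ∀ P ε, Function.support (w P ε) ⊆ P.toSet := fun P ε => Set.support_indicator_subset
  have h0 : ∫ x, (w Q 1 + w R (-1)) x ∂μ = 0 := by
    simp only [Pi.add_apply]
    rw [integral_add (hwint _ _) (hwint _ _), hwi, hwi]
    norm_num
  have hdbl : ∀ P : Cube μ, P.IsDoubling →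
      (μ P.toSet)⁻¹ * μ (P.dilate 1).toSet ≤ 2 ^ (d + 1) := by
    intro P hP
    calc (μ P.toSet)⁻¹ * μ (P.dilate 1).toSet ≤ (μ P.toSet)⁻¹ * (2 ^ (d + 1) * μ P.toSet) := by
          gcongr
          exact P.isDoubling_iff.1 hP
      _ = 2 ^ (d + 1) * ((μ P.toSet)⁻¹ * μ P.toSet) := by ring
      _ ≤ 2 ^ (d + 1) * 1 := by gcongr; exact ENNReal.inv_mul_le_one _
      _ = _ := mul_one _
  have hnorm : atbENorm n ∞ μ (w Q 1 + w R (-1)) ≤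
      (2 ^ (d + 1) + 2 ^ (d + 1)) * coeffK n Q R := by
    refine (atbENorm_top_le_of_two_atoms hn hG hμ (hwtop Q 1) (hwtop R (-1)) hQR Subset.rfl
      (hwint _ _).aestronglyMeasurable (hwint _ _).aestronglyMeasurable (hws _ _) (hws _ _)
      (hwn _ _) (hwn _ _) h0).trans ?_
    rw [enorm_neg, enorm_one, one_mul, one_mul, add_mul]
    refine add_le_add (mul_le_mul_left (hdbl Q hQ) _) ?_
    refine mul_le_mul' (hdbl R hR) ?_
    rw [coeffK_self]
    exact one_le_coeffK _ _
  have hpair : ∫ x, (w Q 1 + w R (-1)) x * g x ∂μ =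
      (⨍ y in Q.toSet, g y ∂μ) - ⨍ y in R.toSet, g y ∂μ := by
    simp only [Pi.add_apply, add_mul]
    rw [integral_add (hwg Q 1 hQR).1 (hwg R (-1) Subset.rfl).1, (hwg Q 1 hQR).2,
      (hwg R (-1) Subset.rfl).2]
    ring
  rw [← hpair, mul_assoc]
  refine (hT _ (MemLp.add ⟨(hwint _ _).aestronglyMeasurable, (hwn _ _).trans_lt
    (hwtop _ _).lt_top⟩ ⟨(hwint _ _).aestronglyMeasurable, (hwn _ _).trans_lt (hwtop _ _).lt_top⟩)
    ((Function.support_add _ _).trans (union_subset ((hws _ _).trans hQR) (hws _ _))) h0).trans ?_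
  gcongr

/-! ### The Riesz representation of functionals on `H^{1,p}`, `1 < p ≤ 2` -/

lemma Hatb.ext {f g : Hatb n p μ} (h : f.1 =ᵐ[μ] g.1) : f = g :=
  Subtype.ext (AEEqFun.ext h)

lemma Hatb.enorm_eq (f : Hatb n p μ) : ‖f‖ₑ = atbENorm n p μ f.1 := by
  rw [← ofReal_norm]
  exact ENNReal.ofReal_toReal (ne_of_lt f.2)

/-- The class in `H^{1,p}` of a function of finite norm. -/
def toHatb (f : (Fin d → ℝ) → ℝ) (hm : AEStronglyMeasurable f μ) (hf : atbENorm n p μ f < ∞) :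
    Hatb n p μ :=
  ⟨AEEqFun.mk f hm, by
    change atbENorm n p μ _ < ∞
    rwa [atbENorm_congr (AEEqFun.coeFn_mk f hm)]⟩

lemma coeFn_toHatb {f : (Fin d → ℝ) → ℝ} (hm : AEStronglyMeasurable f μ)
    (hf : atbENorm n p μ f < ∞) : (toHatb f hm hf).1 =ᵐ[μ] f :=
  AEEqFun.coeFn_mk f hm

lemma exists_mem_support (hμ : μ ≠ 0) : ∃ x, x ∈ μ.support := by
  rw [← Set.Nonempty, nonempty_iff_ne_empty]
  intro h0
  have h2 := Measure.support_mem_ae (μ := μ)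
  rw [mem_ae_iff, h0, compl_empty] at h2
  exact hμ (Measure.measure_univ_eq_zero.1 h2)

/-- There is an increasing sequence of cubes that eventually contain any given cube. -/
lemma exists_exhaustion (hμ : μ ≠ 0) :
    ∃ S : ℕ → Cube μ, (∀ i j, i ≤ j → (S i).toSet ⊆ (S j).toSet) ∧
      ∀ R : Cube μ, ∃ k, R.toSet ⊆ (S k).toSet := by
  by_cases hfin : μ univ < ∞
  · exact ⟨fun _ => .whole hfin, fun _ _ _ => Subset.rfl, fun R => ⟨0, subset_univ _⟩⟩
  · obtain ⟨x, hx⟩ := exists_mem_support hμ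
    refine ⟨fun k => .cube x (2 * (k + 1)) hx (by positivity), fun i j hij => ?_, fun R => ?_⟩
    · refine Metric.closedBall_subset_closedBall ?_
      have : (i : ℝ) ≤ j := by exact_mod_cast hij
      linarith
    · cases R with
      | cube y s hy hs =>
        obtain ⟨k, hk⟩ := exists_nat_ge (s / 2 + dist y x)
        refine ⟨k, Metric.closedBall_subset_closedBall' ?_⟩
        linarith
      | whole h => exact absurd h hfin

lemma setIntegral_enorm_le [IsLocallyFiniteMeasure μ] (S : Cube μ) {φ : (Fin d → ℝ) → ℝ}
    (hφ : MemLp φ 2 μ) :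
    IntegrableOn φ S.toSet μ ∧
      ‖∫ x in S.toSet, φ x ∂μ‖ₑ ≤ eLpNorm φ 2 μ * μ S.toSet ^ (1 / 2 : ℝ) := by
  have : IsFiniteMeasure (μ.restrict S.toSet) := ⟨by simpa using S.measure_lt_top⟩
  have h1 : MemLp φ 2 (μ.restrict S.toSet) := hφ.restrict _
  have h2 := eLpNorm_le_eLpNorm_mul_rpow_measure_univ (p := 1) (q := 2) (by norm_num) h1.1
  refine ⟨h1.integrable (by norm_num), (enorm_integral_le_lintegral_enorm _).trans ?_⟩
  rw [← eLpNorm_one_eq_lintegral_enorm]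
  refine h2.trans (mul_le_mul' (eLpNorm_mono_measure _ Measure.restrict_le_self) (le_of_eq ?_))
  rw [Measure.restrict_apply_univ]
  norm_num

/-- Cutting off a square integrable function to a cube and restoring a vanishing integral by a
multiple of `ψ` is a bounded operator from `L²` to `H^{1,p}`, `p ≤ 2`. -/
lemma exists_cutoff (hn : 1 ≤ n) (hG : CubeGrowth n c μ) (hμ : μ ≠ 0) (hp1 : 1 ≤ p) (hp2 : p ≤ 2)
    (S : Cube μ) {ψ : (Fin d → ℝ) → ℝ} (hψ : MemLp ψ 2 μ) (hψs : Function.support ψ ⊆ S.toSet)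
    (hψint : Integrable ψ μ) (hψ1 : ∫ x, ψ x ∂μ = 1) :
    ∃ T : Lp ℝ 2 μ →L[ℝ] Hatb n p μ, ∀ φ : Lp ℝ 2 μ, (T φ).1 =ᵐ[μ]
      fun x => S.toSet.indicator φ x - (∫ y in S.toSet, φ y ∂μ) * ψ x := by
  have hloc := hG.isLocallyFiniteMeasure
  set V : ((Fin d → ℝ) → ℝ) → (Fin d → ℝ) → ℝ := fun φ x =>
    S.toSet.indicator φ x - (∫ y in S.toSet, φ y ∂μ) * ψ x with hV
  have hVm : ∀ φ : (Fin d → ℝ) → ℝ, MemLp φ 2 μ → MemLp (V φ) 2 μ := fun φ hφ =>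
    (hφ.indicator S.measurableSet).sub (hψ.const_mul _)
  set D : ℝ≥0∞ := 1 + μ S.toSet ^ (1 / 2 : ℝ) * eLpNorm ψ 2 μ with hD
  have hDtop : D ≠ ∞ := ENNReal.add_ne_top.2 ⟨ENNReal.one_ne_top, ENNReal.mul_ne_top
    (ENNReal.rpow_ne_top_of_nonneg (by norm_num) S.measure_lt_top.ne) hψ.2.ne⟩
  have ha0 := atomBound_ne_zero (p := 2) hn hG hμ S S
  have hat := atomBound_ne_top (n := n) (p := 2) hμ S S
  set D' : ℝ≥0 := (D / atomBound n 2 S S).toNNReal with hD'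
  have hD'eq : (D' : ℝ≥0∞) * atomBound n 2 S S = D := by
    rw [hD', ENNReal.coe_toNNReal (ENNReal.div_ne_top hDtop ha0), ENNReal.div_mul_cancel ha0 hat]
  have hbound : ∀ φ : (Fin d → ℝ) → ℝ, MemLp φ 2 μ →
      atbENorm n p μ (V φ) ≤ D' * eLpNorm φ 2 μ := by
    intro φ hφ
    obtain ⟨h1, h2⟩ := setIntegral_enorm_le S hφ
    have h3 : eLpNorm (V φ) 2 μ ≤ D * eLpNorm φ 2 μ := by
      refine (eLpNorm_sub_le (hφ.indicator S.measurableSet).1 (hψ.const_mul _).1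
        (by norm_num)).trans ?_
      rw [hD, add_mul, one_mul]
      refine add_le_add (eLpNorm_indicator_le _) ?_
      refine (eLpNorm_const_smul_le (c := ∫ y in S.toSet, φ y ∂μ) (f := ψ)).trans ?_
      calc _ ≤ (eLpNorm φ 2 μ * μ S.toSet ^ (1 / 2 : ℝ)) * eLpNorm ψ 2 μ := by gcongr
        _ = _ := by ring
    have h4 : atbENorm n 2 μ (V φ) ≤ ((D' * (eLpNorm φ 2 μ).toNNReal : ℝ≥0) : ℝ≥0∞) := by
      refine atbENorm_le_of_single_atom (R := S) (by norm_num) (hVm φ hφ).1 ?_ ?_ ?_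
      · intro x hx
        by_contra hxS
        refine hx ?_
        have : ψ x = 0 := by
          by_contra h
          exact hxS (hψs h)
        simp [hV, hxS, this]
      · refine h3.trans (le_of_eq ?_)
        push_cast
        rw [ENNReal.coe_toNNReal hφ.2.ne, ← hD'eq]
        ring
      · rw [hV, integral_sub ((integrable_indicator_iff S.measurableSet).2 h1)
          (hψint.const_mul _), integral_indicator S.measurableSet, integral_const_mul, hψ1, mul_one,
          sub_self]
    refine ((atbENorm_mono hp2 hp1 _).trans h4).trans (le_of_eq ?_)
    push_cast
    rw [ENNReal.coe_toNNReal hφ.2.ne]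
  have hfin : ∀ φ : (Fin d → ℝ) → ℝ, MemLp φ 2 μ → atbENorm n p μ (V φ) < ∞ := fun φ hφ =>
    (hbound φ hφ).trans_lt (ENNReal.mul_lt_top ENNReal.coe_lt_top hφ.2)
  set T₀ : Lp ℝ 2 μ → Hatb n p μ := fun φ =>
    toHatb (V φ) (hVm φ (Lp.memLp φ)).1 (hfin φ (Lp.memLp φ)) with hT₀
  have hT₀ae : ∀ φ, (T₀ φ).1 =ᵐ[μ] V φ := fun φ => coeFn_toHatb _ _
  have hcongr : ∀ {u v : (Fin d → ℝ) → ℝ}, u =ᵐ[μ] v → V u =ᵐ[μ] V v := by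
    intro u v h
    filter_upwards [h] with x hx
    simp only [hV]
    rw [setIntegral_congr_ae S.measurableSet (h.mono fun y hy _ => hy)]
    by_cases hxS : x ∈ S.toSet <;> simp [hxS, hx]
  have hadd : ∀ φ φ' : Lp ℝ 2 μ, T₀ (φ + φ') = T₀ φ + T₀ φ' := by
    intro φ φ'
    refine Hatb.ext ((hT₀ae _).trans ((hcongr (Lp.coeFn_add φ φ')).trans ?_))
    filter_upwards [hT₀ae φ, hT₀ae φ', AEEqFun.coeFn_add (T₀ φ).1 (T₀ φ').1] with x h1 h2 h3
    change _ = ((T₀ φ).1 + (T₀ φ').1 : (Fin d → ℝ) →ₘ[μ] ℝ) x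
    rw [h3, Pi.add_apply, h1, h2]
    simp only [hV, Pi.add_apply]
    rw [integral_add (setIntegral_enorm_le S (Lp.memLp φ)).1 (setIntegral_enorm_le S
      (Lp.memLp φ')).1, indicator_add']
    simp only [Pi.add_apply]
    ring
  have hsmul : ∀ (t : ℝ) (φ : Lp ℝ 2 μ), T₀ (t • φ) = t • T₀ φ := by
    intro t φ
    refine Hatb.ext ((hT₀ae _).trans ((hcongr (Lp.coeFn_smul t φ)).trans ?_))
    filter_upwards [hT₀ae φ, AEEqFun.coeFn_smul t (T₀ φ).1] with x h1 h3
    change _ = (t • (T₀ φ).1 : (Fin d → ℝ) →ₘ[μ] ℝ) x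
    rw [h3, Pi.smul_apply, h1]
    simp only [hV, Pi.smul_apply, smul_eq_mul]
    rw [integral_const_mul]
    by_cases hxS : x ∈ S.toSet <;> simp [hxS] <;> ring
  refine ⟨LinearMap.mkContinuous ⟨⟨T₀, hadd⟩, hsmul⟩ D' fun φ => ?_, hT₀ae⟩
  change (atbENorm n p μ (T₀ φ).1).toReal ≤ D' * ‖φ‖
  rw [atbENorm_congr (hT₀ae φ), Lp.norm_def, ← ENNReal.coe_toReal, ← ENNReal.toReal_mul]
  exact ENNReal.toReal_mono (ENNReal.mul_ne_top ENNReal.coe_ne_top (Lp.memLp φ).2.ne)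
    (hbound φ (Lp.memLp φ))

/-- A continuous functional on `H^{1,p}`, `1 < p ≤ 2`, is given on the square integrable functions
supported in a cube by integration against a function that is locally in `L²`: apply the Riesz
representation theorem on an increasing sequence of cubes. -/
lemma exists_representation (hn : 1 ≤ n) (hG : CubeGrowth n c μ) (hμ : μ ≠ 0) (hp1 : 1 < p)
    (hp2 : p ≤ 2) (ℓ : StrongDual ℝ (Hatb n p μ)) :
    ∃ g : (Fin d → ℝ) → ℝ, (∀ Q : Cube μ, MemLp g 2 (μ.restrict Q.toSet)) ∧
      ∀ (f : Hatb n p μ) (R : Cube μ), MemLp f.1 2 μ → (∀ᵐ x ∂μ, x ∉ R.toSet → f.1 x = 0) →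
        ℓ f = ∫ x, f.1 x * g x ∂μ := by
  have hloc := hG.isLocallyFiniteMeasure
  obtain ⟨S, hSmono, hSR⟩ := exists_exhaustion hμ
  have hreal : μ.real (S 0).toSet ≠ 0 := by
    rw [measureReal_def, ENNReal.toReal_ne_zero]
    exact ⟨((S 0).measure_pos hμ).ne', (S 0).measure_lt_top.ne⟩
  set ψ : (Fin d → ℝ) → ℝ := (S 0).toSet.indicator fun _ => (μ.real (S 0).toSet)⁻¹ with hψ
  have hψ1 : ∫ x, ψ x ∂μ = 1 := by
    rw [hψ, integral_indicator (S 0).measurableSet, setIntegral_const, smul_eq_mul,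
      mul_inv_cancel₀ hreal]
  have hψm : ∀ s : ℝ≥0∞, MemLp ψ s μ := fun s =>
    memLp_indicator_const s (S 0).measurableSet _ (Or.inr (S 0).measure_lt_top.ne)
  have hψs : Function.support ψ ⊆ (S 0).toSet := Set.support_indicator_subset
  choose T hT using fun k => exists_cutoff hn hG hμ hp1.le hp2 (S k) (hψm 2)
    (hψs.trans (hSmono 0 k (Nat.zero_le k))) (memLp_one_iff_integrable.1 (hψm 1)) hψ1
  set h : ℕ → Lp ℝ 2 μ := fun k => (InnerProductSpace.toDual ℝ (Lp ℝ 2 μ)).symm (ℓ.comp (T k))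
    with hh
  have hinner : ∀ k φ, ∫ x, φ x * h k x ∂μ = ℓ (T k φ) := by
    intro k φ
    have h1 : inner ℝ (h k) φ = ℓ (T k φ) := InnerProductSpace.toDual_symm_apply
    rw [← h1, L2.inner_def]
    rfl
  -- the representing functions are consistent
  have hcons : ∀ k K, k ≤ K → ∀ᵐ x ∂μ, x ∈ (S k).toSet → h k x = h K x := by
    intro k K hkK
    have hmem : MemLp ((S k).toSet.indicator (h K)) 2 μ :=
      (Lp.memLp (h K)).indicator (S k).measurableSet
    have heq : h k = hmem.toLp _ := by
      refine ext_inner_right ℝ fun φ => ?_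
      have hφ : MemLp ((S k).toSet.indicator φ) 2 μ :=
        (Lp.memLp φ).indicator (S k).measurableSet
      have h1 : inner ℝ (h k) φ = ℓ (T k φ) := InnerProductSpace.toDual_symm_apply
      have h2 : T k φ = T K (hφ.toLp _) := by
        refine Hatb.ext ((hT k φ).trans (EventuallyEq.trans ?_ (hT K _).symm))
        filter_upwards [hφ.coeFn_toLp] with x hx
        have e1 : ∫ y in (S K).toSet, hφ.toLp _ y ∂μ = ∫ y in (S k).toSet, φ y ∂μ := by
          rw [setIntegral_congr_ae (g := (S k).toSet.indicator φ) (S K).measurableSet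
            (hφ.coeFn_toLp.mono fun y hy _ => hy), setIntegral_indicator (S k).measurableSet,
            inter_eq_self_of_subset_right (hSmono k K hkK)]
        rw [e1]
        congr 1
        by_cases hxk : x ∈ (S k).toSet
        · rw [indicator_of_mem hxk, indicator_of_mem (hSmono k K hkK hxk), hx,
            indicator_of_mem hxk]
        · rw [indicator_of_notMem hxk]
          by_cases hxK : x ∈ (S K).toSet
          · rw [indicator_of_mem hxK, hx, indicator_of_notMem hxk]
          · rw [indicator_of_notMem hxK]
      rw [h1, h2, ← hinner, L2.inner_def]
      refine integral_congr_ae ?_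
      filter_upwards [hφ.coeFn_toLp, hmem.coeFn_toLp] with x hx1 hx2
      rw [hx1, hx2]
      by_cases hxk : x ∈ (S k).toSet <;> simp [hxk, mul_comm]
    rw [heq]
    filter_upwards [hmem.coeFn_toLp] with x hx hxk
    rw [hx, indicator_of_mem hxk]
  set g : (Fin d → ℝ) → ℝ := fun x => h (sInf {k | x ∈ (S k).toSet}) x with hg
  have hgh : ∀ K, ∀ᵐ x ∂μ, x ∈ (S K).toSet → g x = h K x := by
    intro K
    have : ∀ᵐ x ∂μ, ∀ k, k ≤ K → x ∈ (S k).toSet → h k x = h K x := by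
      rw [ae_all_iff]
      intro k
      by_cases hk : k ≤ K
      · filter_upwards [hcons k K hk] with x hx _ using hx
      · exact Eventually.of_forall fun x h => absurd h hk
    filter_upwards [this] with x hx hxK
    exact hx _ (Nat.sInf_le hxK) (Nat.sInf_mem (s := {k | x ∈ (S k).toSet}) ⟨K, hxK⟩)
  refine ⟨g, fun Q => ?_, fun f R hf hfR => ?_⟩
  · obtain ⟨K, hK⟩ := hSR Q
    refine ((Lp.memLp (h K)).restrict Q.toSet).ae_eq ?_
    rw [EventuallyEq, ae_restrict_iff' Q.measurableSet]
    filter_upwards [hgh K] with x hx hxQ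
    exact (hx (hK hxQ)).symm
  · obtain ⟨K, hK⟩ := hSR R
    have hf0 : ∫ x, f.1 x ∂μ = 0 := integral_eq_zero_of_atbENorm_lt_top hp1 f.2
    have h1 : f = T K (hf.toLp _) := by
      refine Hatb.ext (EventuallyEq.trans ?_ (hT K _).symm)
      have e1 : ∫ y in (S K).toSet, hf.toLp _ y ∂μ = 0 := by
        rw [setIntegral_congr_ae (g := f.1) (S K).measurableSet
          (hf.coeFn_toLp.mono fun y hy _ => hy), ← hf0]
        refine setIntegral_eq_integral_of_ae_compl_eq_zero ?_
        filter_upwards [hfR] with x hx hxK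
        exact hx fun hxR => hxK (hK hxR)
      filter_upwards [hf.coeFn_toLp, hfR] with x hx hxR
      rw [e1, zero_mul, sub_zero]
      by_cases hxK : x ∈ (S K).toSet
      · rw [indicator_of_mem hxK, hx]
      · rw [indicator_of_notMem hxK, hxR fun h => hxK (hK h)]
    rw [h1, ← hinner, ← h1]
    refine integral_congr_ae ?_
    filter_upwards [hf.coeFn_toLp, hfR, hgh K] with x hx hxR hxg
    rw [hx]
    by_cases hxK : x ∈ (S K).toSet
    · rw [hxg hxK]
    · rw [hxR fun h => hxK (hK h), zero_mul, zero_mul]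

/-! ### The dual of `H^{1,p}`, `1 < p ≤ 2` -/

lemma locallyIntegrable_of_cubes (hμ : μ ≠ 0) {g : (Fin d → ℝ) → ℝ}
    (h : ∀ Q : Cube μ, IntegrableOn g Q.toSet μ) : LocallyIntegrable g μ := by
  obtain ⟨x₀, hx₀⟩ := exists_mem_support hμ
  intro x
  refine ⟨Metric.closedBall x₀ (2 * (dist x x₀ + 1) / 2), Metric.closedBall_mem_nhds_of_mem ?_,
    h (.cube x₀ (2 * (dist x x₀ + 1)) hx₀ (by positivity))⟩
  rw [Metric.mem_ball]
  linarith

/-- The constant relating the norm of a functional, tested on bounded blocks, to the `RBMO` norm of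
the function representing it. -/
def testConst (d : ℕ) (c : ℝ≥0) : ℝ≥0 := 1 + 2 * c + 2 ^ (d + 1) + 2 ^ (d + 1)

/-- A function whose pairing with bounded mean zero functions supported in a cube is controlled by
the norm of `H^{1,∞}` belongs to `RBMO`. -/
lemma isRBMOWith_of_test (hn : 1 ≤ n) (hnd : n ≤ d) (hG : CubeGrowth n c μ) (hμ : μ ≠ 0)
    {g : (Fin d → ℝ) → ℝ} {M : ℝ≥0} (hg : ∀ Q : Cube μ, IntegrableOn g Q.toSet μ)
    (hT : ∀ (f : (Fin d → ℝ) → ℝ) (R : Cube μ), MemLp f ∞ μ → Function.support f ⊆ R.toSet →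
      ∫ x, f x ∂μ = 0 → ‖∫ x, f x * g x ∂μ‖ₑ ≤ M * atbENorm n ∞ μ f) :
    IsRBMOWith n μ (M * testConst d c) g where
  locInt := locallyIntegrable_of_cubes hμ hg
  osc Q := by
    refine (lintegral_sub_average_tilde_le hn hnd hG hμ Q (hg _) fun f => hT f _).trans ?_
    rw [testConst]
    push_cast
    exact mul_le_mul_left (mul_le_mul_right le_self_add _) _
  reg Q R hQ hR hQR := by
    refine (enorm_average_sub_average_le hn hG hμ hQ hR hQR (hg _) fun f => hT f _).trans ?_
    rw [testConst]
    push_cast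
    gcongr
    exact le_add_self

lemma memLp_of_memLp_top_of_support [IsLocallyFiniteMeasure μ] {f : (Fin d → ℝ) → ℝ} {R : Cube μ}
    (hf : MemLp f ∞ μ) (hR : Function.support f ⊆ R.toSet) (s : ℝ≥0∞) : MemLp f s μ := by
  refine hf.mono_exponent_of_measure_support_ne_top (s := R.toSet) (fun x hx => ?_)
    R.measure_lt_top.ne le_top
  by_contra h
  exact hx (hR h)

lemma atbENorm_lt_top_of_support (hn : 1 ≤ n) (hG : CubeGrowth n c μ) (hμ : μ ≠ 0)
    {f : (Fin d → ℝ) → ℝ} {R : Cube μ} (hf : MemLp f ∞ μ) (hR : Function.support f ⊆ R.toSet)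
    (h0 : ∫ x, f x ∂μ = 0) : atbENorm n ∞ μ f < ∞ := by
  have hloc := hG.isLocallyFiniteMeasure
  have h1 := atomBound_ne_zero (p := ∞) hn hG hμ R R
  have h2 := atomBound_ne_top (n := n) (p := ∞) hμ R R
  refine (atbENorm_le_of_single_atom (t := (eLpNorm f ∞ μ / atomBound n ∞ R R).toNNReal)
    ENNReal.one_lt_top hf.1 hR ?_ h0).trans_lt ENNReal.coe_lt_top
  rw [ENNReal.coe_toNNReal (ENNReal.div_ne_top hf.2.ne h1), ENNReal.div_mul_cancel h1 h2]

/-- A functional on `H^{1,p}`, `1 < p ≤ 2`, that is bounded by `M` times the norm of `H^{1,∞}` is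
represented by a function of `RBMO` norm at most a constant times `M`. -/
lemma exists_rbmo_representation (hn : 1 ≤ n) (hnd : n ≤ d) (hG : CubeGrowth n c μ) (hμ : μ ≠ 0)
    (hp1 : 1 < p) (hp2 : p ≤ 2) (ℓ : StrongDual ℝ (Hatb n p μ)) {M : ℝ≥0}
    (hM : ∀ f : Hatb n p μ, ‖ℓ f‖ₑ ≤ M * atbENorm n ∞ μ f.1) :
    ∃ g : (Fin d → ℝ) → ℝ, IsRBMOWith n μ (M * testConst d c) g ∧
      ∀ (f : Hatb n p μ) (R : Cube μ), MemLp f.1 2 μ → (∀ᵐ x ∂μ, x ∉ R.toSet → f.1 x = 0) →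
        ℓ f = ∫ x, f.1 x * g x ∂μ := by
  have hloc := hG.isLocallyFiniteMeasure
  obtain ⟨g, hg, hrep⟩ := exists_representation hn hG hμ hp1 hp2 ℓ
  refine ⟨g, isRBMOWith_of_test hn hnd hG hμ (fun Q => ?_) fun f R hf hR h0 => ?_, hrep⟩
  · have : IsFiniteMeasure (μ.restrict Q.toSet) := ⟨by simpa using Q.measure_lt_top⟩
    exact (hg Q).integrable (by norm_num)
  · have hfin : atbENorm n p μ f < ∞ :=
      (atbENorm_mono le_top hp1.le f).trans_lt (atbENorm_lt_top_of_support hn hG hμ hf hR h0)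
    have hae := coeFn_toHatb hf.1 hfin
    have h1 := hrep (toHatb f hf.1 hfin) R
      ((memLp_of_memLp_top_of_support hf hR 2).ae_eq hae.symm) (by
        filter_upwards [hae] with x hx hxR
        rw [hx]
        by_contra h
        exact hxR (hR h))
    have h2 := hM (toHatb f hf.1 hfin)
    rw [h1, atbENorm_congr hae] at h2
    refine le_trans (le_of_eq ?_) h2
    congr 1
    refine integral_congr_ae ?_
    filter_upwards [hae] with x hx
    rw [hx]

lemma IsBoundedCompSupp.memLp_two [IsLocallyFiniteMeasure μ] {f : (Fin d → ℝ) → ℝ}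
    (hf : IsBoundedCompSupp μ f) : MemLp f 2 μ := by
  obtain ⟨h1, S, hS, h2⟩ := hf
  have h3 : MemLp (S.indicator f) ∞ μ := h1.indicator hS.measurableSet
  have h4 : MemLp (S.indicator f) 2 μ :=
    h3.mono_exponent_of_measure_support_ne_top (s := S) (fun x hx => indicator_of_notMem hx _)
      hS.measure_lt_top.ne le_top
  refine h4.ae_eq ?_
  filter_upwards [h2] with x hx
  by_cases hxS : x ∈ S
  · rw [indicator_of_mem hxS]
  · rw [indicator_of_notMem hxS, hx hxS]

lemma enorm_apply_le (ℓ : StrongDual ℝ (Hatb n p μ)) (f : Hatb n p μ) :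
    ‖ℓ f‖ₑ ≤ ‖ℓ‖ₑ * atbENorm n p μ f.1 := by
  rw [← Hatb.enorm_eq]
  exact ℓ.le_opENorm f

/-- On the functionals on `H^{1,p}`, `1 < p ≤ 2`, the norm of the dual of `H^{1,p}` is controlled
by the norm of the dual of `H^{1,∞}`: the `RBMO` function representing the functional is paired with
the blocks by the John-Nirenberg inequality. -/
lemma exists_dual_bound (d n : ℕ) (hn : 1 ≤ n) (hnd : n ≤ d) (c : ℝ≥0) (hp1 : 1 < p)
    (hp2 : p ≤ 2) :
    ∃ K : ℝ≥0, ∀ μ : Measure (Fin d → ℝ), CubeGrowth n c μ → μ ≠ 0 →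
      ∀ (ℓ : StrongDual ℝ (Hatb n p μ)) (M : ℝ≥0),
        (∀ f : Hatb n p μ, ‖ℓ f‖ₑ ≤ M * atbENorm n ∞ μ f.1) →
        ∀ f : Hatb n p μ, ‖ℓ f‖ₑ ≤ K * M * atbENorm n p μ f.1 := by
  have hpq := ENNReal.HolderConjugate.conjExponent hp1.le
  set q := p.conjExponent
  have hp' : p ≠ ∞ := ne_top_of_le_ne_top (by norm_num) hp2
  obtain ⟨hq1, hq2⟩ := one_lt_conj (q := q) hp1
  obtain ⟨C, hC⟩ := exists_johnNirenberg d n hn hnd c hq1 hq2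
  refine ⟨(C + 1) * (testConst d c * tildeConst n c), fun μ hG hμ ℓ M hM f => ?_⟩
  have hloc := hG.isLocallyFiniteMeasure
  obtain ⟨g, hg, hrep⟩ := exists_rbmo_representation hn hnd hG hμ hp1 hp2 ℓ hM
  have hosc := hg.oscData (hn.trans hnd) hnd hG
  have hpair := fun (B : AtomicBlock n p μ) => B.enorm_integral_mul_le (q := q) hp1 hosc
    (hC μ hG _ _ _ hosc)
  set A : ℝ≥0 := M * testConst d c * tildeConst n c with hA
  set K : ℝ≥0 := (C + 1) * A with hK
  have hKe : ((C : ℝ≥0∞) + 1) * A = K := by rw [hK]; push_cast; rfl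
  have hBfin : ∀ B : AtomicBlock n p μ, B.size ≠ ∞ → atbENorm n p μ B.b < ∞ := fun B hB =>
    B.atbENorm_le.trans_lt hB.lt_top
  -- the representation holds for square integrable functions only, hence the approximation of the
  -- block
  have hblock : ∀ (B : AtomicBlock n p μ) (hB : B.size ≠ ∞),
      ‖ℓ (toHatb B.b B.integrable.aestronglyMeasurable (hBfin B hB))‖ₑ ≤ K * B.size := by
    intro B hB
    refine ENNReal.le_of_forall_pos_le_add fun ε hε _ => ?_
    set η : ℝ≥0 := ε / (‖ℓ‖₊ + K + 1) with hη
    have hηpos : η ≠ 0 := (div_pos hε (by positivity)).ne'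
    obtain ⟨B', hR, hB', hv⟩ := B.exists_approx hn hG hμ hp1 hp' hB
      (η := η) (ENNReal.coe_ne_zero.2 hηpos)
    have hB't : B'.size ≠ ∞ := ne_top_of_le_ne_top ENNReal.coe_ne_top hB'
    set F := toHatb B.b B.integrable.aestronglyMeasurable (hBfin B hB) with hF
    set F' := toHatb B'.b B'.integrable.aestronglyMeasurable (hBfin B' hB't) with hF'
    have hsub : (F - F').1 =ᵐ[μ] fun x => B.b x - B'.b x := by
      filter_upwards [AEEqFun.coeFn_sub F.1 F'.1, coeFn_toHatb _ (hBfin B hB),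
        coeFn_toHatb _ (hBfin B' hB't)] with x h1 h2 h3
      change (F.1 - F'.1 : (Fin d → ℝ) →ₘ[μ] ℝ) x = _
      rw [h1, Pi.sub_apply, h2, h3]
    have h1 := hrep (F - F') B.R (hv.memLp_two.ae_eq hsub.symm) (by
      filter_upwards [hsub] with x hx hxR
      have e1 : B.b x = 0 := by
        by_contra h
        exact hxR (B.support_b h)
      have e2 : B'.b x = 0 := by
        by_contra h
        exact hxR (hR ▸ B'.support_b h)
      rw [hx, e1, e2, sub_zero])
    have h2 : ∫ x, (F - F').1 x * g x ∂μ = (∫ x, B.b x * g x ∂μ) - ∫ x, B'.b x * g x ∂μ := by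
      rw [← integral_sub (hpair B hB).1 (hpair B' hB't).1]
      refine integral_congr_ae ?_
      filter_upwards [hsub] with x hx
      rw [hx, sub_mul]
    rw [h2, map_sub] at h1
    have h3 : ℓ F = (∫ x, B.b x * g x ∂μ) + (ℓ F' - ∫ x, B'.b x * g x ∂μ) := by linarith
    have h4 : ‖ℓ F'‖ₑ ≤ ‖ℓ‖ₑ * η := by
      refine (enorm_apply_le ℓ F').trans ?_
      rw [atbENorm_congr (coeFn_toHatb _ (hBfin B' hB't))]
      gcongr
      exact B'.atbENorm_le.trans hB'
    have h5 : ‖∫ x, B'.b x * g x ∂μ‖ₑ ≤ K * η := by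
      refine (hpair B' hB't).2.trans ?_
      rw [hKe]
      gcongr
    have h6 : ‖∫ x, B.b x * g x ∂μ‖ₑ ≤ K * B.size := by
      rw [← hKe]
      exact (hpair B hB).2
    have h7 : ‖ℓ‖ₑ * η + K * η ≤ (ε : ℝ≥0∞) := by
      rw [enorm_eq_nnnorm]
      norm_cast
      rw [← add_mul, hη, mul_div_assoc', div_le_iff₀ (by positivity), mul_comm ε]
      exact mul_le_mul_left le_self_add _
    rw [h3]
    refine (enorm_add_le _ _).trans (add_le_add h6 ((enorm_sub_le).trans ?_))
    exact (add_le_add h4 h5).trans h7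
  have hfin : ∀ (B : ℕ → AtomicBlock n p μ), (∀ᵐ x ∂μ, HasSum (fun i => (B i).b x) (f.1 x)) →
      ∑' i, (B i).size < ∞ → ‖ℓ f‖ₑ ≤ K * ∑' i, (B i).size := by
    intro B hB hsize
    have hBi : ∀ i, (B i).size ≠ ∞ := ENNReal.ne_top_of_tsum_ne_top hsize.ne
    have hpart : ∀ I : ℕ, ∃ F : Hatb n p μ, (F.1 =ᵐ[μ] fun x => ∑ i ∈ Finset.range I, (B i).b x) ∧
        ‖ℓ F‖ₑ ≤ K * ∑ i ∈ Finset.range I, (B i).size := by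
      intro I
      induction I with
      | zero => exact ⟨0, by simpa using! AEEqFun.coeFn_zero, by simp⟩
      | succ I ih =>
        obtain ⟨F, hF1, hF2⟩ := ih
        set F' := toHatb (B I).b (B I).integrable.aestronglyMeasurable (hBfin (B I) (hBi I))
        refine ⟨F + F', ?_, ?_⟩
        · filter_upwards [hF1, AEEqFun.coeFn_add F.1 F'.1,
            coeFn_toHatb _ (hBfin (B I) (hBi I))] with x h1 h2 h3
          change (F.1 + F'.1 : (Fin d → ℝ) →ₘ[μ] ℝ) x = _
          rw [h2, Pi.add_apply, h1, h3, Finset.sum_range_succ]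
        · rw [map_add, Finset.sum_range_succ, mul_add]
          exact (enorm_add_le _ _).trans (add_le_add hF2 (hblock _ (hBi I)))
    have hle : ∀ I : ℕ, ‖ℓ f‖ₑ ≤ K * (∑' i, (B i).size) + ‖ℓ‖ₑ * ∑' k, (B (k + I)).size := by
      intro I
      obtain ⟨F, hF1, hF2⟩ := hpart I
      have h1 : atbENorm n p μ (f - F).1 ≤ ∑' k, (B (k + I)).size := by
        refine atbENorm_le_tsum_size (fun k => B (k + I)) ?_
        filter_upwards [hB, hF1, AEEqFun.coeFn_sub f.1 F.1] with x h1 h2 h3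
        change HasSum _ ((f.1 - F.1 : (Fin d → ℝ) →ₘ[μ] ℝ) x)
        rw [h3, Pi.sub_apply, h2]
        exact (hasSum_nat_add_iff' I).2 h1
      have h2 : ℓ f = ℓ F + ℓ (f - F) := by rw [← map_add]; congr 1; abel
      rw [h2]
      refine (enorm_add_le _ _).trans (add_le_add (hF2.trans ?_) ((enorm_apply_le _ _).trans ?_))
      · gcongr
        exact ENNReal.sum_le_tsum _
      · gcongr
    have hlim : Tendsto (fun I : ℕ => K * (∑' i, (B i).size) + ‖ℓ‖ₑ * ∑' k, (B (k + I)).size) atTop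
        (𝓝 (K * (∑' i, (B i).size) + ‖ℓ‖ₑ * 0)) :=
      (ENNReal.Tendsto.const_mul (ENNReal.tendsto_sum_nat_add _ hsize.ne)
        (Or.inr enorm_ne_top)).const_add _
    rw [mul_zero, add_zero] at hlim
    exact ge_of_tendsto' hlim hle
  have hKM : (((C + 1) * (testConst d c * tildeConst n c) : ℝ≥0) : ℝ≥0∞) * M = K := by
    rw [hK, hA]; push_cast; ring
  rw [hKM]
  refine ENNReal.le_of_forall_pos_le_add fun ε hε _ => ?_
  obtain ⟨B, hB1, hB2⟩ := exists_decomposition (f := f.1) (n := n) (p := p)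
    (t := atbENorm n p μ f.1 + (ε / (K + 1) : ℝ≥0)) (ENNReal.lt_add_right (ne_of_lt f.2)
      (ENNReal.coe_ne_zero.2 (div_pos hε (by positivity)).ne'))
  refine (hfin B hB1 (hB2.trans (ENNReal.add_lt_top.2 ⟨f.2, ENNReal.coe_lt_top⟩))).trans ?_
  calc (K : ℝ≥0∞) * ∑' i, (B i).size
      ≤ K * (atbENorm n p μ f.1 + (ε / (K + 1) : ℝ≥0)) := by gcongr
    _ = K * atbENorm n p μ f.1 + ((K * (ε / (K + 1)) : ℝ≥0) : ℝ≥0∞) := by push_cast; ring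
    _ ≤ _ := by
      gcongr
      rw [mul_div_assoc', div_le_iff₀ (by positivity), mul_comm ε]
      gcongr
      exact le_self_add

/-! ### Equivalence of the norms of `H^{1,p}` and `H^{1,∞}` -/

/-- By the Hahn-Banach theorem, the bound of `exists_dual_bound` on functionals shows that the unit
ball of `H^{1,p}`, `1 < p ≤ 2`, lies in the closure of a ball of `H^{1,∞}`. -/
lemma exists_approx_top (d n : ℕ) (hn : 1 ≤ n) (hnd : n ≤ d) (c : ℝ≥0) (hp1 : 1 < p)
    (hp2 : p ≤ 2) :
    ∃ K : ℝ≥0, 1 ≤ K ∧ ∀ μ : Measure (Fin d → ℝ), CubeGrowth n c μ → μ ≠ 0 →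
      ∀ f : Hatb n p μ, ∃ h : Hatb n p μ, atbENorm n ∞ μ h.1 ≤ K * ‖f‖ₑ ∧
        ‖f - h‖ₑ ≤ 2⁻¹ * ‖f‖ₑ := by
  obtain ⟨K, hK⟩ := exists_dual_bound d n hn hnd c hp1 hp2
  refine ⟨K + 1, le_add_self, fun μ hG hμ f => ?_⟩
  by_cases hf0 : ‖f‖ = 0
  · refine ⟨0, ?_, ?_⟩
    · have : atbENorm n ∞ μ (0 : Hatb n p μ).1 = 0 := by
        rw [← atbENorm_zero (n := n) (p := ∞) (μ := μ)]
        exact atbENorm_congr AEEqFun.coeFn_zero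
      rw [this]
      exact zero_le
    · rw [sub_zero, ← ofReal_norm, hf0]
      simp
  have hfpos : 0 < ‖f‖ := lt_of_le_of_ne (norm_nonneg f) (Ne.symm hf0)
  have hsmul : ∀ (t : ℝ) (a : Hatb n p μ),
      atbENorm n ∞ μ (t • a).1 = ‖t‖ₑ * atbENorm n ∞ μ a.1 := by
    intro t a
    rw [← atbENorm_smul]
    exact atbENorm_congr (AEEqFun.coeFn_smul t a.1)
  have hadd : ∀ a b : Hatb n p μ,
      atbENorm n ∞ μ (a + b).1 ≤ atbENorm n ∞ μ a.1 + atbENorm n ∞ μ b.1 := by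
    intro a b
    refine le_trans (le_of_eq ?_) (atbENorm_add _ _)
    exact atbENorm_congr (AEEqFun.coeFn_add a.1 b.1)
  set s : Set (Hatb n p μ) := {a | atbENorm n ∞ μ a.1 ≤ (K + 1 : ℝ≥0)} with hs
  have hconv : Convex ℝ s := by
    intro a ha b hb t t' ht ht' htt
    change atbENorm n ∞ μ (t • a + t' • b).1 ≤ _
    refine (hadd _ _).trans ?_
    rw [hsmul, hsmul, Real.enorm_eq_ofReal ht, Real.enorm_eq_ofReal ht']
    calc _ ≤ ENNReal.ofReal t * (K + 1 : ℝ≥0) + ENNReal.ofReal t' * (K + 1 : ℝ≥0) :=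
          add_le_add (mul_le_mul_right ha _) (mul_le_mul_right hb _)
      _ = _ := by rw [← add_mul, ← ENNReal.ofReal_add ht ht', htt, ENNReal.ofReal_one, one_mul]
  set f' := ‖f‖⁻¹ • f with hf'
  have hf'1 : ‖f'‖ = 1 := by
    rw [hf', norm_smul, norm_inv, norm_norm, inv_mul_cancel₀ hf0]
  have hcl : f' ∈ closure s := by
    by_contra hcon
    obtain ⟨ℓ, u, hu1, hu2⟩ := geometric_hahn_banach_closed_point hconv.closure isClosed_closure hcon
    have hlt : ∀ a ∈ s, ℓ a < u := fun a ha => hu1 a (subset_closure ha)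
    have hupos : 0 < u := by
      have h0 : (0 : Hatb n p μ) ∈ s := by
        have h1 := hsmul 0 0
        rw [zero_smul, enorm_zero, zero_mul] at h1
        change atbENorm n ∞ μ (0 : Hatb n p μ).1 ≤ _
        rw [h1]
        exact zero_le
      simpa using hlt 0 h0
    -- as `ℓ < u` on `s`, the functional is bounded by `M = u / (K + 1)` times the norm of `H^{1,∞}`;
    -- hence `ℓ f' ≤ K * M < u`, a contradiction
    set M : ℝ≥0 := u.toNNReal / (K + 1) with hM
    have hMr : (M : ℝ) = u / (K + 1) := by
      rw [hM, NNReal.coe_div, Real.coe_toNNReal _ hupos.le]; push_cast; rfl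
    have hMne : M ≠ 0 := (div_pos (Real.toNNReal_pos.2 hupos) (by positivity)).ne'
    have hbd : ∀ a : Hatb n p μ, ‖ℓ a‖ₑ ≤ M * atbENorm n ∞ μ a.1 := by
      intro a
      rcases eq_or_ne (atbENorm n ∞ μ a.1) ∞ with htop | htop
      · rw [htop, ENNReal.mul_top (ENNReal.coe_ne_zero.2 hMne)]
        exact le_top
      set T := (atbENorm n ∞ μ a.1).toReal with hT
      have hT0 : 0 ≤ T := ENNReal.toReal_nonneg
      have key : ∀ ε : ℝ, 0 < ε → |ℓ a| ≤ M * (T + ε) := by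
        intro ε hε
        have ht : 0 < T + ε := by positivity
        have hmem : ∀ σ : ℝ, |σ| = 1 → (σ * ((K + 1) / (T + ε))) • a ∈ s := by
          intro σ hσ
          change atbENorm n ∞ μ _ ≤ _
          rw [hsmul, ← ENNReal.ofReal_toReal htop, ← hT, ← ofReal_norm, Real.norm_eq_abs, abs_mul,
            hσ, one_mul, abs_of_nonneg (by positivity), ← ENNReal.ofReal_mul (by positivity),
            ← ENNReal.ofReal_coe_nnreal]
          refine ENNReal.ofReal_le_ofReal ?_
          rw [div_mul_eq_mul_div, div_le_iff₀ ht]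
          push_cast
          have : (0 : ℝ) ≤ (K + 1) * ε := by positivity
          nlinarith
        have h1 := hlt _ (hmem 1 (by simp))
        have h2 := hlt _ (hmem (-1) (by simp))
        rw [map_smul, smul_eq_mul] at h1 h2
        rw [hMr, div_mul_eq_mul_div, le_div_iff₀ (by positivity), abs_eq_max_neg]
        rw [one_mul, div_mul_eq_mul_div, div_lt_iff₀ ht] at h1
        rw [neg_one_mul, neg_mul, div_mul_eq_mul_div, ← neg_div, div_lt_iff₀ ht] at h2
        rcases max_cases (ℓ a) (-ℓ a) with h | h <;> rw [h.1] <;> nlinarith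
      have h3 : |ℓ a| ≤ M * T := by
        refine le_of_forall_pos_le_add fun ε hε => ?_
        have hMpos : (0 : ℝ) < M := by exact_mod_cast pos_iff_ne_zero.2 hMne
        have := key (ε / M) (div_pos hε hMpos)
        rwa [mul_add, mul_div_cancel₀ _ hMpos.ne'] at this
      rw [← ofReal_norm, Real.norm_eq_abs, ← ENNReal.ofReal_toReal htop, ← hT,
        ← ENNReal.ofReal_coe_nnreal, ← ENNReal.ofReal_mul M.coe_nonneg]
      exact ENNReal.ofReal_le_ofReal h3
    have h4 := hK μ hG hμ ℓ M hbd f'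
    rw [← Hatb.enorm_eq, ← ofReal_norm f', hf'1, ENNReal.ofReal_one, mul_one, ← ofReal_norm,
      ← ENNReal.coe_mul, ← ENNReal.ofReal_coe_nnreal, ENNReal.ofReal_le_ofReal_iff (by positivity),
      NNReal.coe_mul, hMr] at h4
    have h5 := (le_abs_self (ℓ f')).trans h4
    have h6 : (K : ℝ) * (u / (K + 1)) ≤ u := by
      rw [mul_div_assoc', div_le_iff₀ (by positivity)]
      nlinarith
    linarith
  obtain ⟨a, ha, hdist⟩ := Metric.mem_closure_iff.1 hcl (1 / 2) (by norm_num)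
  refine ⟨‖f‖ • a, ?_, ?_⟩
  · rw [hsmul, enorm_norm, mul_comm]
    exact mul_le_mul_left ha _
  · have h1 : f - ‖f‖ • a = ‖f‖ • (f' - a) := by
      rw [smul_sub, hf', smul_smul, mul_inv_cancel₀ hf0, one_smul]
    rw [h1, enorm_smul, enorm_norm, mul_comm]
    refine mul_le_mul_left ?_ _
    rw [dist_eq_norm] at hdist
    rw [← ofReal_norm]
    refine (ENNReal.ofReal_le_ofReal hdist.le).trans (le_of_eq ?_)
    rw [one_div, ENNReal.ofReal_inv_of_pos (by norm_num)]
    norm_num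

lemma ae_summable_of_tsum_lintegral {h : ℕ → (Fin d → ℝ) → ℝ}
    (hm : ∀ k, AEStronglyMeasurable (h k) μ) (hs : ∑' k, ∫⁻ x, ‖h k x‖ₑ ∂μ ≠ ∞) :
    ∀ᵐ x ∂μ, Summable fun k => h k x := by
  have h1 : ∫⁻ x, ∑' k, ‖h k x‖ₑ ∂μ ≠ ∞ := by
    rwa [lintegral_tsum fun k => (hm k).enorm]
  filter_upwards [ae_lt_top' (AEMeasurable.tsum fun k => (hm k).enorm) h1] with x hx
  exact Summable.of_enorm hx.ne

/-- Iterating the approximation writes `f` as a sum of elements of `H^{1,∞}` whose norms decay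
geometrically. -/
lemma atbENorm_top_le_of_le_two (d n : ℕ) (hn : 1 ≤ n) (hnd : n ≤ d) (c : ℝ≥0) (hp1 : 1 < p)
    (hp2 : p ≤ 2) :
    ∃ K : ℝ≥0, 1 ≤ K ∧ ∀ μ : Measure (Fin d → ℝ), CubeGrowth n c μ → μ ≠ 0 →
      ∀ f : Hatb n p μ, atbENorm n ∞ μ f.1 ≤ K * atbENorm n p μ f.1 := by
  obtain ⟨K, hK1, hK⟩ := exists_approx_top d n hn hnd c hp1 hp2
  refine ⟨K * 2, hK1.trans (le_mul_of_one_le_right zero_le (by norm_num)), fun μ hG hμ f => ?_⟩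
  choose φ hφ1 hφ2 using hK μ hG hμ
  -- the remainders of the iteration
  set F : ℕ → Hatb n p μ := fun k => (fun a => a - φ a)^[k] f with hF
  have hF0 : F 0 = f := rfl
  have hFs : ∀ k, F (k + 1) = F k - φ (F k) := fun k => Function.iterate_succ_apply' _ _ _
  have hFn : ∀ k, ‖F k‖ₑ ≤ 2⁻¹ ^ k * ‖f‖ₑ := by
    intro k
    induction k with
    | zero => simp [hF0]
    | succ k ih =>
      rw [hFs, pow_succ', mul_assoc]
      exact (hφ2 _).trans (mul_le_mul_right ih _)
  have hgeo : ∑' k : ℕ, (2⁻¹ : ℝ≥0∞) ^ k * ‖f‖ₑ = 2 * ‖f‖ₑ := by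
    rw [ENNReal.tsum_mul_right, ENNReal.tsum_geometric, ENNReal.one_sub_inv_two, inv_inv]
  have hφn : ∑' k, atbENorm n ∞ μ (φ (F k)).1 ≤ K * 2 * atbENorm n p μ f.1 := by
    calc ∑' k, atbENorm n ∞ μ (φ (F k)).1 ≤ ∑' k : ℕ, K * ((2⁻¹ : ℝ≥0∞) ^ k * ‖f‖ₑ) :=
          ENNReal.tsum_le_tsum fun k => (hφ1 _).trans (mul_le_mul_right (hFn k) _)
      _ = K * 2 * atbENorm n p μ f.1 := by
          rw [ENNReal.tsum_mul_left, hgeo, ← Hatb.enorm_eq, mul_assoc]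
  have hftop : K * 2 * atbENorm n p μ f.1 ≠ ∞ :=
    ENNReal.mul_ne_top (by finiteness) (ne_of_lt f.2)
  have hsF : ∀ᵐ x ∂μ, Summable fun k => (F k).1 x := by
    refine ae_summable_of_tsum_lintegral (fun k => (F k).1.aestronglyMeasurable)
      (ne_top_of_le_ne_top (b := 2 * ‖f‖ₑ) (ENNReal.mul_ne_top (by norm_num) enorm_ne_top) ?_)
    rw [← hgeo]
    refine ENNReal.tsum_le_tsum fun k => (lintegral_enorm_le_atbENorm (n := n) hp1 _).trans ?_
    rw [← Hatb.enorm_eq]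
    exact hFn k
  have hsφ : ∀ᵐ x ∂μ, Summable fun k => (φ (F k)).1 x := by
    refine ae_summable_of_tsum_lintegral (fun k => (φ (F k)).1.aestronglyMeasurable)
      (ne_top_of_le_ne_top hftop (le_trans ?_ hφn))
    exact ENNReal.tsum_le_tsum fun k => lintegral_enorm_le_atbENorm (n := n) ENNReal.one_lt_top _
  have hstep : ∀ᵐ x ∂μ, ∀ k, (F (k + 1)).1 x = (F k).1 x - (φ (F k)).1 x := by
    rw [ae_all_iff]
    intro k
    filter_upwards [AEEqFun.coeFn_sub (F k).1 (φ (F k)).1] with x hx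
    rw [hFs]
    exact hx
  have hsum : ∀ᵐ x ∂μ, HasSum (fun k => (φ (F k)).1 x) (f.1 x) := by
    filter_upwards [hsF, hsφ, hstep] with x h1 h2 h3
    have h4 : ∀ k, ∑ i ∈ Finset.range k, (φ (F i)).1 x = f.1 x - (F k).1 x := by
      intro k
      induction k with
      | zero => simp [hF0]
      | succ k ih => rw [Finset.sum_range_succ, ih, h3 k]; ring
    have h5 : Tendsto (fun k => ∑ i ∈ Finset.range k, (φ (F i)).1 x) atTop (𝓝 (f.1 x - 0)) := by
      simp only [h4]
      exact h1.tendsto_atTop_zero.const_sub _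
    rw [sub_zero] at h5
    rw [← tendsto_nhds_unique h2.hasSum.tendsto_sum_nat h5]
    exact h2.hasSum
  exact (atbENorm_le_tsum ENNReal.one_lt_top hsum).trans hφn

/-- The spaces `H^{1,p}`, `1 < p < ∞`, have norms equivalent to that of `H^{1,∞}`. -/
lemma exists_atbENorm_top_le (d n : ℕ) (hn : 1 ≤ n) (hnd : n ≤ d) (c : ℝ≥0) (hp1 : 1 < p) :
    ∃ K : ℝ≥0, 1 ≤ K ∧ ∀ μ : Measure (Fin d → ℝ), CubeGrowth n c μ →
      ∀ f : (Fin d → ℝ) →ₘ[μ] ℝ, atbENorm n ∞ μ f ≤ K * atbENorm n p μ f := by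
  -- for `p > 2`, the norm of `H^{1,p}` dominates that of `H^{1,2}`
  have hr1 : 1 < min p 2 := lt_min hp1 (by norm_num)
  obtain ⟨K, hK1, hK⟩ := atbENorm_top_le_of_le_two d n hn hnd c hr1 (min_le_right p 2)
  refine ⟨K, hK1, fun μ hG f => ?_⟩
  have hloc := hG.isLocallyFiniteMeasure
  rcases eq_or_ne μ 0 with rfl | hμ
  · have : atbENorm n ∞ (0 : Measure (Fin d → ℝ)) f = 0 := by
      rw [← atbENorm_zero (n := n) (p := ∞) (μ := (0 : Measure (Fin d → ℝ)))]
      exact atbENorm_congr (by simp [EventuallyEq])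
    rw [this]
    exact zero_le
  rcases eq_or_ne (atbENorm n p μ f) ∞ with htop | htop
  · rw [htop, ENNReal.mul_top (ENNReal.coe_ne_zero.2 (one_pos.trans_le hK1).ne')]
    exact le_top
  have hle := atbENorm_mono (n := n) (μ := μ) (min_le_left p 2) hr1.le f
  exact (hK μ hG hμ ⟨f, hle.trans_lt htop.lt_top⟩).trans (mul_le_mul_right hle _)

/-! ### The dual of `H^{1,∞}` -/

lemma IsBoundedCompSupp.integrable_mul {f g : (Fin d → ℝ) → ℝ} (hf : IsBoundedCompSupp μ f)
    (hg : LocallyIntegrable g μ) : Integrable (fun x => f x * g x) μ := by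
  obtain ⟨hf1, S, hS, hfS⟩ := hf
  have h1 : IntegrableOn (fun x => f x * g x) S μ := by
    have h2 : ∀ᵐ x ∂μ, ‖f x‖ ≤ (eLpNorm f ∞ μ).toReal := by
      filter_upwards [ae_le_eLpNormEssSup (f := f) (μ := μ)] with x hx
      rw [← eLpNorm_exponent_top] at hx
      rw [← toReal_enorm]
      exact ENNReal.toReal_mono hf1.2.ne hx
    exact Integrable.bdd_mul (hg.integrableOn_isCompact hS) hf1.1.restrict
      (ae_restrict_of_ae h2)
  refine h1.integrable_of_ae_notMem_eq_zero ?_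
  filter_upwards [hfS] with x hx hxS
  rw [hx hxS, zero_mul]

/-- The pairing of a bounded function of compact support in `H^{1,∞}` with an `RBMO` function is
controlled by the product of the norms. -/
lemma enorm_integral_mul_le (hd : 1 ≤ d) (hnd : n ≤ d) (hG : CubeGrowth n c μ) {A : ℝ≥0}
    {f g : (Fin d → ℝ) → ℝ} (hg : IsRBMOWith n μ A g) (hf : IsBoundedCompSupp μ f)
    (hfin : atbENorm n ∞ μ f < ∞) :
    ‖∫ x, f x * g x ∂μ‖ₑ ≤ (2 * tildeConst n c : ℝ≥0) * A * atbENorm n ∞ μ f := by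
  have hosc := hg.oscData hd hnd hG
  have hgm : AEStronglyMeasurable g μ := hg.locInt.aestronglyMeasurable
  -- the pairing of `f` with a bounded function can be computed block by block
  have htrunc : ∀ m : ℕ, ‖∫ x, f x * clip m (g x) ∂μ‖ₑ ≤
      (2 * tildeConst n c : ℝ≥0) * A * atbENorm n ∞ μ f := by
    intro m
    have hm : (0 : ℝ) ≤ m := m.cast_nonneg
    have hclip := hosc.clip hm
    have := enorm_integral_mul_le_of_blocks (n := n) (p := ∞) (K := 2 * tildeConst n c * A)
      ENNReal.one_lt_top ((continuous_clip m).comp_aestronglyMeasurable hgm)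
      (fun x => abs_clip_le hm (g x)) (fun B hB => ?_) hfin
    · rwa [ENNReal.coe_mul] at this
    · refine (B.enorm_integral_mul_le (q := 1) (C := 1) ENNReal.one_lt_top hclip
        (fun Q => ?_) hB).2.trans (le_of_eq ?_)
      · rw [eLpNorm_one_eq_lintegral_enorm, inv_one, ENNReal.toReal_one, ENNReal.rpow_one,
          ENNReal.coe_one, one_mul]
        exact hclip.osc Q
      · push_cast
        ring
  have hint := hf.integrable_mul hg.locInt
  have hlim : Tendsto (fun m : ℕ => ∫ x, f x * clip m (g x) ∂μ) atTop
      (𝓝 (∫ x, f x * g x ∂μ)) := by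
    refine tendsto_integral_of_dominated_convergence (fun x => ‖f x * g x‖) (fun m => ?_)
      hint.norm (fun m => Eventually.of_forall fun x => ?_) (Eventually.of_forall fun x => ?_)
    · exact hf.1.1.mul ((continuous_clip m).comp_aestronglyMeasurable hgm)
    · rw [norm_mul, norm_mul]
      exact mul_le_mul_of_nonneg_left (abs_clip_le_abs m.cast_nonneg _) (norm_nonneg _)
    · exact (tendsto_clip (g x)).const_mul _
  exact le_of_tendsto' ((continuous_enorm.tendsto _).comp hlim) htrunc

/-- The classes in `H^{1,∞}` of bounded functions with compact support. -/
def boundedCompSupp (n : ℕ) (μ : Measure (Fin d → ℝ)) : Submodule ℝ (Hatb n ∞ μ) where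
  carrier := {f | IsBoundedCompSupp μ f.1}
  zero_mem' := IsBoundedCompSupp.zero.congr AEEqFun.coeFn_zero.symm
  add_mem' {f g} hf hg := (IsBoundedCompSupp.add hf hg).congr (AEEqFun.coeFn_add f.1 g.1).symm
  smul_mem' t f hf := (IsBoundedCompSupp.const_smul hf t).congr (AEEqFun.coeFn_smul t f.1).symm

lemma ae_eq_of_measure_eq_zero (hμ : μ = 0) (f g : (Fin d → ℝ) → ℝ) : f =ᵐ[μ] g := by
  simp [EventuallyEq, hμ]

/-- For `p = ∞` the density follows from that in `H^{1,2}`, since the norms are equivalent. -/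
lemma dense_boundedCompSupp (hn : 1 ≤ n) (hnd : n ≤ d) (hG : CubeGrowth n c μ) :
    Dense (boundedCompSupp n μ : Set (Hatb n ∞ μ)) := by
  have hloc := hG.isLocallyFiniteMeasure
  intro f
  rcases eq_or_ne μ 0 with hμ | hμ
  · have : f = 0 := Hatb.ext (ae_eq_of_measure_eq_zero hμ _ _)
    rw [this]
    exact subset_closure (boundedCompSupp n μ).zero_mem
  obtain ⟨K, hK1, hK⟩ := exists_atbENorm_top_le (p := 2) d n hn hnd c (by norm_num)
  rw [EMetric.mem_closure_iff]
  intro ε hε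
  obtain ⟨δ, hδ0, hδ⟩ : ∃ δ : ℝ≥0∞, δ ≠ 0 ∧ K * δ < ε := by
    obtain ⟨e, he0, he⟩ := ENNReal.lt_iff_exists_nnreal_btwn.1 hε
    refine ⟨(e / K : ℝ≥0), ENNReal.coe_ne_zero.2 (div_pos (ENNReal.coe_pos.1 he0)
      (one_pos.trans_le hK1)).ne', ?_⟩
    rwa [← ENNReal.coe_mul, mul_div_cancel₀ _ (one_pos.trans_le hK1).ne']
  have hf2 : atbENorm n 2 μ f.1 < ∞ := (atbENorm_mono le_top (by norm_num) _).trans_lt f.2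
  obtain ⟨v, hv, hfv⟩ := exists_boundedCompSupp_approx hn hG hμ (by norm_num) (by norm_num) hf2 hδ0
  have hvm : AEStronglyMeasurable v μ := hv.1.1
  have hae : (f.1 - AEEqFun.mk v hvm : (Fin d → ℝ) →ₘ[μ] ℝ) =ᵐ[μ] f.1 - v := by
    filter_upwards [AEEqFun.coeFn_sub f.1 (AEEqFun.mk v hvm), AEEqFun.coeFn_mk v hvm] with x h1 h2
    rw [h1, Pi.sub_apply, h2, Pi.sub_apply]
  have hlt : atbENorm n ∞ μ (f.1 - AEEqFun.mk v hvm : (Fin d → ℝ) →ₘ[μ] ℝ) < ε := by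
    refine (hK μ hG _).trans_lt (lt_of_le_of_lt ?_ hδ)
    rw [atbENorm_congr hae]
    gcongr
  have hwmem : (f.1 - AEEqFun.mk v hvm : (Fin d → ℝ) →ₘ[μ] ℝ) ∈ Hatb n ∞ μ :=
    hlt.trans_le le_top
  set w : Hatb n ∞ μ := ⟨_, hwmem⟩ with hw
  refine ⟨f - w, ?_, ?_⟩
  · refine hv.congr ?_
    have : (f - w).1 = AEEqFun.mk v hvm := sub_sub_cancel f.1 (AEEqFun.mk v hvm)
    rw [this]
    exact (AEEqFun.coeFn_mk v hvm).symm
  · rw [edist_eq_enorm_sub, sub_sub_cancel, Hatb.enorm_eq]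
    exact hlt

lemma eq_of_eqOn_boundedCompSupp (hn : 1 ≤ n) (hnd : n ≤ d) (hG : CubeGrowth n c μ)
    {ℓ ℓ' : StrongDual ℝ (Hatb n ∞ μ)}
    (h : ∀ f : Hatb n ∞ μ, IsBoundedCompSupp μ f.1 → ℓ f = ℓ' f) : ℓ = ℓ' := by
  refine ContinuousLinearMap.ext_on (s := (boundedCompSupp n μ : Set (Hatb n ∞ μ))) ?_ h
  rw [Submodule.span_eq]
  exact dense_boundedCompSupp hn hnd hG

lemma nnnorm_le_of_boundedCompSupp (hn : 1 ≤ n) (hnd : n ≤ d) (hG : CubeGrowth n c μ)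
    {ℓ : StrongDual ℝ (Hatb n ∞ μ)} {t : ℝ≥0}
    (h : ∀ f : Hatb n ∞ μ, IsBoundedCompSupp μ f.1 → ‖ℓ f‖ₑ ≤ t * ‖f‖ₑ) : ‖ℓ‖₊ ≤ t := by
  refine ℓ.opNNNorm_le_bound t fun f => ?_
  have hcl : IsClosed {f : Hatb n ∞ μ | ‖ℓ f‖₊ ≤ t * ‖f‖₊} :=
    isClosed_le (by fun_prop) (by fun_prop)
  refine (dense_boundedCompSupp hn hnd hG).induction (P := fun f => ‖ℓ f‖₊ ≤ t * ‖f‖₊)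
    (fun x hx => ?_) hcl f
  have := h x hx
  rw [enorm_eq_nnnorm, enorm_eq_nnnorm] at this
  exact_mod_cast this

/-- Integration against an `RBMO` function extends from the bounded functions with compact support to
a continuous functional on `H^{1,∞}`. -/
lemma exists_functional (hn : 1 ≤ n) (hnd : n ≤ d) (hG : CubeGrowth n c μ) {A : ℝ≥0}
    {g : (Fin d → ℝ) → ℝ} (hg : IsRBMOWith n μ A g) :
    ∃ ℓ : StrongDual ℝ (Hatb n ∞ μ), ∀ f : Hatb n ∞ μ, IsBoundedCompSupp μ f.1 →
      ℓ f = ∫ x, f.1 x * g x ∂μ := by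
  set D := boundedCompSupp n μ
  set ℓ₀ : D →ₗ[ℝ] ℝ :=
    { toFun := fun f => ∫ x, f.1.1 x * g x ∂μ
      map_add' := fun f f' => by
        rw [← integral_add (IsBoundedCompSupp.integrable_mul f.2 hg.locInt)
          (IsBoundedCompSupp.integrable_mul f'.2 hg.locInt)]
        refine integral_congr_ae ?_
        filter_upwards [AEEqFun.coeFn_add f.1.1 f'.1.1] with x hx
        change (f.1.1 + f'.1.1 : (Fin d → ℝ) →ₘ[μ] ℝ) x * g x = _
        rw [hx, Pi.add_apply, add_mul]
      map_smul' := fun t f => by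
        rw [RingHom.id_apply, smul_eq_mul, ← integral_const_mul]
        refine integral_congr_ae ?_
        filter_upwards [AEEqFun.coeFn_smul t f.1.1] with x hx
        change (t • f.1.1 : (Fin d → ℝ) →ₘ[μ] ℝ) x * g x = _
        rw [hx, Pi.smul_apply, smul_eq_mul, mul_assoc] } with hℓ₀
  have hbound : ∀ f : D, ‖ℓ₀ f‖ ≤ (2 * tildeConst n c * A : ℝ≥0) * ‖f‖ := by
    intro f
    have h1 := enorm_integral_mul_le (hn.trans hnd) hnd hG hg f.2 f.1.2
    rw [← Hatb.enorm_eq, enorm_eq_nnnorm, enorm_eq_nnnorm] at h1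
    have h2 : ‖ℓ₀ f‖₊ ≤ 2 * tildeConst n c * A * ‖f.1‖₊ := by exact_mod_cast h1
    exact_mod_cast h2
  set ℓ₁ : D →L[ℝ] ℝ := ℓ₀.mkContinuous _ hbound with hℓ₁
  have hdr : DenseRange D.subtypeL := by
    change Dense (range (Subtype.val : D → Hatb n ∞ μ))
    rw [Subtype.range_coe]
    exact dense_boundedCompSupp hn hnd hG
  have hui : IsUniformInducing D.subtypeL := isUniformInducing_val _
  refine ⟨ℓ₁.extend D.subtypeL, fun f hf => ?_⟩
  exact ContinuousLinearMap.extend_eq ℓ₁ hdr hui ⟨f, hf⟩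

/-- The dual of `H^{1,∞}` consists of the functionals given by `RBMO` functions: by the equivalence of
norms, a functional on `H^{1,∞}` is a functional on `H^{1,2}`, where the Riesz representation
applies. -/
lemma exists_rbmo_of_dual (hn : 1 ≤ n) (hnd : n ≤ d) (hG : CubeGrowth n c μ) (hμ : μ ≠ 0)
    (ℓ : StrongDual ℝ (Hatb n ∞ μ)) :
    ∃ g : (Fin d → ℝ) → ℝ, IsRBMOWith n μ (‖ℓ‖₊ * testConst d c) g ∧
      ∀ f : Hatb n ∞ μ, IsBoundedCompSupp μ f.1 → ℓ f = ∫ x, f.1 x * g x ∂μ := by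
  have hloc := hG.isLocallyFiniteMeasure
  obtain ⟨K, -, hK⟩ := exists_atbENorm_top_le (p := 2) d n hn hnd c (by norm_num)
  have hfin : ∀ f : Hatb n 2 μ, atbENorm n ∞ μ f.1 < ∞ := fun f =>
    (hK μ hG f.1).trans_lt (ENNReal.mul_lt_top ENNReal.coe_lt_top f.2)
  set ι₀ : Hatb n 2 μ →ₗ[ℝ] Hatb n ∞ μ :=
    { toFun := fun f => ⟨f.1, hfin f⟩, map_add' := fun _ _ => rfl, map_smul' := fun _ _ => rfl }
  set ι : Hatb n 2 μ →L[ℝ] Hatb n ∞ μ := ι₀.mkContinuous K fun f => by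
    change (atbENorm n ∞ μ f.1).toReal ≤ K * (atbENorm n 2 μ f.1).toReal
    rw [← ENNReal.coe_toReal, ← ENNReal.toReal_mul]
    exact ENNReal.toReal_mono (ENNReal.mul_lt_top ENNReal.coe_lt_top f.2).ne (hK μ hG f.1)
  obtain ⟨g, hg, hrep⟩ := exists_rbmo_representation hn hnd hG hμ (by norm_num) le_rfl (ℓ.comp ι)
    (M := ‖ℓ‖₊) fun f => enorm_apply_le ℓ (ι f)
  refine ⟨g, hg, fun f hf => ?_⟩
  have hf2 : atbENorm n 2 μ f.1 < ∞ := (atbENorm_mono le_top (by norm_num) _).trans_lt f.2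
  obtain ⟨S, hS, hfS⟩ := hf.2
  obtain ⟨x₀, hx₀⟩ := exists_mem_support hμ
  obtain ⟨r, hr⟩ := hS.isBounded.subset_closedBall x₀
  refine hrep ⟨f.1, hf2⟩ (.cube x₀ (2 * (|r| + 1)) hx₀ (by positivity)) hf.memLp_two ?_
  filter_upwards [hfS] with x hx hxR
  refine hx fun hxS => hxR (Metric.closedBall_subset_closedBall ?_ (hr hxS))
  have := le_abs_self r
  linarith

/-- A function that pairs to zero with all bounded functions of compact support in `H^{1,∞}` is
constant: its oscillation on every cube vanishes. -/
lemma exists_ae_eq_const (hn : 1 ≤ n) (hnd : n ≤ d) (hG : CubeGrowth n c μ) (hμ : μ ≠ 0)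
    {h : (Fin d → ℝ) → ℝ} (hh : LocallyIntegrable h μ)
    (h0 : ∀ f : Hatb n ∞ μ, IsBoundedCompSupp μ f.1 → ∫ x, f.1 x * h x ∂μ = 0) :
    ∃ k : ℝ, ∀ᵐ x ∂μ, h x = k := by
  have hloc := hG.isLocallyFiniteMeasure
  obtain ⟨x₀, hx₀⟩ := exists_mem_support hμ
  have hcube : ∀ (l : ℝ) (hl : 0 < l), ∃ m : ℝ,
      ∀ᵐ x ∂μ, x ∈ Metric.closedBall x₀ (l / 2) → h x = m := by
    intro l hl
    set Q : Cube μ := .cube x₀ l hx₀ hl with hQ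
    have hcpt : IsCompact Q.tilde.toSet := by
      rw [Q.tilde_eq, hQ]
      exact isCompact_closedBall _ _
    have h1 := lintegral_sub_average_tilde_le (M := 0) hn hnd hG hμ Q
      (hh.integrableOn_isCompact hcpt) fun f hf hfs hf0 => by
        have hfin := atbENorm_lt_top_of_support hn hG hμ hf hfs hf0
        have hae := coeFn_toHatb hf.1 hfin
        have hbc : IsBoundedCompSupp μ f := ⟨hf, _, hcpt, Eventually.of_forall fun x hx => by
          by_contra hne
          exact hx (hfs hne)⟩
        have h2 := h0 _ (hbc.congr hae.symm)
        rw [integral_congr_ae (g := fun x => f x * h x) (by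
          filter_upwards [hae] with x hx
          rw [hx])] at h2
        rw [h2, enorm_zero]
        exact zero_le
    rw [ENNReal.coe_zero, zero_mul, zero_mul, nonpos_iff_eq_zero, lintegral_eq_zero_iff'] at h1
    · refine ⟨⨍ y in Q.tilde.toSet, h y ∂μ,
        ((ae_restrict_iff' Q.measurableSet).1 h1).mono fun x hx hxQ => ?_⟩
      have h3 := hx hxQ
      rw [Pi.zero_apply, enorm_eq_zero] at h3
      exact sub_eq_zero.1 h3
    · exact (((hh.integrableOn_isCompact hcpt).mono_set
        Q.toSet_subset_tilde).aestronglyMeasurable.sub aestronglyMeasurable_const).enorm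
  choose m hm using fun k : ℕ => hcube (k + 1) (by positivity)
  have hconst : ∀ k, m k = m 0 := by
    intro k
    have h1 : μ (Metric.closedBall x₀ (((0 : ℕ) + 1 : ℝ) / 2)) ≠ 0 :=
      (measure_closedBall_pos_of_mem_support hx₀ (by norm_num)).ne'
    have h2 : ∃ᵐ x ∂μ, x ∈ Metric.closedBall x₀ (((0 : ℕ) + 1 : ℝ) / 2) :=
      frequently_ae_mem_iff.2 h1
    obtain ⟨x, hx, hx1, hx2⟩ := (h2.and_eventually ((hm 0).and (hm k))).exists
    have hk : (((0 : ℕ) : ℝ) + 1) / 2 ≤ ((k : ℝ) + 1) / 2 := by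
      have : (0 : ℝ) ≤ k := k.cast_nonneg
      rw [Nat.cast_zero]
      linarith
    rw [← hx1 hx, ← hx2 (Metric.closedBall_subset_closedBall hk hx)]
  refine ⟨m 0, ?_⟩
  filter_upwards [ae_all_iff.2 hm] with x hx
  obtain ⟨k, hk⟩ := exists_nat_ge (2 * dist x x₀)
  rw [hx k (by rw [Metric.mem_closedBall]; linarith), hconst]

lemma IsRBMOWith.const [IsLocallyFiniteMeasure μ] (hμ : μ ≠ 0) (k : ℝ) :
    IsRBMOWith n μ 0 (fun _ => k) := by
  have havg : ∀ Q : Cube μ, ⨍ _ in Q.toSet, k ∂μ = k := fun Q =>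
    setAverage_const (Q.measure_pos hμ).ne' Q.measure_lt_top.ne k
  refine ⟨locallyIntegrable_const k, fun Q => ?_, fun Q R _ _ _ => ?_⟩
  · simp [havg]
  · simp [havg]

/-- The duality between `H^{1,∞}` and `RBMO`. -/
lemma exists_duality (d n : ℕ) (hn : 1 ≤ n) (hnd : n ≤ d) (c : ℝ≥0) :
    ∃ C : ℝ≥0, ∀ μ : Measure (Fin d → ℝ), CubeGrowth n c μ →
      ∃ L : RBMO n μ →ₗ[ℝ] StrongDual ℝ (Hatb n ∞ μ),
        (∀ (g : RBMO n μ) (ℓ : StrongDual ℝ (Hatb n ∞ μ)),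
          ℓ = L g ↔ ∀ f : Hatb n ∞ μ, IsBoundedCompSupp μ f.1 → ℓ f = ∫ x, f.1 x * g.1 x ∂μ) ∧
        Function.Surjective L ∧
        (∀ g : RBMO n μ, L g = 0 ↔ ∃ c : ℝ, ∀ᵐ x ∂μ, g.1 x = c) ∧
        (∀ g : RBMO n μ, ‖L g‖ ≤ C * rbmoNorm n μ g.1 ∧ rbmoNorm n μ g.1 ≤ C * ‖L g‖) := by
  refine ⟨2 * tildeConst n c + testConst d c, fun μ hG => ?_⟩
  have hloc := hG.isLocallyFiniteMeasure
  have hlocint : ∀ g : RBMO n μ, LocallyIntegrable g.1 μ := fun g => by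
    obtain ⟨A, hA⟩ := g.2
    exact hA.locInt
  have hex : ∀ g : RBMO n μ, ∃ ℓ : StrongDual ℝ (Hatb n ∞ μ), ∀ f : Hatb n ∞ μ,
      IsBoundedCompSupp μ f.1 → ℓ f = ∫ x, f.1 x * g.1 x ∂μ := fun g => by
    obtain ⟨A, hA⟩ := g.2
    exact exists_functional hn hnd hG hA
  choose Λ hΛ using hex
  have hchar : ∀ (g : RBMO n μ) (ℓ : StrongDual ℝ (Hatb n ∞ μ)), ℓ = Λ g ↔
      ∀ f : Hatb n ∞ μ, IsBoundedCompSupp μ f.1 → ℓ f = ∫ x, f.1 x * g.1 x ∂μ := by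
    refine fun g ℓ => ⟨?_, fun h => eq_of_eqOn_boundedCompSupp hn hnd hG fun f hf => ?_⟩
    · rintro rfl
      exact hΛ g
    · rw [h f hf, hΛ g f hf]
  set L : RBMO n μ →ₗ[ℝ] StrongDual ℝ (Hatb n ∞ μ) :=
    { toFun := Λ
      map_add' := fun g g' => by
        refine ((hchar _ _).2 fun f hf => ?_).symm
        rw [add_apply, hΛ g f hf, hΛ g' f hf,
          ← integral_add (hf.integrable_mul (hlocint g)) (hf.integrable_mul (hlocint g'))]
        refine integral_congr_ae ?_
        filter_upwards [AEEqFun.coeFn_add g.1 g'.1] with x hx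
        change _ = f.1 x * (g.1 + g'.1 : (Fin d → ℝ) →ₘ[μ] ℝ) x
        rw [hx, Pi.add_apply, mul_add]
      map_smul' := fun t g => by
        refine ((hchar _ _).2 fun f hf => ?_).symm
        rw [RingHom.id_apply, smul_apply, hΛ g f hf, smul_eq_mul,
          ← integral_const_mul]
        refine integral_congr_ae ?_
        filter_upwards [AEEqFun.coeFn_smul t g.1] with x hx
        change _ = f.1 x * (t • g.1 : (Fin d → ℝ) →ₘ[μ] ℝ) x
        rw [hx, Pi.smul_apply, smul_eq_mul]
        ring } with hL
  have hsub : ∀ f g : Hatb n ∞ μ, μ = 0 → f = g := fun f g hμ =>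
    Hatb.ext (ae_eq_of_measure_eq_zero hμ _ _)
  refine ⟨L, hchar, fun ℓ => ?_, fun g => ⟨fun h => ?_, ?_⟩, fun g => ⟨?_, ?_⟩⟩
  · rcases eq_or_ne μ 0 with hμ | hμ
    · refine ⟨0, ContinuousLinearMap.ext fun f => ?_⟩
      rw [hsub f 0 hμ, map_zero, map_zero]
    obtain ⟨g, hg, hrep⟩ := exists_rbmo_of_dual hn hnd hG hμ ℓ
    have hgm := hg.locInt.aestronglyMeasurable
    have hae := AEEqFun.coeFn_mk g hgm
    refine ⟨⟨AEEqFun.mk g hgm, _, hg.congr hae.symm⟩, ((hchar _ ℓ).2 fun f hf => ?_).symm⟩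
    rw [hrep f hf]
    refine integral_congr_ae ?_
    filter_upwards [hae] with x hx
    rw [hx]
  · rcases eq_or_ne μ 0 with hμ | hμ
    · exact ⟨0, ae_eq_of_measure_eq_zero hμ _ _⟩
    refine exists_ae_eq_const hn hnd hG hμ (hlocint g) fun f hf => ?_
    rw [← (hchar g (L g)).1 rfl f hf, h]
    rfl
  · rintro ⟨k, hk⟩
    refine ((hchar g 0).2 fun f _ => ?_).symm
    have h1 : ∫ x, f.1 x * g.1 x ∂μ = ∫ x, f.1 x * k ∂μ := by
      refine integral_congr_ae ?_
      filter_upwards [hk] with x hx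
      rw [hx]
    rw [h1, integral_mul_const, integral_eq_zero_of_atbENorm_lt_top ENNReal.one_lt_top f.2,
      zero_mul]
    rfl
  · have hle : ∀ A : ℝ≥0, IsRBMOWith n μ A g.1 → ‖L g‖₊ ≤ 2 * tildeConst n c * A := by
      refine fun A hA => nnnorm_le_of_boundedCompSupp hn hnd hG fun f hf => ?_
      rw [(hchar g (L g)).1 rfl f hf, Hatb.enorm_eq, ENNReal.coe_mul]
      exact enorm_integral_mul_le (hn.trans hnd) hnd hG hA hf f.2
    have hinf : ‖L g‖₊ ≤ 2 * tildeConst n c * sInf {A : ℝ≥0 | IsRBMOWith n μ A g.1} := by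
      have hne : {A : ℝ≥0 | IsRBMOWith n μ A g.1}.Nonempty := g.2
      rcases eq_or_ne (2 * tildeConst n c) 0 with h0 | h0
      · obtain ⟨A, hA⟩ := hne
        have := hle A hA
        rwa [h0, zero_mul] at this ⊢
      · rw [← div_le_iff₀' (pos_iff_ne_zero.2 h0)]
        exact le_csInf hne fun A hA => (div_le_iff₀' (pos_iff_ne_zero.2 h0)).2 (hle A hA)
    have hinf' : ‖L g‖ ≤ ((2 * tildeConst n c : ℝ≥0) : ℝ) * rbmoNorm n μ g.1 := by
      exact_mod_cast hinf
    refine hinf'.trans (mul_le_mul_of_nonneg_right ?_ (NNReal.coe_nonneg _))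
    exact_mod_cast le_self_add
  · have hkey : IsRBMOWith n μ (‖L g‖₊ * testConst d c) g.1 := by
      rcases eq_or_ne μ 0 with hμ | hμ
      · refine IsRBMOWith.congr (f := fun _ => 0) ?_ (ae_eq_of_measure_eq_zero hμ _ _)
        exact ⟨locallyIntegrable_zero, fun Q => by simp, fun Q R _ _ _ => by simp⟩
      obtain ⟨g', hg', hrep⟩ := exists_rbmo_of_dual hn hnd hG hμ (L g)
      obtain ⟨k, hk⟩ := exists_ae_eq_const hn hnd hG hμ ((hlocint g).sub hg'.locInt)
        fun f hf => by
          simp only [Pi.sub_apply, mul_sub]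
          rw [integral_sub (hf.integrable_mul (hlocint g)) (hf.integrable_mul hg'.locInt),
            ← hrep f hf, ← (hchar g (L g)).1 rfl f hf, sub_self]
      have h1 := hg'.add (IsRBMOWith.const (n := n) hμ k)
      rw [add_zero] at h1
      refine h1.congr ?_
      filter_upwards [hk] with x hx
      rw [Pi.sub_apply] at hx
      rw [Pi.add_apply, ← hx]
      ring
    have h1 : sInf {A : ℝ≥0 | IsRBMOWith n μ A g.1} ≤ ‖L g‖₊ * testConst d c :=
      csInf_le (OrderBot.bddBelow _) hkey
    have h2 : rbmoNorm n μ g.1 ≤ ‖L g‖ * testConst d c := by exact_mod_cast h1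
    refine h2.trans ?_
    rw [mul_comm]
    refine mul_le_mul_of_nonneg_right ?_ (norm_nonneg _)
    exact_mod_cast le_add_self

end NonDoubling

end

open NonDoubling in
theorem theorem5p2 (d n : ℕ) (hn : 1 ≤ n) (hnd : n ≤ d) (C₀ : ℝ) :
    (∀ p : ℝ≥0∞, 1 < p → p < ∞ →
      ∃ C : ℝ≥0, ∀ μ : Measure (Fin d → ℝ), Growth n C₀ μ →
        Hatb n p μ = Hatb n ∞ μ ∧
        ∀ f : (Fin d → ℝ) →ₘ[μ] ℝ,
          atbENorm n p μ f ≤ C * atbENorm n ∞ μ f ∧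
          atbENorm n ∞ μ f ≤ C * atbENorm n p μ f) ∧
    (∃ C : ℝ≥0, ∀ μ : Measure (Fin d → ℝ), Growth n C₀ μ →
      ∃ L : RBMO n μ →ₗ[ℝ] StrongDual ℝ (Hatb n ∞ μ),
        (∀ (g : RBMO n μ) (ℓ : StrongDual ℝ (Hatb n ∞ μ)),
          ℓ = L g ↔ ∀ f : Hatb n ∞ μ, IsBoundedCompSupp μ f.1 → ℓ f = ∫ x, f.1 x * g.1 x ∂μ) ∧
        Function.Surjective L ∧
        (∀ g : RBMO n μ, L g = 0 ↔ ∃ c : ℝ, ∀ᵐ x ∂μ, g.1 x = c) ∧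
        (∀ g : RBMO n μ, ‖L g‖ ≤ C * rbmoNorm n μ g.1 ∧ rbmoNorm n μ g.1 ≤ C * ‖L g‖)) := by
  refine ⟨fun p hp1 hp => ?_, ?_⟩
  · obtain ⟨K, hK1, hK⟩ := exists_atbENorm_top_le d n hn hnd (C₀.toNNReal * (d + 1) ^ n) hp1
    refine ⟨K, fun μ hμ => ?_⟩
    have hG := hμ.cubeGrowth
    have hloc := hG.isLocallyFiniteMeasure
    have hle : ∀ f : (Fin d → ℝ) →ₘ[μ] ℝ, atbENorm n p μ f ≤ atbENorm n ∞ μ f := fun f =>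
      atbENorm_mono le_top hp1.le f
    refine ⟨Submodule.ext fun f => ⟨fun h => ?_, fun h => (hle f).trans_lt h⟩, fun f =>
      ⟨(hle f).trans (le_mul_of_one_le_left zero_le (by exact_mod_cast hK1)), hK μ hG f⟩⟩
    exact (hK μ hG f).trans_lt (ENNReal.mul_lt_top ENNReal.coe_lt_top h)
  · obtain ⟨C, hC⟩ := exists_duality d n hn hnd (C₀.toNNReal * (d + 1) ^ n)
    exact ⟨C, fun μ hμ => hC μ hμ.cubeGrowth⟩
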